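/- **Setting.** $CC_\omega$ is the Calculus of Constructions with a cumulative predicative hierarchy of universes $\Box_i$ ($i\in\mathbb N$), with terms $\Box_i \mid x \mid M\,N \mid \lambda x:A.\,M \mid \Pi x:A.\,B$ (up to $\alpha$-equivalence), $\beta$-conversion, and typing $\Gamma\vdash M:A$. Write $\Gamma\vdash_u M:A$ for typing in its extension by dependent pairs $\Sigma$, the identity type $=$, $\eta$-conversion for functions, and the univalence axiom for every universe (a universe-polymorphic constant witnessing that the canonical map $A=B\to A\simeq B$ is an equivalence for all $A,B:\Box_i$); $\equiv$ is conversion in this extension. For $R:A\to B\to\Box_i$ let $R^{-1}$ be $R$ with its arguments swapped, and let $\mathrm{IsUMap}(R)$ be the type $$\Sigma (m:A\to B)\,(g_1:\Pi a\,b.\ m\,a=b\to R\,a\,b)\,(g_2:\Pi a\,b.\ R\,a\,b\to m\,a=b).\ \Pi a\,b\,(x:R\,a\,b).\ g_1\,a\,b\,(g_2\,a\,b\,x)=x .$$ Put $\mathrm{Param}^\top_i\,A\,B := \Sigma R:A\to B\to\Box_i.\ \mathrm{IsUMap}(R)\times\mathrm{IsUMap}(R^{-1})$, and let $\mathrm{Rel}$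 be the first projection. **Combinators.** A choice of combinators consists of terms $p^{\top,\top}_{\Box_i}$ ($i\in\mathbb N$) and a universe-polymorphic term $p^\top_\Pi$ such that for all $i$: * $\vdash_u p^{\top,\top}_{\Box_i}:\mathrm{Param}^\top_{i+1}\,\Box_i\,\Box_i$ and $\mathrm{Rel}(p^{\top,\top}_{\Box_i})\equiv \lambda A\,B:\Box_i.\ \mathrm{Param}^\top_i\,A\,B$; * for generic $A,A':\Box_i$, $A_R:\mathrm{Param}^\top_i\,A\,A'$, $B:A\to\Box_i$, $B':A'\to\Box_i$ and $B_R:\Pi(x:A)(x':A')(x_R:\mathrm{Rel}(A_R)\,x\,x').\ \mathrm{Param}^\top_i\,(B\,x)\,(B'\,x')$, $$\vdash_u p^\top_\Pi\,A_R\,B_R:\mathrm{Param}^\top_i\,(\Pi x:A.\,B\,x)\,(\Pi x':A'.\,B'\,x'),$$ $$\mathrm{Rel}(p^\top_\Pi\,A_R\,B_R)\equiv\lambda f\,f'.\ \Pi(x:A)(x':A')(x_R:\mathrm{Rel}(A_R)\,x\,x').\ \mathrm{Rel}(B_R\,x\,x'\,x_R)\,(f\,x)\,(f'\,x').$$ **Sequents.**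 A parametricity context $\Xi$ is a list of triples of variables $x\sim x'\because x_R$; it is well-formed ($\Xi\vdash$) if no variable occurs twice in it. The sequents $\Xi\vdash_u M\sim M'\because M_R$ are generated by the following rules, where bound variables are fresh: * $\Xi\vdash_u\Box_i\sim\Box_i\because p^{\top,\top}_{\Box_i}$; * $\Xi\vdash_u x\sim x'\because x_R$ if $(x,x',x_R)\in\Xi$ and $\Xi\vdash$; * from $\Xi\vdash_u M\sim M'\because M_R$ and $\Xi\vdash_u N\sim N'\because N_R$ infer $\Xi\vdash_u M\,N\sim M'\,N'\because M_R\,N\,N'\,N_R$; * from $\Xi\vdash_u A\sim A'\because A_R$ and $\Xi,\,x\sim x'\because x_R\vdash_u M\sim M'\because M_R$ infer $\Xi\vdash_u \lambda x:A.\,M\sim\lambda x':A'.\,M'\because\lambda(x:A)(x':A')(x_R:\mathrm{Rel}(A_R)\,x\,x').\,M_R$; * from $\Xi\vdash_u A\sim A'\because A_R$ and $\Xi,\,x\sim x'\because x_R\vdash_u B\sim B'\because B_R$ infer $\Xi\vdash_u \Pi x:A.\,B\sim\Pi x':A'.\,B'\because p^\top_\Pi\,A_R\,(\lambda x\,x'\,x_R.\,B_R)$.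 **Admissibility.** $\Gamma\rhd\Xi$ means: $\Xi$ is well-formed; $\Gamma$ is a well-formed context (for $\vdash_u$); and for each $(x,x',x_R)\in\Xi$ the variables $x,x',x_R$ are declared in $\Gamma$, $\Gamma(x)$ is a type of $CC_\omega$ (that is, $\Gamma\vdash\Gamma(x):\Box_i$ for some $i$) that has a translation in $\Xi$, and for all $A',A_R$ with $\Xi\vdash_u\Gamma(x)\sim A'\because A_R$ one has $\Gamma(x')=A'$ and $\Gamma(x_R)\equiv\mathrm{Rel}(A_R)\,x\,x'$. **Theorem (Univalent abstraction theorem).** A choice of combinators exists. Moreover, for every choice of combinators, if $$\Gamma\rhd\Xi,\qquad \Gamma\vdash M:A,\qquad \Xi\vdash_u M\sim M'\because M_R,\qquad \Xi\vdash_u A\sim A'\because A_R,$$ then $$\Gamma\vdash M':A'\qquad\text{and}\qquad \Gamma\vdash_u M_R:\mathrm{Rel}(A_R)\ M\ M'.$$ -/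

import Mathlib

namespace Trocq

/-! ## Terms

Raw terms, with de Bruijn indices (so that equality is equality up to renaming of bound variables).
The terms of `CC_ω` are those built from the first five constructors. The others (dependent pairs,
the identity type, and a constant for the univalence axiom) belong to the theory in which the
parametricity witnesses live. -/

/-- Raw terms. `lam A t`, `pi A B` and `sig A B` bind one variable in their last argument.
`split C d p` is the dependent eliminator of pairs (`C` binds the pair, `d` binds its two
components) and `idrec C d p` is based path induction (`C` binds the end point and the path). -/
inductive Term : Type
  | var (n : ℕ)
  | sort (i : ℕ)
  | app (t u : Term)
  | lam (A t : Term)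
  | pi (A B : Term)
  | sig (A B : Term)
  | pair (a b : Term)
  | fst (p : Term)
  | snd (p : Term)
  | split (C d p : Term)
  | id (A a b : Term)
  | refl (a : Term)
  | idrec (C d p : Term)
  | ua

namespace Term

/-- Lifting of a renaming under one binder. -/
def upRen (ρ : ℕ → ℕ) : ℕ → ℕ
  | 0 => 0
  | n + 1 => ρ n + 1

/-- Renaming of the free variables. -/
def rename : (ℕ → ℕ) → Term → Term
  | ρ, var n => var (ρ n)
  | _, sort i => sort i
  | ρ, app t u => app (rename ρ t) (rename ρ u)
  | ρ, lam A t => lam (rename ρ A) (rename (upRen ρ) t)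
  | ρ, pi A B => pi (rename ρ A) (rename (upRen ρ) B)
  | ρ, sig A B => sig (rename ρ A) (rename (upRen ρ) B)
  | ρ, pair a b => pair (rename ρ a) (rename ρ b)
  | ρ, fst p => fst (rename ρ p)
  | ρ, snd p => snd (rename ρ p)
  | ρ, split C d p =>
      split (rename (upRen ρ) C) (rename (upRen (upRen ρ)) d) (rename ρ p)
  | ρ, id A a b => id (rename ρ A) (rename ρ a) (rename ρ b)
  | ρ, refl a => refl (rename ρ a)
  | ρ, idrec C d p => idrec (rename (upRen (upRen ρ)) C) (rename ρ d) (rename ρ p)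
  | _, ua => ua

/-- Weakening by `k` variables. -/
def lift (k : ℕ) (t : Term) : Term := t.rename (fun n => n + k)

/-- Lifting of a substitution under one binder. -/
def upSub (σ : ℕ → Term) : ℕ → Term
  | 0 => var 0
  | n + 1 => (σ n).lift 1

/-- Simultaneous capture-avoiding substitution. -/
def subst : (ℕ → Term) → Term → Term
  | σ, var n => σ n
  | _, sort i => sort i
  | σ, app t u => app (subst σ t) (subst σ u)
  | σ, lam A t => lam (subst σ A) (subst (upSub σ) t)
  | σ, pi A B => pi (subst σ A) (subst (upSub σ) B)
  | σ, sig A B => sig (subst σ A) (subst (upSub σ) B)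
  | σ, pair a b => pair (subst σ a) (subst σ b)
  | σ, fst p => fst (subst σ p)
  | σ, snd p => snd (subst σ p)
  | σ, split C d p =>
      split (subst (upSub σ) C) (subst (upSub (upSub σ)) d) (subst σ p)
  | σ, id A a b => id (subst σ A) (subst σ a) (subst σ b)
  | σ, refl a => refl (subst σ a)
  | σ, idrec C d p => idrec (subst (upSub (upSub σ)) C) (subst σ d) (subst σ p)
  | _, ua => ua

/-- Extension of a substitution by a value for the variable `0`. -/
def scons (a : Term) (σ : ℕ → Term) : ℕ → Term
  | 0 => a
  | n + 1 => σ n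

/-- `t.inst a` is `t[x := a]`, where `x` is the last variable. -/
def inst (t a : Term) : Term := t.subst (scons a var)

/-- `t.inst₂ a b` is `t[x := a, y := b]`, where `x, y` are the last two variables, `y` last. -/
def inst₂ (t a b : Term) : Term := t.subst (scons b (scons a var))

/-- Application to two arguments. -/
def app₂ (t u v : Term) : Term := app (app t u) v

/-- Application to three arguments. -/
def app₃ (t u v w : Term) : Term := app (app (app t u) v) w

/-- Non-dependent function type `A → B`. -/
def arrow (A B : Term) : Term := pi A (B.lift 1)

/-- Non-dependent product `A × B`. -/
def prod (A B : Term) : Term := sig A (B.lift 1)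

/-! ### Equivalences and univalence -/

/-- `ap_f p : f x = y'` with `y' = f y`, for `f` with values in `B` and `p : x = y`. -/
def ap (B f x p : Term) : Term :=
  idrec (id (B.lift 2) (app (f.lift 2) (x.lift 2)) (app (f.lift 2) (var 1))) (refl (app f x)) p

/-- `f : A → B` is an equivalence:
`Σ (g : B → A) (s : Π a, g (f a) = a) (r : Π b, f (g b) = b), Π a, ap_f (s a) = r (f a)`. -/
def isEquiv (A B f : Term) : Term :=
  sig (arrow B A) <|
  sig (pi (A.lift 1) (id (A.lift 2) (app (var 1) (app (f.lift 2) (var 0))) (var 0))) <|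
  sig (pi (B.lift 2) (id (B.lift 3) (app (f.lift 3) (app (var 2) (var 0))) (var 0))) <|
  pi (A.lift 3) <|
    id (id (B.lift 4)
          (app (f.lift 4) (app (var 3) (app (f.lift 4) (var 0)))) (app (f.lift 4) (var 0)))
      (ap (B.lift 4) (f.lift 4) (app (var 3) (app (f.lift 4) (var 0))) (app (var 2) (var 0)))
      (app (var 1) (app (f.lift 4) (var 0)))

/-- `A ≃ B`, that is `Σ f : A → B, isEquiv f`. -/
def equiv (A B : Term) : Term :=
  sig (arrow A B) (isEquiv (A.lift 1) (B.lift 1) (var 0))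

/-- The identity equivalence of `A`. -/
def idEquiv (A : Term) : Term :=
  pair (lam A (var 0)) <| pair (lam A (var 0)) <| pair (lam A (refl (var 0))) <|
    pair (lam A (refl (var 0))) (lam A (refl (refl (var 0))))

/-- The canonical map `A = B → A ≃ B` applied to `p : A = B`. -/
def idToEquiv (A p : Term) : Term := idrec (equiv (A.lift 2) (var 1)) (idEquiv A) p

/-- The statement that the universe `□ᵢ` is univalent: for all `A B : □ᵢ`, the canonical map
`A = B → A ≃ B` is an equivalence. -/
def univalence (i : ℕ) : Term :=
  pi (sort i) <| pi (sort i) <|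
    isEquiv (id (sort i) (var 1) (var 0)) (equiv (var 1) (var 0))
      (lam (id (sort i) (var 1) (var 0)) (idToEquiv (var 2) (var 0)))

/-! ### Univalent maps and the relation `Param^⊤` -/

/-- `R : A → B → □` is a univalent map: `Σ (m : A → B) (g₁ : Π a b, m a = b → R a b)
(g₂ : Π a b, R a b → m a = b), Π a b (x : R a b), g₁ a b (g₂ a b x) = x`. -/
def isUMap (A B R : Term) : Term :=
  sig (arrow A B) <|
  sig (pi (A.lift 1) <| pi (B.lift 2) <|
    arrow (id (B.lift 3) (app (var 2) (var 1)) (var 0)) (app₂ (R.lift 3) (var 1) (var 0))) <|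
  sig (pi (A.lift 2) <| pi (B.lift 3) <|
    arrow (app₂ (R.lift 4) (var 1) (var 0)) (id (B.lift 4) (app (var 3) (var 1)) (var 0))) <|
  pi (A.lift 3) <| pi (B.lift 4) <| pi (app₂ (R.lift 5) (var 1) (var 0)) <|
    id (app₂ (R.lift 6) (var 2) (var 1))
      (app (app₂ (var 4) (var 2) (var 1)) (app (app₂ (var 3) (var 2) (var 1)) (var 0)))
      (var 0)

/-- The relation `R⁻¹ : B → A → □` obtained by swapping the arguments of `R : A → B → □`. -/
def flip (A B R : Term) : Term :=
  lam B (lam (A.lift 1) (app₂ (R.lift 2) (var 0) (var 1)))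

/-- `Param^⊤_i A B = Σ R : A → B → □ᵢ, isUMap R × isUMap R⁻¹`. -/
def param (i : ℕ) (A B : Term) : Term :=
  sig (arrow A (arrow B (sort i))) <|
    prod (isUMap (A.lift 1) (B.lift 1) (var 0))
      (isUMap (B.lift 1) (A.lift 1) (flip (A.lift 1) (B.lift 1) (var 0)))

/-- `Rel(r) u v`: the relation packed in `r : Param^⊤ A B`, applied to `u : A` and `v : B`. -/
def rel (r u v : Term) : Term := app₂ (fst r) u v

/-- `λ (x : A) (x' : A') (x_R : Rel(A_R) x x'), t`. -/
def lam₃ (A A' AR t : Term) : Term :=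
  lam A <| lam (A'.lift 1) <| lam (rel (AR.lift 2) (var 1) (var 0)) t

/-- `Π (x : A) (x' : A') (x_R : Rel(A_R) x x'), t`. -/
def pi₃ (A A' AR t : Term) : Term :=
  pi A <| pi (A'.lift 1) <| pi (rel (AR.lift 2) (var 1) (var 0)) t

end Term

open Term

/-! ## Typing -/

/-- The two theories: `CC_ω`, and its extension by dependent pairs, the identity type and the
univalence axiom. -/
inductive Theory : Type
  | ccω
  | univalent

/-- One-step reduction: `β` in `CC_ω`; in the univalent theory also `η` for functions and the
computation rules of pairs and of path induction. -/
inductive Step : Theory → Term → Term → Prop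
  | beta {T A t u} : Step T (app (lam A t) u) (t.inst u)
  | eta {A t} : Step .univalent (lam A (app (t.lift 1) (var 0))) t
  | fst_pair {a b} : Step .univalent (fst (pair a b)) a
  | snd_pair {a b} : Step .univalent (snd (pair a b)) b
  | split_pair {C d a b} : Step .univalent (split C d (pair a b)) (d.inst₂ a b)
  | idrec_refl {C d a} : Step .univalent (idrec C d (refl a)) d
  | app_left {T t t' u} : Step T t t' → Step T (app t u) (app t' u)
  | app_right {T t u u'} : Step T u u' → Step T (app t u) (app t u')
  | lam_dom {T A A' t} : Step T A A' → Step T (lam A t) (lam A' t)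
  | lam_body {T A t t'} : Step T t t' → Step T (lam A t) (lam A t')
  | pi_dom {T A A' B} : Step T A A' → Step T (pi A B) (pi A' B)
  | pi_cod {T A B B'} : Step T B B' → Step T (pi A B) (pi A B')
  | sig_dom {T A A' B} : Step T A A' → Step T (sig A B) (sig A' B)
  | sig_cod {T A B B'} : Step T B B' → Step T (sig A B) (sig A B')
  | pair_left {T a a' b} : Step T a a' → Step T (pair a b) (pair a' b)
  | pair_right {T a b b'} : Step T b b' → Step T (pair a b) (pair a b')
  | fst_arg {T p p'} : Step T p p' → Step T (fst p) (fst p')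
  | snd_arg {T p p'} : Step T p p' → Step T (snd p) (snd p')
  | split_motive {T C C' d p} : Step T C C' → Step T (split C d p) (split C' d p)
  | split_branch {T C d d' p} : Step T d d' → Step T (split C d p) (split C d' p)
  | split_arg {T C d p p'} : Step T p p' → Step T (split C d p) (split C d p')
  | id_type {T A A' a b} : Step T A A' → Step T (id A a b) (id A' a b)
  | id_left {T A a a' b} : Step T a a' → Step T (id A a b) (id A a' b)
  | id_right {T A a b b'} : Step T b b' → Step T (id A a b) (id A a b')
  | refl_arg {T a a'} : Step T a a' → Step T (refl a) (refl a')
  | idrec_motive {T C C' d p} : Step T C C' → Step T (idrec C d p) (idrec C' d p)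
  | idrec_branch {T C d d' p} : Step T d d' → Step T (idrec C d p) (idrec C d' p)
  | idrec_arg {T C d p p'} : Step T p p' → Step T (idrec C d p) (idrec C d p')

/-- Conversion `≡`: the equivalence relation generated by reduction. -/
def Conv (T : Theory) : Term → Term → Prop := Relation.EqvGen (Step T)

/-- Cumulativity: the preorder generated by conversion and `□ᵢ ≤ □ⱼ` for `i ≤ j`, propagated to
codomains of products and, in the univalent theory, to both components of dependent pair types. -/
inductive Cumul : Theory → Term → Term → Prop
  | conv {T A B} : Conv T A B → Cumul T A B
  | sort {T i j} : i ≤ j → Cumul T (sort i) (sort j)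
  | pi {T A A' B B'} : Conv T A A' → Cumul T B B' → Cumul T (pi A B) (pi A' B')
  | sig {A A' B B'} : Cumul .univalent A A' → Cumul .univalent B B' →
      Cumul .univalent (sig A B) (sig A' B')
  | trans {T A B C} : Cumul T A B → Cumul T B C → Cumul T A C

/-- Typing contexts, last declaration first; the type of a variable lives in the rest of the
list. -/
abbrev Ctx := List Term

/-- `Γ.HasVar n A`: the variable `n` is declared in `Γ`, and `Γ(n) = A` as a term over `Γ`. -/
def Ctx.HasVar (Γ : Ctx) (n : ℕ) (A : Term) : Prop := ∃ B, Γ[n]? = some B ∧ A = B.lift (n + 1)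

/-- Typing `Γ ⊢ t : A` in `CC_ω` (the rules for an arbitrary theory `T`) and `Γ ⊢_u t : A` in the
univalent theory (all rules). Well-formedness of contexts is the separate judgment `WfCtx`. The
constant `ua` is universe-polymorphic: it witnesses the univalence of every universe. -/
inductive Typing : Theory → Ctx → Term → Term → Prop
  | sort {T Γ i} : Typing T Γ (sort i) (sort (i + 1))
  | var {T Γ n A} : Ctx.HasVar Γ n A → Typing T Γ (var n) A
  | pi {T Γ A B i} : Typing T Γ A (sort i) → Typing T (A :: Γ) B (sort i) →
      Typing T Γ (pi A B) (sort i)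
  | lam {T Γ A B t i} : Typing T Γ A (sort i) → Typing T (A :: Γ) t B →
      Typing T Γ (lam A t) (pi A B)
  | app {T Γ A B t u} : Typing T Γ t (pi A B) → Typing T Γ u A →
      Typing T Γ (app t u) (B.inst u)
  | conv {T Γ A B t i} : Typing T Γ t A → Cumul T A B → Typing T Γ B (sort i) →
      Typing T Γ t B
  | sig {Γ A B i} : Typing .univalent Γ A (sort i) → Typing .univalent (A :: Γ) B (sort i) →
      Typing .univalent Γ (sig A B) (sort i)
  | pair {Γ A B a b i} : Typing .univalent Γ (sig A B) (sort i) → Typing .univalent Γ a A →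
      Typing .univalent Γ b (B.inst a) → Typing .univalent Γ (pair a b) (sig A B)
  | fst {Γ A B p} : Typing .univalent Γ p (sig A B) → Typing .univalent Γ (fst p) A
  | snd {Γ A B p} : Typing .univalent Γ p (sig A B) →
      Typing .univalent Γ (snd p) (B.inst (fst p))
  | split {Γ A B C d p i} : Typing .univalent Γ p (sig A B) →
      Typing .univalent (sig A B :: Γ) C (sort i) →
      Typing .univalent (B :: A :: Γ) d
        (C.subst (scons (pair (var 1) (var 0)) fun n => var (n + 2))) →
      Typing .univalent Γ (split C d p) (C.inst p)
  | id {Γ A a b i} : Typing .univalent Γ A (sort i) → Typing .univalent Γ a A →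
      Typing .univalent Γ b A → Typing .univalent Γ (id A a b) (sort i)
  | refl {Γ A a} : Typing .univalent Γ a A → Typing .univalent Γ (refl a) (id A a a)
  | idrec {Γ A C a b d p i} : Typing .univalent Γ p (id A a b) →
      Typing .univalent (id (A.lift 1) (a.lift 1) (var 0) :: A :: Γ) C (sort i) →
      Typing .univalent Γ d (C.inst₂ a (refl a)) →
      Typing .univalent Γ (idrec C d p) (C.inst₂ b p)
  | ua {Γ i} : Typing .univalent Γ ua (univalence i)

/-- Well-formed contexts of the univalent theory. -/
inductive WfCtx : Ctx → Prop
  | nil : WfCtx []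
  | cons {Γ A i} : WfCtx Γ → Typing .univalent Γ A (sort i) → WfCtx (A :: Γ)

/-! ## The combinators for universes and products -/

/-- A candidate for the terms `p_{□ᵢ}^{⊤,⊤}` (one for each universe) and for the term `p_Π^⊤`.
The latter is universe-polymorphic: it is one term in the six variables
`A, A', A_R, B, B', B_R`, which have the de Bruijn indices `5, 4, 3, 2, 1, 0`. -/
structure Combinators where
  pSort : ℕ → Term
  pPi : Term

/-- The term `p_Π^⊤ A_R B_R`, with the implicit arguments `A, A', B, B'` written out. -/
def Combinators.piWitness (p : Combinators) (A A' AR B B' BR : Term) : Term :=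
  p.pPi.subst <|
    scons BR <| scons B' <| scons B <| scons AR <| scons A' <| scons A <| var

/-- The context `A : □ᵢ, A' : □ᵢ, A_R : Param^⊤_i A A', B : A → □ᵢ, B' : A' → □ᵢ,
B_R : Π (x : A) (x' : A') (x_R : Rel(A_R) x x'), Param^⊤_i (B x) (B' x')`. -/
def piCtx (i : ℕ) : Ctx :=
  [pi₃ (var 4) (var 3) (var 2) (param i (app (var 4) (var 2)) (app (var 3) (var 1))),
   arrow (var 2) (sort i),
   arrow (var 2) (sort i),
   param i (var 1) (var 0),
   sort i,
   sort i]

/-- The relation `λ f f', Π (x : A) (x' : A') (x_R : Rel(A_R) x x'), Rel(B_R x x' x_R) (f x) (f' x')`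
between `Π x, B x` and `Π x', B' x'`. -/
def piRel (A A' AR B B' BR : Term) : Term :=
  lam (pi A (app (B.lift 1) (var 0))) <|
  lam (pi (A'.lift 1) (app (B'.lift 2) (var 0))) <|
    pi₃ (A.lift 2) (A'.lift 2) (AR.lift 2) <|
      rel (app₃ (BR.lift 5) (var 2) (var 1) (var 0)) (app (var 4) (var 2)) (app (var 3) (var 1))

/-- The specification of the combinators: `⊢_u p_{□ᵢ} : Param^⊤_{i+1} □ᵢ □ᵢ` with
`Rel(p_{□ᵢ}) ≡ Param^⊤_i`, and `p_Π A_R B_R : Param^⊤_i (Π x : A, B x) (Π x' : A', B' x')` for all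
related types and families at every level `i`, with the pointwise relation as its relation. -/
structure Combinators.IsUnivalent (p : Combinators) : Prop where
  sort_typing : ∀ i, Typing .univalent [] (p.pSort i) (param (i + 1) (sort i) (sort i))
  sort_rel : ∀ i, Conv .univalent (fst (p.pSort i))
    (lam (sort i) (lam (sort i) (param i (var 1) (var 0))))
  pi_typing : ∀ i, Typing .univalent (piCtx i) p.pPi
    (param i (pi (var 5) (app (var 3) (var 0))) (pi (var 4) (app (var 2) (var 0))))
  pi_rel : Conv .univalent (fst p.pPi) (piRel (var 5) (var 4) (var 3) (var 2) (var 1) (var 0))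

/-! ## Univalent parametricity sequents -/

/-- Parametricity contexts: lists of triples `(x, x', x_R)` of variables. -/
abbrev PCtx := List (ℕ × ℕ × ℕ)

/-- The sequence of the variables related in a parametricity context, with multiplicities. -/
def PCtx.vars (Ξ : PCtx) : List ℕ := Ξ.flatMap fun t => [t.1, t.2.1, t.2.2]

/-- A parametricity context is well-formed when its sequence of variables is duplicate-free. -/
def PCtx.Wf (Ξ : PCtx) : Prop := Ξ.vars.Nodup

/-- `Ξ, x ~ x' ∵ x_R` for three fresh variables `x, x', x_R`, which get the indices `2, 1, 0`. -/
def PCtx.ext (Ξ : PCtx) : PCtx :=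
  (2, 1, 0) :: Ξ.map fun t => (t.1 + 3, t.2.1 + 3, t.2.2 + 3)

/-- Moves a term in the scope of one more variable `x` into the scope of `x, x', x_R`. -/
def inX : ℕ → ℕ
  | 0 => 2
  | n + 1 => n + 3

/-- Moves a term in the scope of one more variable `x'` into the scope of `x, x', x_R`. -/
def inX' : ℕ → ℕ
  | 0 => 1
  | n + 1 => n + 3

/-- The univalent parametricity judgment `Ξ ⊢_u M ~ M' ∵ M_R`. -/
inductive UParam (p : Combinators) : PCtx → Term → Term → Term → Prop
  | sort {Ξ i} : UParam p Ξ (sort i) (sort i) (p.pSort i)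
  | var {Ξ x x' xR} : (x, x', xR) ∈ Ξ → PCtx.Wf Ξ → UParam p Ξ (var x) (var x') (var xR)
  | app {Ξ M M' MR N N' NR} : UParam p Ξ M M' MR → UParam p Ξ N N' NR →
      UParam p Ξ (app M N) (app M' N') (app₃ MR N N' NR)
  | lam {Ξ A A' AR M M' MR} : UParam p Ξ A A' AR →
      UParam p (PCtx.ext Ξ) (M.rename inX) (M'.rename inX') MR →
      UParam p Ξ (lam A M) (lam A' M') (lam₃ A A' AR MR)
  | pi {Ξ A A' AR B B' BR} : UParam p Ξ A A' AR →
      UParam p (PCtx.ext Ξ) (B.rename inX) (B'.rename inX') BR →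
      UParam p Ξ (pi A B) (pi A' B')
        (p.piWitness A A' AR (lam A B) (lam A' B') (lam₃ A A' AR BR))

/-- `Γ ▷ Ξ`: the parametricity context `Ξ` is admissible for the context `Γ`. Both are well-formed,
and for every `(x, x', x_R) ∈ Ξ` the three variables are declared in `Γ`, the type `Γ(x)` is a type
of `CC_ω` that has a translation in `Ξ`, and `Γ(x') = A'` and `Γ(x_R) ≡ Rel(A_R) x x'` whenever
`Ξ ⊢_u Γ(x) ~ A' ∵ A_R`. -/
structure Admissible (p : Combinators) (Γ : Ctx) (Ξ : PCtx) : Prop where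
  wf_pctx : PCtx.Wf Ξ
  wf_ctx : WfCtx Γ
  coherent : ∀ x x' xR, (x, x', xR) ∈ Ξ → ∃ B B' BR,
    Ctx.HasVar Γ x B ∧ Ctx.HasVar Γ x' B' ∧ Ctx.HasVar Γ xR BR ∧
    (∃ i, Typing .ccω Γ B (sort i)) ∧
    (∃ A' AR, UParam p Ξ B A' AR) ∧
    ∀ A' AR, UParam p Ξ B A' AR → B' = A' ∧ Conv .univalent BR (rel AR (var x) (var x'))

end Trocq

/-! The proof has two independent halves: a construction inside the univalent theory, which yields
the combinators, and a syntactic induction, which yields the abstraction theorem.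

Combinators. A relation is a univalent map exactly when its fibers Σ b, R a b are contractible
(`ofContrThm`, `toContrThm`). For products, fix a function f. Over each x' the elements x related to
x' form a contractible type, so the values at x' that are compatible with f form a contractible type
(`piFiberThm`); choice, a consequence of function extensionality, assembles them into functions
(`choiceThm`, `piContrThm`). Function extensionality is itself derived from univalence
(`funextThm`). For universes, the point is that Σ B, Param A B is contractible (`paramContrThm`). A
univalent relation comes from an equivalence (`equivThm`), and induction on equivalences reduces it
to a reflexive relation on A with contractible fibers, which equals the identity relation by
univalence and extensionality (`relPathThm`, `paramPathThm`). The remaining data are proofs that the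
relation and its inverse are univalent maps, and these are unique (`isPropUMapThm`).

All these arguments are explicit proof terms. They are accepted by a type checker that is proved
sound (`run_sound`) and evaluated by the kernel. They are written at the lowest level and raised by
`Typing.shift`. The combinator for products has to be the same term at all levels, so the proofs it
relies on mention no universe and are fixed by shifting.

Abstraction. Sequents are functional: M' is a renaming of M and M_R is the value at M of a recursive
function `tr` (`UParam.eq_tr`). Since `tr` commutes with substitution it preserves conversion, and
it turns cumulativity of types into cumulativity of the associated relations (`rel_tr_cumul`); an
induction on typing then gives `tr_typing`.

The obstacle is that Γ may declare variables without translation, and a derivation of M : A may pass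
through types that mention them. Derivations in `Ty` are confined to a set of variables. Confluence
of β, injectivity of products and subject reduction show that a judgment of `CC_ω` whose term and
type lie within the set has such a derivation (`Ty.of_typing_of_fv`). Admissibility becomes a typed
interpretation of the variables by recursion along Γ, from the oldest declarations to the newest
(`Admissible.related`). -/

namespace Trocq

open Term

namespace Term

/-! ## Substitution calculus -/

theorem upRen_comp (ρ ξ : ℕ → ℕ) : (fun n => upRen ρ (upRen ξ n)) = upRen (fun n => ρ (ξ n)) := by
  funext n; cases n <;> rfl

theorem rename_rename (t : Term) (ξ ρ : ℕ → ℕ) :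
    (t.rename ξ).rename ρ = t.rename (fun n => ρ (ξ n)) := by
  induction t generalizing ξ ρ <;> simp_all [rename, upRen_comp]

theorem upSub_var_comp (ρ : ℕ → ℕ) : upSub (fun n => var (ρ n)) = fun n => var (upRen ρ n) := by
  funext n; cases n <;> rfl

theorem rename_eq_subst (t : Term) (ρ : ℕ → ℕ) : t.rename ρ = t.subst (fun n => var (ρ n)) := by
  induction t generalizing ρ <;> simp_all [rename, subst, upSub_var_comp]

theorem lift_eq_subst (k : ℕ) (t : Term) : t.lift k = t.subst (fun n => var (n + k)) :=
  rename_eq_subst _ _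

theorem upSub_upRen (σ : ℕ → Term) (ξ : ℕ → ℕ) :
    (fun n => upSub σ (upRen ξ n)) = upSub (fun n => σ (ξ n)) := by
  funext n; cases n <;> rfl

theorem subst_rename (t : Term) (ξ : ℕ → ℕ) (σ : ℕ → Term) :
    (t.rename ξ).subst σ = t.subst (fun n => σ (ξ n)) := by
  induction t generalizing ξ σ <;> simp_all [rename, subst, upSub_upRen]

theorem rename_upSub (σ : ℕ → Term) (ρ : ℕ → ℕ) :
    (fun n => (upSub σ n).rename (upRen ρ)) = upSub (fun n => (σ n).rename ρ) := by
  funext n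
  cases n with
  | zero => rfl
  | succ n => simp only [upSub, lift, rename_rename]; rfl

theorem rename_subst (t : Term) (σ : ℕ → Term) (ρ : ℕ → ℕ) :
    (t.subst σ).rename ρ = t.subst (fun n => (σ n).rename ρ) := by
  induction t generalizing σ ρ <;> simp_all [rename, subst, rename_upSub]

theorem subst_upSub (σ τ : ℕ → Term) :
    (fun n => (upSub σ n).subst (upSub τ)) = upSub (fun n => (σ n).subst τ) := by
  funext n
  cases n with
  | zero => rfl
  | succ n => simp only [upSub, lift, subst_rename, rename_subst]

/-- Lifting a substitution under a binder renames its values, so the binder case rests on the two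
mixed laws between renamings and substitutions. -/
theorem subst_subst (t : Term) (σ τ : ℕ → Term) :
    (t.subst σ).subst τ = t.subst (fun n => (σ n).subst τ) := by
  induction t generalizing σ τ <;> simp_all [subst, subst_upSub]

theorem upSub_var : upSub var = var := by funext n; cases n <;> rfl

@[simp] theorem subst_var (t : Term) : t.subst var = t := by
  induction t <;> simp_all [subst, upSub_var]

theorem rename_id (t : Term) : t.rename (fun n => n) = t := by
  rw [rename_eq_subst]; exact subst_var t

theorem lift_lift (t : Term) (k l : ℕ) : (t.lift k).lift l = t.lift (k + l) := by
  simp only [lift, rename_rename, Nat.add_assoc]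

theorem lift_subst_scons (t a : Term) (σ : ℕ → Term) : (t.lift 1).subst (scons a σ) = t.subst σ := by
  simp only [lift, subst_rename]; rfl

theorem lift_inst (t a : Term) : (t.lift 1).inst a = t := by
  simp only [inst, lift_subst_scons, subst_var]

theorem lift_subst_upSub (t : Term) (σ : ℕ → Term) :
    (t.lift 1).subst (upSub σ) = (t.subst σ).lift 1 := by
  simp only [lift, subst_rename, rename_subst]; rfl

theorem inst_subst (t a : Term) (σ : ℕ → Term) :
    (t.inst a).subst σ = (t.subst (upSub σ)).inst (a.subst σ) := by
  simp only [inst, subst_subst]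
  congr 1; funext n
  cases n with
  | zero => rfl
  | succ n => simp only [scons, upSub, lift_subst_scons, subst_var]; rfl

theorem inst₂_subst (t a b : Term) (σ : ℕ → Term) :
    (t.inst₂ a b).subst σ = (t.subst (upSub (upSub σ))).inst₂ (a.subst σ) (b.subst σ) := by
  simp only [inst₂, subst_subst]
  congr 1; funext n
  rcases n with _ | _ | n
  · rfl
  · rfl
  · simp only [scons, upSub, lift_subst_scons, subst_var]; rfl

/-! ## Free variables -/

/-- Lifting of a predicate on variables under one binder. -/
def upP (P : ℕ → Prop) : ℕ → Prop
  | 0 => True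
  | n + 1 => P n

/-- All free variables of the term satisfy the predicate. -/
def FV : (ℕ → Prop) → Term → Prop
  | P, var n => P n
  | _, sort _ => True
  | P, app t u => FV P t ∧ FV P u
  | P, lam A t => FV P A ∧ FV (upP P) t
  | P, pi A B => FV P A ∧ FV (upP P) B
  | P, sig A B => FV P A ∧ FV (upP P) B
  | P, pair a b => FV P a ∧ FV P b
  | P, fst p => FV P p
  | P, snd p => FV P p
  | P, split C d p => FV (upP P) C ∧ FV (upP (upP P)) d ∧ FV P p
  | P, id A a b => FV P A ∧ FV P a ∧ FV P b
  | P, refl a => FV P a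
  | P, idrec C d p => FV (upP (upP P)) C ∧ FV P d ∧ FV P p
  | _, ua => True

theorem upP_mono {P Q : ℕ → Prop} (h : ∀ n, P n → Q n) : ∀ n, upP P n → upP Q n
  | 0, _ => trivial
  | n + 1, hn => h n hn

theorem FV.mono {t : Term} : ∀ {P Q : ℕ → Prop}, (∀ n, P n → Q n) → FV P t → FV Q t := by
  induction t <;> intro P Q h ht <;> simp only [FV] at ht ⊢ <;>
    first
    | exact h _ ht
    | grind [upP_mono]

theorem upP_and (P Q : ℕ → Prop) : upP (fun n => P n ∧ Q n) = fun n => upP P n ∧ upP Q n := by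
  funext n; cases n <;> simp [upP]

theorem FV.and {t : Term} : ∀ {P Q : ℕ → Prop}, FV P t → FV Q t → FV (fun n => P n ∧ Q n) t := by
  induction t <;> intro P Q h ht <;> simp only [FV, upP_and] at * <;> grind

theorem FV.rename {t : Term} : ∀ {P Q : ℕ → Prop} {ρ : ℕ → ℕ},
    (∀ n, P n → Q (ρ n)) → FV P t → FV Q (t.rename ρ) := by
  have up : ∀ {P Q : ℕ → Prop} {ρ : ℕ → ℕ}, (∀ n, P n → Q (ρ n)) →
      ∀ n, upP P n → upP Q (upRen ρ n) := by
    intro P Q ρ h n; cases n <;> simp_all [upP, upRen]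
  induction t <;> intro P Q ρ h ht <;> simp only [FV, Term.rename] at ht ⊢ <;>
    first
    | exact h _ ht
    | grind

theorem FV.trivial (t : Term) : FV (fun _ => True) t := by
  have up : upP (fun _ => True) = fun _ => True := by funext n; cases n <;> rfl
  induction t <;> simp_all [FV]

theorem FV.lift {t : Term} (k : ℕ) : FV (fun n => k ≤ n) (t.lift k) :=
  FV.rename (fun n _ => Nat.le_add_left k n) (FV.trivial t)

theorem subst_congr {t : Term} : ∀ {P : ℕ → Prop} {σ τ : ℕ → Term},
    (∀ n, P n → σ n = τ n) → FV P t → t.subst σ = t.subst τ := by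
  have up : ∀ {P : ℕ → Prop} {σ τ : ℕ → Term}, (∀ n, P n → σ n = τ n) →
      ∀ n, upP P n → upSub σ n = upSub τ n := by
    intro P σ τ h n hn
    cases n with
    | zero => rfl
    | succ n => simp only [upSub, h n hn]
  induction t <;> intro P σ τ h ht <;> simp only [FV, Term.subst] at ht ⊢ <;>
    first
    | exact h _ ht
    | grind

theorem rename_congr {t : Term} {P : ℕ → Prop} {ρ ξ : ℕ → ℕ}
    (h : ∀ n, P n → ρ n = ξ n) (ht : FV P t) : t.rename ρ = t.rename ξ := by
  rw [rename_eq_subst, rename_eq_subst]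
  exact subst_congr (fun n hn => by rw [h n hn]) ht

/-! ## Shifting of universe levels -/

/-- Raises all universe levels by `k`. -/
def shift (k : ℕ) : Term → Term
  | var n => var n
  | sort i => sort (i + k)
  | app t u => app (shift k t) (shift k u)
  | lam A t => lam (shift k A) (shift k t)
  | pi A B => pi (shift k A) (shift k B)
  | sig A B => sig (shift k A) (shift k B)
  | pair a b => pair (shift k a) (shift k b)
  | fst p => fst (shift k p)
  | snd p => snd (shift k p)
  | split C d p => split (shift k C) (shift k d) (shift k p)
  | id A a b => id (shift k A) (shift k a) (shift k b)
  | refl a => refl (shift k a)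
  | idrec C d p => idrec (shift k C) (shift k d) (shift k p)
  | ua => ua

theorem shift_rename (k : ℕ) (t : Term) (ρ : ℕ → ℕ) :
    (t.rename ρ).shift k = (t.shift k).rename ρ := by
  induction t generalizing ρ <;> simp_all [shift, rename]

theorem shift_upSub (k : ℕ) (σ : ℕ → Term) :
    (fun n => (upSub σ n).shift k) = upSub (fun n => (σ n).shift k) := by
  funext n
  cases n with
  | zero => rfl
  | succ n => exact shift_rename _ _ _

theorem shift_subst (k : ℕ) (t : Term) (σ : ℕ → Term) :
    (t.subst σ).shift k = (t.shift k).subst (fun n => (σ n).shift k) := by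
  induction t generalizing σ <;> simp_all [shift, subst, shift_upSub]

theorem shift_inst (k : ℕ) (t a : Term) : (t.inst a).shift k = (t.shift k).inst (a.shift k) := by
  simp only [inst, shift_subst]
  congr 1; funext n; cases n <;> rfl

theorem shift_inst₂ (k : ℕ) (t a b : Term) :
    (t.inst₂ a b).shift k = (t.shift k).inst₂ (a.shift k) (b.shift k) := by
  simp only [inst₂, shift_subst]
  congr 1; funext n; rcases n with _ | _ | n <;> rfl

theorem shift_lift (k l : ℕ) (t : Term) : (t.lift l).shift k = (t.shift k).lift l :=
  shift_rename _ _ _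

theorem univalence_shift (i k : ℕ) : (univalence i).shift k = univalence (i + k) := rfl

theorem univalence_subst (i : ℕ) (σ : ℕ → Term) : (univalence i).subst σ = univalence i := by
  simp [univalence, isEquiv, arrow, equiv, idToEquiv, idEquiv, ap, lift, subst, rename, upSub,
    upRen]

end Term

/-! ## Conversion -/

theorem Step.subst {T : Theory} {t u : Term} (h : Step T t u) (σ : ℕ → Term) :
    Step T (t.subst σ) (u.subst σ) := by
  induction h generalizing σ with
  | beta => rw [inst_subst]; exact .beta
  | eta => simp only [Term.subst, lift_subst_upSub]; exact .eta
  | split_pair => rw [inst₂_subst]; exact .split_pair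
  | fst_pair => exact .fst_pair
  | snd_pair => exact .snd_pair
  | idrec_refl => exact .idrec_refl
  | _ => simp only [Term.subst]; constructor; apply_assumption

theorem Step.shift {T : Theory} {t u : Term} (h : Step T t u) (k : ℕ) :
    Step T (t.shift k) (u.shift k) := by
  induction h with
  | beta => rw [shift_inst]; exact .beta
  | eta => simp only [Term.shift, shift_lift]; exact .eta
  | split_pair => rw [shift_inst₂]; exact .split_pair
  | fst_pair => exact .fst_pair
  | snd_pair => exact .snd_pair
  | idrec_refl => exact .idrec_refl
  | _ => simp only [Term.shift]; constructor; apply_assumption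

namespace Conv

variable {T : Theory} {t u v A A' B B' a a' b b' C C' d d' p p' : Term}

theorem refl (t : Term) : Conv T t t := Relation.EqvGen.refl t
theorem symm (h : Conv T t u) : Conv T u t := Relation.EqvGen.symm _ _ h
theorem trans (h : Conv T t u) (h' : Conv T u v) : Conv T t v := Relation.EqvGen.trans _ _ _ h h'
theorem step (h : Step T t u) : Conv T t u := Relation.EqvGen.rel _ _ h
theorem of_eq (h : t = u) : Conv T t u := h ▸ refl t

theorem map (f : Term → Term) (hf : ∀ {t u}, Step T t u → Step T (f t) (f u)) (h : Conv T t u) :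
    Conv T (f t) (f u) := by
  induction h with
  | rel _ _ h => exact step (hf h)
  | refl => exact refl _
  | symm _ _ _ ih => exact ih.symm
  | trans _ _ _ _ _ ih ih' => exact ih.trans ih'

theorem subst (h : Conv T t u) (σ : ℕ → Term) : Conv T (t.subst σ) (u.subst σ) :=
  h.map (fun t => t.subst σ) (fun h => h.subst σ)
theorem rename (h : Conv T t u) (ρ : ℕ → ℕ) : Conv T (t.rename ρ) (u.rename ρ) := by
  simpa only [rename_eq_subst] using h.subst _
theorem lift (h : Conv T t u) (k : ℕ) : Conv T (t.lift k) (u.lift k) := h.rename _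
theorem shift (h : Conv T t u) (k : ℕ) : Conv T (t.shift k) (u.shift k) :=
  h.map (fun t => t.shift k) (fun h => h.shift k)

theorem app (h : Conv T a a') (h' : Conv T b b') : Conv T (app a b) (app a' b') :=
  (h.map (fun x => .app x b) .app_left).trans (h'.map (fun x => .app a' x) .app_right)
theorem lam (h : Conv T A A') (h' : Conv T b b') : Conv T (lam A b) (lam A' b') :=
  (h.map (fun x => .lam x b) .lam_dom).trans (h'.map (fun x => .lam A' x) .lam_body)
theorem pi (h : Conv T A A') (h' : Conv T B B') : Conv T (pi A B) (pi A' B') :=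
  (h.map (fun x => .pi x B) .pi_dom).trans (h'.map (fun x => .pi A' x) .pi_cod)
theorem sig (h : Conv T A A') (h' : Conv T B B') : Conv T (sig A B) (sig A' B') :=
  (h.map (fun x => .sig x B) .sig_dom).trans (h'.map (fun x => .sig A' x) .sig_cod)
theorem pair (h : Conv T a a') (h' : Conv T b b') : Conv T (pair a b) (pair a' b') :=
  (h.map (fun x => .pair x b) .pair_left).trans (h'.map (fun x => .pair a' x) .pair_right)
theorem fst (h : Conv T p p') : Conv T (fst p) (fst p') := h.map (fun x => .fst x) .fst_arg
theorem snd (h : Conv T p p') : Conv T (snd p) (snd p') := h.map (fun x => .snd x) .snd_arg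
theorem split (h : Conv T C C') (h' : Conv T d d') (h'' : Conv T p p') :
    Conv T (split C d p) (split C' d' p') :=
  ((h.map (fun x => .split x d p) .split_motive).trans
    (h'.map (fun x => .split C' x p) .split_branch)).trans
    (h''.map (fun x => .split C' d' x) .split_arg)
theorem id (h : Conv T A A') (h' : Conv T a a') (h'' : Conv T b b') :
    Conv T (id A a b) (id A' a' b') :=
  ((h.map (fun x => .id x a b) .id_type).trans (h'.map (fun x => .id A' x b) .id_left)).trans
    (h''.map (fun x => .id A' a' x) .id_right)
theorem reflTerm (h : Conv T a a') : Conv T (.refl a) (.refl a') := h.map (fun x => .refl x) .refl_arg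
theorem idrec (h : Conv T C C') (h' : Conv T d d') (h'' : Conv T p p') :
    Conv T (idrec C d p) (idrec C' d' p') :=
  ((h.map (fun x => .idrec x d p) .idrec_motive).trans
    (h'.map (fun x => .idrec C' x p) .idrec_branch)).trans
    (h''.map (fun x => .idrec C' d' x) .idrec_arg)

theorem beta : Conv T (.app (.lam A t) u) (t.inst u) := step .beta

theorem upSub {σ τ : ℕ → Term} (h : ∀ n, Conv T (σ n) (τ n)) :
    ∀ n, Conv T (upSub σ n) (upSub τ n)
  | 0 => refl _
  | n + 1 => (h n).lift 1

theorem subst_right (t : Term) : ∀ {σ τ : ℕ → Term}, (∀ n, Conv T (σ n) (τ n)) →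
    Conv T (t.subst σ) (t.subst τ) := by
  induction t with
  | var n => intro σ τ h; exact h n
  | sort i => intros; exact refl _
  | app t u iht ihu => intro σ τ h; exact (iht h).app (ihu h)
  | lam A t iht ihu => intro σ τ h; exact (iht h).lam (ihu (upSub h))
  | pi A t iht ihu => intro σ τ h; exact (iht h).pi (ihu (upSub h))
  | sig A t iht ihu => intro σ τ h; exact (iht h).sig (ihu (upSub h))
  | pair t u iht ihu => intro σ τ h; exact (iht h).pair (ihu h)
  | fst t iht => intro σ τ h; exact (iht h).fst
  | snd t iht => intro σ τ h; exact (iht h).snd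
  | split C d p ihC ihd ihp =>
    intro σ τ h; exact (ihC (upSub h)).split (ihd (upSub (upSub h))) (ihp h)
  | id A a b ihA iha ihb => intro σ τ h; exact (ihA h).id (iha h) (ihb h)
  | refl t iht => intro σ τ h; exact (iht h).reflTerm
  | idrec C d p ihC ihd ihp =>
    intro σ τ h; exact (ihC (upSub (upSub h))).idrec (ihd h) (ihp h)
  | ua => intros; exact refl _

theorem inst (h : Conv T t u) (h' : Conv T a a') : Conv T (t.inst a) (u.inst a') :=
  (h.subst _).trans (subst_right u fun n => by
    cases n with
    | zero => exact h'
    | succ n => exact refl _)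

end Conv

theorem Cumul.refl {T : Theory} (A : Term) : Cumul T A A := .conv (.refl A)

theorem Cumul.subst {T : Theory} {A B : Term} (h : Cumul T A B) (σ : ℕ → Term) :
    Cumul T (A.subst σ) (B.subst σ) := by
  induction h generalizing σ with
  | conv h => exact .conv (h.subst σ)
  | sort h => exact .sort h
  | pi h _ ih => exact .pi (h.subst σ) (ih _)
  | sig _ _ ih ih' => exact .sig (ih _) (ih' _)
  | trans _ _ ih ih' => exact .trans (ih _) (ih' _)

theorem Cumul.rename {T : Theory} {A B : Term} (h : Cumul T A B) (ρ : ℕ → ℕ) :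
    Cumul T (A.rename ρ) (B.rename ρ) := by
  simpa only [rename_eq_subst] using h.subst _

theorem Cumul.lift {T : Theory} {A B : Term} (h : Cumul T A B) (k : ℕ) :
    Cumul T (A.lift k) (B.lift k) := h.rename _

theorem Cumul.inst {T : Theory} {A B : Term} (h : Cumul T A B) (a : Term) :
    Cumul T (A.inst a) (B.inst a) := h.subst _

theorem Cumul.shift {T : Theory} {A B : Term} (h : Cumul T A B) (k : ℕ) :
    Cumul T (A.shift k) (B.shift k) := by
  induction h with
  | conv h => exact .conv (h.shift k)
  | sort h => exact .sort (Nat.add_le_add_right h k)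
  | pi h _ ih => exact .pi (h.shift k) ih
  | sig _ _ ih ih' => exact .sig ih ih'
  | trans _ _ ih ih' => exact .trans ih ih'

/-! ## Structural properties of typing -/

theorem Ctx.HasVar.zero {Γ : Ctx} {A : Term} : Ctx.HasVar (A :: Γ) 0 (A.lift 1) := ⟨A, rfl, rfl⟩

theorem Ctx.HasVar.succ {Γ : Ctx} {A B : Term} {n : ℕ} (h : Ctx.HasVar Γ n B) :
    Ctx.HasVar (A :: Γ) (n + 1) (B.lift 1) := by
  obtain ⟨C, hC, rfl⟩ := h
  exact ⟨C, hC, by rw [lift_lift]⟩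

theorem Ctx.HasVar.cases {Γ : Ctx} {A B : Term} {n : ℕ} (h : Ctx.HasVar (A :: Γ) n B) :
    (n = 0 ∧ B = A.lift 1) ∨ ∃ m C, n = m + 1 ∧ Ctx.HasVar Γ m C ∧ B = C.lift 1 := by
  obtain ⟨C, hC, rfl⟩ := h
  cases n with
  | zero => simp at hC; exact .inl ⟨rfl, by rw [hC]⟩
  | succ n => exact .inr ⟨n, C.lift (n + 1), rfl, ⟨C, hC, rfl⟩, by rw [lift_lift]⟩

theorem Ctx.HasVar.unique {Γ : Ctx} {A B : Term} {n : ℕ} (h : Ctx.HasVar Γ n A)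
    (h' : Ctx.HasVar Γ n B) : A = B := by
  obtain ⟨C, hC, rfl⟩ := h
  obtain ⟨D, hD, rfl⟩ := h'
  simp_all

/-- A renaming of variables that respects the types in the contexts. -/
def RenTyped (Γ Δ : Ctx) (ρ : ℕ → ℕ) : Prop :=
  ∀ n A, Ctx.HasVar Γ n A → Ctx.HasVar Δ (ρ n) (A.rename ρ)

theorem RenTyped.up {Γ Δ : Ctx} {ρ : ℕ → ℕ} (h : RenTyped Γ Δ ρ) (A : Term) :
    RenTyped (A :: Γ) (A.rename ρ :: Δ) (upRen ρ) := by
  intro n B hB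
  rcases hB.cases with ⟨rfl, rfl⟩ | ⟨m, C, rfl, hC, rfl⟩
  · have : (A.lift 1).rename (upRen ρ) = (A.rename ρ).lift 1 := by
      simp only [Term.lift, rename_rename]; rfl
    rw [this]; exact .zero
  · have : (C.lift 1).rename (upRen ρ) = (C.rename ρ).lift 1 := by
      simp only [Term.lift, rename_rename]; rfl
    rw [this]; exact (h m C hC).succ

theorem RenTyped.succ (Γ : Ctx) (A : Term) : RenTyped Γ (A :: Γ) (fun n => n + 1) :=
  fun _ _ h => h.succ

theorem rename_inst (t a : Term) (ρ : ℕ → ℕ) :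
    (t.inst a).rename ρ = (t.rename (upRen ρ)).inst (a.rename ρ) := by
  simp only [rename_eq_subst, inst_subst, upSub_var_comp]

theorem rename_inst₂ (t a b : Term) (ρ : ℕ → ℕ) :
    (t.inst₂ a b).rename ρ = (t.rename (upRen (upRen ρ))).inst₂ (a.rename ρ) (b.rename ρ) := by
  simp only [rename_eq_subst, inst₂_subst, upSub_var_comp]

theorem pairMotive_subst (C : Term) (σ : ℕ → Term) :
    (C.subst (scons (pair (var 1) (var 0)) fun n => var (n + 2))).subst (upSub (upSub σ)) =
      (C.subst (upSub σ)).subst (scons (pair (var 1) (var 0)) fun n => var (n + 2)) := by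
  simp only [subst_subst]
  congr 1; funext n
  cases n with
  | zero => rfl
  | succ n =>
    simp only [scons, upSub, Term.subst, Term.lift, rename_rename, subst_rename]
    rw [rename_eq_subst]

theorem Typing.rename {T : Theory} {Γ Δ : Ctx} {t A : Term} {ρ : ℕ → ℕ} (h : Typing T Γ t A)
    (hρ : RenTyped Γ Δ ρ) : Typing T Δ (t.rename ρ) (A.rename ρ) := by
  induction h generalizing Δ ρ with
  | sort => exact .sort
  | var h => exact .var (hρ _ _ h)
  | pi _ _ ih ih' => exact .pi (ih hρ) (ih' (hρ.up _))
  | lam _ _ ih ih' => exact .lam (ih hρ) (ih' (hρ.up _))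
  | app _ _ ih ih' => rw [rename_inst]; exact .app (ih hρ) (ih' hρ)
  | conv _ h _ ih ih' => exact .conv (ih hρ) (h.rename _) (ih' hρ)
  | sig _ _ ih ih' => exact .sig (ih hρ) (ih' (hρ.up _))
  | pair _ _ _ ih ih' ih'' => exact .pair (ih hρ) (ih' hρ) (by rw [← rename_inst]; exact ih'' hρ)
  | fst _ ih => exact .fst (ih hρ)
  | snd _ ih => rw [rename_inst]; exact .snd (ih hρ)
  | split _ _ _ ih ih' ih'' =>
    rw [rename_inst]
    refine .split (ih hρ) (ih' (hρ.up _)) ?_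
    have := ih'' ((hρ.up _).up _)
    simp only [rename_eq_subst _ (upRen _)] at this ⊢
    simpa only [← upSub_var_comp, pairMotive_subst] using this
  | id _ _ _ ih ih' ih'' => exact .id (ih hρ) (ih' hρ) (ih'' hρ)
  | refl _ ih => exact .refl (ih hρ)
  | idrec _ _ _ ih ih' ih'' =>
    rw [rename_inst₂]
    have h₂ := ih'' hρ
    rw [rename_inst₂] at h₂
    have h₁ := ih' ((hρ.up _).up _)
    simp only [Term.rename, Term.lift, rename_rename, upRen] at h₁
    exact .idrec (ih hρ) (by simpa only [Term.lift, rename_rename] using h₁) h₂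
  | ua => rw [rename_eq_subst (univalence _), univalence_subst]; exact .ua

theorem Typing.lift {T : Theory} {Γ : Ctx} {t A : Term} (h : Typing T Γ t A) (B : Term) :
    Typing T (B :: Γ) (t.lift 1) (A.lift 1) := h.rename (.succ Γ B)

/-- A substitution whose values have the types required by the contexts. -/
def SubTyped (T : Theory) (Γ Δ : Ctx) (σ : ℕ → Term) : Prop :=
  ∀ n A, Ctx.HasVar Γ n A → Typing T Δ (σ n) (A.subst σ)

theorem SubTyped.up {T : Theory} {Γ Δ : Ctx} {σ : ℕ → Term} (h : SubTyped T Γ Δ σ) (A : Term) :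
    SubTyped T (A :: Γ) (A.subst σ :: Δ) (upSub σ) := by
  intro n B hB
  rcases hB.cases with ⟨rfl, rfl⟩ | ⟨m, C, rfl, hC, rfl⟩
  · rw [lift_subst_upSub]; exact .var .zero
  · rw [lift_subst_upSub]; exact (h m C hC).lift _

theorem SubTyped.scons {T : Theory} {Γ Δ : Ctx} {σ : ℕ → Term} {a A : Term}
    (h : SubTyped T Γ Δ σ) (ha : Typing T Δ a (A.subst σ)) :
    SubTyped T (A :: Γ) Δ (scons a σ) := by
  intro n B hB
  rcases hB.cases with ⟨rfl, rfl⟩ | ⟨m, C, rfl, hC, rfl⟩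
  · rw [lift_subst_scons]; exact ha
  · rw [lift_subst_scons]; exact h m C hC

theorem SubTyped.var (T : Theory) (Γ : Ctx) : SubTyped T Γ Γ var :=
  fun n A h => by rw [subst_var]; exact .var h

theorem SubTyped.nil {T : Theory} {Γ : Ctx} {σ : ℕ → Term} : SubTyped T [] Γ σ := by
  rintro n A ⟨B, hB, _⟩; simp at hB

theorem Typing.subst {T : Theory} {Γ Δ : Ctx} {t A : Term} {σ : ℕ → Term} (h : Typing T Γ t A)
    (hσ : SubTyped T Γ Δ σ) : Typing T Δ (t.subst σ) (A.subst σ) := by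
  induction h generalizing Δ σ with
  | sort => exact .sort
  | var h => exact hσ _ _ h
  | pi _ _ ih ih' => exact .pi (ih hσ) (ih' (hσ.up _))
  | lam _ _ ih ih' => exact .lam (ih hσ) (ih' (hσ.up _))
  | app _ _ ih ih' => rw [inst_subst]; exact .app (ih hσ) (ih' hσ)
  | conv _ h _ ih ih' => exact .conv (ih hσ) (h.subst _) (ih' hσ)
  | sig _ _ ih ih' => exact .sig (ih hσ) (ih' (hσ.up _))
  | pair _ _ _ ih ih' ih'' => exact .pair (ih hσ) (ih' hσ) (by rw [← inst_subst]; exact ih'' hσ)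
  | fst _ ih => exact .fst (ih hσ)
  | snd _ ih => rw [inst_subst]; exact .snd (ih hσ)
  | split _ _ _ ih ih' ih'' =>
    rw [inst_subst]
    refine .split (ih hσ) (ih' (hσ.up _)) ?_
    have := ih'' ((hσ.up _).up _)
    rwa [pairMotive_subst] at this
  | id _ _ _ ih ih' ih'' => exact .id (ih hσ) (ih' hσ) (ih'' hσ)
  | refl _ ih => exact .refl (ih hσ)
  | idrec _ _ _ ih ih' ih'' =>
    rw [inst₂_subst]
    have h₂ := ih'' hσ
    rw [inst₂_subst] at h₂
    have h₁ := ih' ((hσ.up _).up _)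
    simp only [Term.subst, lift_subst_upSub, upSub] at h₁
    exact .idrec (ih hσ) h₁ h₂
  | ua => rw [univalence_subst]; exact .ua

theorem Typing.inst {T : Theory} {Γ : Ctx} {t a A B : Term} (h : Typing T (A :: Γ) t B)
    (ha : Typing T Γ a A) : Typing T Γ (t.inst a) (B.inst a) :=
  h.subst ((SubTyped.var T Γ).scons (by rwa [subst_var]))

theorem Typing.inst₂ {T : Theory} {Γ : Ctx} {t a b A B C : Term} (h : Typing T (B :: A :: Γ) t C)
    (ha : Typing T Γ a A) (hb : Typing T Γ b (B.inst a)) :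
    Typing T Γ (t.inst₂ a b) (C.inst₂ a b) :=
  h.subst (((SubTyped.var T Γ).scons (by rwa [subst_var])).scons hb)

/-- Every rule is uniform in the levels, `ua` included because it is polymorphic. A construction
carried out at one level is therefore available at all higher ones. -/
theorem Typing.shift {T : Theory} {Γ : Ctx} {t A : Term} (h : Typing T Γ t A) (k : ℕ) :
    Typing T (Γ.map (Term.shift k)) (t.shift k) (A.shift k) := by
  induction h with
  | @sort T Γ i =>
    have : (Term.sort (i + 1)).shift k = .sort (i + k + 1) := by simp only [Term.shift]; congr 1; omega
    rw [this]; exact .sort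
  | var h =>
    obtain ⟨B, hB, rfl⟩ := h
    exact .var ⟨B.shift k, by simp [hB], by rw [shift_lift]⟩
  | pi _ _ ih ih' => exact .pi ih ih'
  | lam _ _ ih ih' => exact .lam ih ih'
  | app _ _ ih ih' => rw [shift_inst]; exact .app ih ih'
  | conv _ h _ ih ih' => exact .conv ih (h.shift _) ih'
  | sig _ _ ih ih' => exact .sig ih ih'
  | pair _ _ _ ih ih' ih'' => exact .pair ih ih' (by rw [← shift_inst]; exact ih'')
  | fst _ ih => exact .fst ih
  | snd _ ih => rw [shift_inst]; exact .snd ih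
  | split _ _ _ ih ih' ih'' =>
    rw [shift_inst]
    refine .split ih ih' ?_
    rw [shift_subst] at ih''
    have : (fun n => (Term.scons (.pair (.var 1) (.var 0)) (fun n => .var (n + 2)) n).shift k) =
        Term.scons (.pair (.var 1) (.var 0)) fun n => .var (n + 2) := by funext n; cases n <;> rfl
    rwa [this] at ih''
  | id _ _ _ ih ih' ih'' => exact .id ih ih' ih''
  | refl _ ih => exact .refl ih
  | idrec _ _ _ ih ih' ih'' =>
    rw [shift_inst₂] at *
    simp only [List.map_cons, Term.shift, shift_lift] at ih'
    exact .idrec ih ih' ih''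
  | ua => rw [univalence_shift]; exact .ua

/-- Applied to the combinators, this bounds their free variables: none for `pSort`, six for `pPi`.
Hence substitution acts on parametricity witnesses only through their arguments. -/
theorem Typing.fv {T : Theory} {Γ : Ctx} {t A : Term} (h : Typing T Γ t A) :
    FV (fun n => n < Γ.length) t := by
  have up : ∀ {k n : ℕ}, n < k + 1 → upP (fun n => n < k) n := by
    intro k n h; cases n
    · trivial
    · exact Nat.lt_of_succ_lt_succ h
  induction h with
  | var h => obtain ⟨B, hB, _⟩ := h; exact (List.getElem?_eq_some_iff.mp hB).1
  | sort => trivial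
  | ua => trivial
  | conv _ _ _ ih _ => exact ih
  | pi _ _ ih ih' => exact ⟨ih, ih'.mono fun _ => up⟩
  | lam _ _ ih ih' => exact ⟨ih, ih'.mono fun _ => up⟩
  | sig _ _ ih ih' => exact ⟨ih, ih'.mono fun _ => up⟩
  | app _ _ ih ih' => exact ⟨ih, ih'⟩
  | pair _ _ _ _ ih ih' => exact ⟨ih, ih'⟩
  | fst _ ih => exact ih
  | snd _ ih => exact ih
  | split _ _ _ ih ih' ih'' =>
    exact ⟨ih'.mono fun _ => up, ih''.mono fun n h => upP_mono (fun _ => up) _ (up h), ih⟩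
  | id _ _ _ ih ih' ih'' => exact ⟨ih, ih', ih''⟩
  | refl _ ih => exact ih
  | idrec _ _ _ ih ih' ih'' =>
    exact ⟨ih'.mono fun n h => upP_mono (fun _ => up) _ (up h), ih'', ih⟩

theorem Typing.sort_mono {T : Theory} {Γ : Ctx} {A : Term} {i j : ℕ} (h : Typing T Γ A (.sort i))
    (hij : i ≤ j) : Typing T Γ A (.sort j) := .conv h (.sort hij) .sort

theorem Typing.pi' {T : Theory} {Γ : Ctx} {A B : Term} {i j : ℕ} (hA : Typing T Γ A (.sort i))
    (hB : Typing T (A :: Γ) B (.sort j)) : Typing T Γ (.pi A B) (.sort (max i j)) :=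
  .pi (hA.sort_mono (le_max_left _ _)) (hB.sort_mono (le_max_right _ _))

theorem Typing.sig' {Γ : Ctx} {A B : Term} {i j : ℕ} (hA : Typing .univalent Γ A (.sort i))
    (hB : Typing .univalent (A :: Γ) B (.sort j)) : Typing .univalent Γ (.sig A B) (.sort (max i j)) :=
  .sig (hA.sort_mono (le_max_left _ _)) (hB.sort_mono (le_max_right _ _))

theorem Typing.pi_inv {T : Theory} {Γ : Ctx} {A B C : Term} (h : Typing T Γ (.pi A B) C) :
    ∃ i, Typing T Γ A (.sort i) ∧ Typing T (A :: Γ) B (.sort i) := by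
  generalize ht : Term.pi A B = t at h
  induction h with
  | conv _ _ _ ih _ => exact ih ht
  | pi hA hB => cases ht; exact ⟨_, hA, hB⟩
  | _ => cases ht

theorem Typing.sig_inv {T : Theory} {Γ : Ctx} {A B C : Term} (h : Typing T Γ (.sig A B) C) :
    ∃ i, Typing T Γ A (.sort i) ∧ Typing T (A :: Γ) B (.sort i) := by
  generalize ht : Term.sig A B = t at h
  induction h with
  | conv _ _ _ ih _ => exact ih ht
  | sig hA hB => cases ht; exact ⟨_, hA, hB⟩
  | _ => cases ht

theorem Typing.id_inv {T : Theory} {Γ : Ctx} {A a b C : Term} (h : Typing T Γ (.id A a b) C) :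
    ∃ i, Typing T Γ A (.sort i) ∧ Typing T Γ a A ∧ Typing T Γ b A := by
  generalize ht : Term.id A a b = t at h
  induction h with
  | conv _ _ _ ih _ => exact ih ht
  | id hA ha hb => cases ht; exact ⟨_, hA, ha, hb⟩
  | _ => cases ht

/-- Replacement of the type of the last variable by a convertible type. -/
theorem Typing.conv_ctx {T : Theory} {Γ : Ctx} {A A' t B : Term} {i : ℕ}
    (h : Typing T (A :: Γ) t B) (hA : Typing T Γ A (.sort i)) (hc : Cumul T A' A) :
    Typing T (A' :: Γ) t B := by
  have hs : SubTyped T (A :: Γ) (A' :: Γ) Term.var := by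
    intro n C hC
    rw [subst_var]
    rcases hC.cases with ⟨rfl, rfl⟩ | ⟨m, D, rfl, hD, rfl⟩
    · exact .conv (.var .zero) (hc.lift 1) (hA.lift A')
    · exact .var hD.succ
  simpa only [subst_var] using h.subst hs

end Trocq

namespace Trocq

open Term

/-! ## Confluence of `β` -/

/-- Parallel `β`-reduction. -/
inductive Par : Term → Term → Prop
  | var {n} : Par (var n) (var n)
  | sort {i} : Par (sort i) (sort i)
  | ua : Par ua ua
  | beta {A t t' u u'} : Par t t' → Par u u' → Par (app (lam A t) u) (t'.inst u')
  | app {t t' u u'} : Par t t' → Par u u' → Par (app t u) (app t' u')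
  | lam {A A' t t'} : Par A A' → Par t t' → Par (lam A t) (lam A' t')
  | pi {A A' t t'} : Par A A' → Par t t' → Par (pi A t) (pi A' t')
  | sig {A A' t t'} : Par A A' → Par t t' → Par (sig A t) (sig A' t')
  | pair {t t' u u'} : Par t t' → Par u u' → Par (pair t u) (pair t' u')
  | fst {p p'} : Par p p' → Par (fst p) (fst p')
  | snd {p p'} : Par p p' → Par (snd p) (snd p')
  | split {C C' d d' p p'} : Par C C' → Par d d' → Par p p' → Par (split C d p) (split C' d' p')
  | id {A A' a a' b b'} : Par A A' → Par a a' → Par b b' → Par (id A a b) (id A' a' b')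
  | refl {a a'} : Par a a' → Par (refl a) (refl a')
  | idrec {C C' d d' p p'} : Par C C' → Par d d' → Par p p' → Par (idrec C d p) (idrec C' d' p')

namespace Par

theorem self (t : Term) : Par t t := by
  induction t <;> constructor <;> assumption

theorem of_step {t u : Term} (h : Step .ccω t u) : Par t u := by
  generalize hT : Theory.ccω = T at h
  induction h <;> cases hT <;>
    first
    | exact .beta (Par.self _) (Par.self _)
    | (constructor <;> first | exact Par.self _ | (rename_i ih; exact ih rfl))

theorem conv {t u : Term} (h : Par t u) : Conv .ccω t u := by
  induction h with
  | var => exact .refl _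
  | sort => exact .refl _
  | ua => exact .refl _
  | beta _ _ ih ih' => exact Conv.beta.trans (ih.inst ih')
  | app _ _ ih ih' => exact ih.app ih'
  | lam _ _ ih ih' => exact ih.lam ih'
  | pi _ _ ih ih' => exact ih.pi ih'
  | sig _ _ ih ih' => exact ih.sig ih'
  | pair _ _ ih ih' => exact ih.pair ih'
  | fst _ ih => exact ih.fst
  | snd _ ih => exact ih.snd
  | split _ _ _ ih ih' ih'' => exact ih.split ih' ih''
  | id _ _ _ ih ih' ih'' => exact ih.id ih' ih''
  | refl _ ih => exact ih.reflTerm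
  | idrec _ _ _ ih ih' ih'' => exact ih.idrec ih' ih''

theorem rename {t t' : Term} (h : Par t t') (ρ : ℕ → ℕ) : Par (t.rename ρ) (t'.rename ρ) := by
  induction h generalizing ρ with
  | beta _ _ ih ih' => rw [rename_inst]; exact .beta (ih _) (ih' _)
  | _ => simp only [Term.rename]; constructor <;> apply_assumption

theorem upSub {σ σ' : ℕ → Term} (h : ∀ n, Par (σ n) (σ' n)) :
    ∀ n, Par (upSub σ n) (upSub σ' n)
  | 0 => .var
  | n + 1 => (h n).rename _

theorem subst {t t' : Term} (h : Par t t') {σ σ' : ℕ → Term} (hσ : ∀ n, Par (σ n) (σ' n)) :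
    Par (t.subst σ) (t'.subst σ') := by
  induction h generalizing σ σ' with
  | var => exact hσ _
  | beta _ _ ih ih' => rw [inst_subst]; exact .beta (ih (upSub hσ)) (ih' hσ)
  | _ => simp only [Term.subst]; constructor <;> grind [upSub]

theorem inst {t t' u u' : Term} (h : Par t t') (h' : Par u u') : Par (t.inst u) (t'.inst u') :=
  h.subst fun n => by
    cases n with
    | zero => exact h'
    | succ n => exact .var

/-- Complete development: contraction of all `β`-redexes of a term. -/
def dev : Term → Term
  | .app (.lam _ t) u => (dev t).inst (dev u)
  | .app t u => .app (dev t) (dev u)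
  | .lam A t => .lam (dev A) (dev t)
  | .pi A B => .pi (dev A) (dev B)
  | .sig A B => .sig (dev A) (dev B)
  | .pair a b => .pair (dev a) (dev b)
  | .fst p => .fst (dev p)
  | .snd p => .snd (dev p)
  | .split C d p => .split (dev C) (dev d) (dev p)
  | .id A a b => .id (dev A) (dev a) (dev b)
  | .refl a => .refl (dev a)
  | .idrec C d p => .idrec (dev C) (dev d) (dev p)
  | t => t

/-- The triangle property: a parallel step contracts some of the redexes of `t`, and contracting the
remaining ones leads to `dev t`, whichever they were. The diamond property follows at once. -/
theorem to_dev {t u : Term} (h : Par t u) : Par u (dev t) := by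
  induction h with
  | beta _ _ ih ih' => exact ih.inst ih'
  | @app t t' u u' h h' ih ih' =>
    cases t with
    | lam A b =>
      cases h with
      | lam hA hb =>
        simp only [dev] at ih ⊢
        cases ih with
        | lam _ ihb => exact .beta ihb ih'
    | _ => exact .app ih ih'
  | _ => simp only [dev]; constructor <;> assumption

/-- Reduction: the reflexive and transitive closure of parallel reduction. -/
abbrev Red : Term → Term → Prop := Relation.ReflTransGen Par

theorem Red.conv {t u : Term} (h : Red t u) : Conv .ccω t u := by
  induction h with
  | refl => exact .refl _
  | tail _ h ih => exact ih.trans h.conv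

/-- The diamond closed by `dev` makes joinability an equivalence relation; as it contains single
steps, it contains conversion. -/
theorem church_rosser {t u : Term} (h : Conv .ccω t u) : Relation.Join Red t u := by
  have hd : ∀ a b c, Par a b → Par a c → ∃ d, Relation.ReflGen Par b d ∧ Red c d :=
    fun a b c hb hc => ⟨dev a, .single hb.to_dev, .single hc.to_dev⟩
  have he := Relation.equivalence_join_reflTransGen hd
  induction h with
  | rel _ _ h => exact ⟨_, .single (of_step h), .refl⟩
  | refl => exact he.refl _
  | symm _ _ _ ih => exact he.symm ih
  | trans _ _ _ _ _ ih ih' => exact he.trans ih ih'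

theorem Red.pi_inv {A B X : Term} (h : Red (.pi A B) X) :
    ∃ A' B', X = .pi A' B' ∧ Red A A' ∧ Red B B' := by
  induction h with
  | refl => exact ⟨A, B, rfl, .refl, .refl⟩
  | tail _ h ih =>
    obtain ⟨A', B', rfl, hA, hB⟩ := ih
    cases h with
    | pi h h' => exact ⟨_, _, rfl, hA.tail h, hB.tail h'⟩

theorem Red.sort_inv {i : ℕ} {X : Term} (h : Red (.sort i) X) : X = .sort i := by
  induction h with
  | refl => rfl
  | tail _ h ih => subst ih; cases h; rfl

end Par

open Par (Red)

/-- A subtype of a product type reduces to a product type. -/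
theorem Cumul.pi_inv {X Y A B : Term} (h : Cumul .ccω X Y) (hY : Red Y (.pi A B)) :
    ∃ A₀ B₀, Red X (.pi A₀ B₀) ∧ Conv .ccω A₀ A ∧ Cumul .ccω B₀ B := by
  generalize hT : Theory.ccω = T at h
  induction h generalizing A B with
  | conv h =>
    subst hT
    obtain ⟨Z, hX, hZ⟩ := Par.church_rosser (h.trans hY.conv)
    obtain ⟨A', B', rfl, hA, hB⟩ := hZ.pi_inv
    exact ⟨A', B', hX, hA.conv.symm, .conv hB.conv.symm⟩
  | sort h => cases hY.sort_inv
  | pi hA hB =>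
    subst hT
    obtain ⟨A', B', h, hA', hB'⟩ := hY.pi_inv
    cases h
    exact ⟨_, _, .refl, hA.trans hA'.conv, hB.trans (.conv hB'.conv)⟩
  | sig => cases hT
  -- Transitivity is the reason for assuming only that `Y` reduces to a product: the intermediate
  -- type is known only up to reduction.
  | trans _ _ ih ih' =>
    obtain ⟨A₁, B₁, h₁, hA₁, hB₁⟩ := ih' hY hT
    obtain ⟨A₀, B₀, h₀, hA₀, hB₀⟩ := ih h₁ hT
    exact ⟨A₀, B₀, h₀, hA₀.trans hA₁, hB₀.trans hB₁⟩

/-- Injectivity of products, since a product only reduces to products, componentwise. The β case of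
subject reduction depends on it. -/
theorem Cumul.pi_pi {A B A' B' : Term} (h : Cumul .ccω (.pi A B) (.pi A' B')) :
    Conv .ccω A A' ∧ Cumul .ccω B B' := by
  obtain ⟨A₀, B₀, h₀, hA, hB⟩ := h.pi_inv .refl
  obtain ⟨_, _, h₁, hA', hB'⟩ := h₀.pi_inv
  cases h₁
  exact ⟨hA'.conv.trans hA, .trans (.conv hB'.conv) hB⟩

/-! ## Typing in `CC_ω` relative to a set of variables -/

/-- Typing in `CC_ω` where only the variables in `S` may occur, with the premises that make types
well-formed spelled out. -/
inductive Ty : (ℕ → Prop) → Ctx → Term → Term → Prop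
  | sort {S Γ i} : Ty S Γ (sort i) (sort (i + 1))
  | var {S Γ n A i} : S n → Ctx.HasVar Γ n A → Ty S Γ A (sort i) → Ty S Γ (var n) A
  | pi {S Γ A B i} : Ty S Γ A (sort i) → Ty (upP S) (A :: Γ) B (sort i) →
      Ty S Γ (pi A B) (sort i)
  | lam {S Γ A B t i} : Ty S Γ A (sort i) → Ty (upP S) (A :: Γ) B (sort i) →
      Ty (upP S) (A :: Γ) t B → Ty S Γ (lam A t) (pi A B)
  | app {S Γ A B t u i} : Ty S Γ A (sort i) → Ty (upP S) (A :: Γ) B (sort i) →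
      Ty S Γ t (pi A B) → Ty S Γ u A → Ty S Γ (app t u) (B.inst u)
  | conv {S Γ A B t i} : Ty S Γ t A → Cumul .ccω A B → Ty S Γ B (sort i) → Ty S Γ t B

namespace Ty

variable {S S' : ℕ → Prop} {Γ Δ : Ctx} {t u A B C : Term}

theorem typing (h : Ty S Γ t A) : Typing .ccω Γ t A := by
  induction h with
  | sort => exact .sort
  | var _ h _ _ => exact .var h
  | pi _ _ ih ih' => exact .pi ih ih'
  | lam _ _ _ ih _ ih' => exact .lam ih ih'
  | app _ _ _ _ _ _ ih ih' => exact .app ih ih'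
  | conv _ h _ ih ih' => exact .conv ih h ih'

theorem mono (h : Ty S Γ t A) (hS : ∀ n, S n → S' n) : Ty S' Γ t A := by
  induction h generalizing S' with
  | sort => exact .sort
  | var h h' _ ih => exact .var (hS _ h) h' (ih hS)
  | pi _ _ ih ih' => exact .pi (ih hS) (ih' (upP_mono hS))
  | lam _ _ _ ih ih' ih'' => exact .lam (ih hS) (ih' (upP_mono hS)) (ih'' (upP_mono hS))
  | app _ _ _ _ ih ih' ih₁ ih₂ => exact .app (ih hS) (ih' (upP_mono hS)) (ih₁ hS) (ih₂ hS)
  | conv _ h _ ih ih' => exact .conv (ih hS) h (ih' hS)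

theorem rename (h : Ty S Γ t A) {ρ : ℕ → ℕ} (hρ : RenTyped Γ Δ ρ) (hS : ∀ n, S n → S' (ρ n)) :
    Ty S' Δ (t.rename ρ) (A.rename ρ) := by
  have up : ∀ {S S' : ℕ → Prop} {ρ : ℕ → ℕ}, (∀ n, S n → S' (ρ n)) →
      ∀ n, upP S n → upP S' (upRen ρ n) := by
    intro S S' ρ h n hn
    cases n with
    | zero => trivial
    | succ n => exact h n hn
  induction h generalizing S' Δ ρ with
  | sort => exact .sort
  | var h h' _ ih => exact .var (hS _ h) (hρ _ _ h') (ih hρ hS)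
  | pi _ _ ih ih' => exact .pi (ih hρ hS) (ih' (hρ.up _) (up hS))
  | lam _ _ _ ih ih' ih'' =>
    exact .lam (ih hρ hS) (ih' (hρ.up _) (up hS)) (ih'' (hρ.up _) (up hS))
  | app _ _ _ _ ih ih' ih₁ ih₂ =>
    rw [rename_inst]
    exact .app (ih hρ hS) (ih' (hρ.up _) (up hS)) (ih₁ hρ hS) (ih₂ hρ hS)
  | conv _ h _ ih ih' => exact .conv (ih hρ hS) (h.rename _) (ih' hρ hS)

theorem lift (h : Ty S Γ t A) (B : Term) : Ty (upP S) (B :: Γ) (t.lift 1) (A.lift 1) :=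
  h.rename (.succ Γ B) fun _ h => h

/-- The variables in `S` have well-formed types. -/
def Valid (S : ℕ → Prop) (Γ : Ctx) : Prop :=
  ∀ n A, S n → Ctx.HasVar Γ n A → ∃ i, Ty S Γ A (.sort i)

theorem Valid.cons {i : ℕ} (h : Valid S Γ) (hA : Ty S Γ A (.sort i)) :
    Valid (upP S) (A :: Γ) := by
  intro n B hn hB
  rcases hB.cases with ⟨rfl, rfl⟩ | ⟨m, C, rfl, hC, rfl⟩
  · exact ⟨i, hA.lift A⟩
  · obtain ⟨j, hj⟩ := h m C hn hC
    exact ⟨j, hj.lift A⟩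

/-- Substitutions whose values on `S` have the types required by the contexts. -/
def Subs (S S' : ℕ → Prop) (Γ Δ : Ctx) (σ : ℕ → Term) : Prop :=
  ∀ n A, S n → Ctx.HasVar Γ n A → Ty S' Δ (σ n) (A.subst σ)

theorem Subs.up {i : ℕ} {σ : ℕ → Term} (h : Subs S S' Γ Δ σ) (hA : Ty S' Δ (A.subst σ) (.sort i)) :
    Subs (upP S) (upP S') (A :: Γ) (A.subst σ :: Δ) (upSub σ) := by
  intro n B hn hB
  rcases hB.cases with ⟨rfl, rfl⟩ | ⟨m, C, rfl, hC, rfl⟩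
  · rw [lift_subst_upSub]; exact .var trivial .zero (hA.lift _)
  · rw [lift_subst_upSub]; exact (h m C hn hC).lift _

theorem subst (h : Ty S Γ t A) {σ : ℕ → Term} (hσ : Subs S S' Γ Δ σ) :
    Ty S' Δ (t.subst σ) (A.subst σ) := by
  induction h generalizing S' Δ σ with
  | sort => exact .sort
  | var h h' => exact hσ _ _ h h'
  | pi _ _ ih ih' => exact .pi (ih hσ) (ih' (hσ.up (ih hσ)))
  | lam _ _ _ ih ih' ih'' => exact .lam (ih hσ) (ih' (hσ.up (ih hσ))) (ih'' (hσ.up (ih hσ)))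
  | app _ _ _ _ ih ih' ih₁ ih₂ =>
    rw [inst_subst]
    exact .app (ih hσ) (ih' (hσ.up (ih hσ))) (ih₁ hσ) (ih₂ hσ)
  | conv _ h _ ih ih' => exact .conv (ih hσ) (h.subst _) (ih' hσ)

/-- Validity is needed because the variable rule of `Ty` asks for a derivation of the type of the
variable, which has to be supplied for all the variables that the substitution leaves in place. -/
theorem inst (hv : Valid S Γ) (h : Ty (upP S) (A :: Γ) t B) (hu : Ty S Γ u A) :
    Ty S Γ (t.inst u) (B.inst u) := by
  refine h.subst fun n C hn hC => ?_
  rcases hC.cases with ⟨rfl, rfl⟩ | ⟨m, D, rfl, hD, rfl⟩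
  · rw [lift_subst_scons, subst_var]; exact hu
  · rw [lift_subst_scons, subst_var]
    obtain ⟨i, hi⟩ := hv m D hn hD
    exact .var hn hD hi

theorem conv_ctx {i j : ℕ} {A' : Term} (hv : Valid S Γ) (h : Ty (upP S) (A :: Γ) t B)
    (hA : Ty S Γ A (.sort i)) (hA' : Ty S Γ A' (.sort j)) (hc : Cumul .ccω A' A) :
    Ty (upP S) (A' :: Γ) t B := by
  have hs : Subs (upP S) (upP S) (A :: Γ) (A' :: Γ) Term.var := by
    intro n C hn hC
    rw [subst_var]
    rcases hC.cases with ⟨rfl, rfl⟩ | ⟨m, D, rfl, hD, rfl⟩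
    · exact .conv (.var trivial .zero (hA'.lift A')) (hc.lift 1) (hA.lift A')
    · obtain ⟨k, hk⟩ := hv m D hn hD
      exact .var hn hD.succ (hk.lift A')
  simpa only [subst_var] using h.subst hs

theorem sort_mono {i j : ℕ} (h : Ty S Γ A (.sort i)) (hij : i ≤ j) : Ty S Γ A (.sort j) :=
  .conv h (.sort hij) .sort

theorem valid (hv : Valid S Γ) (h : Ty S Γ t A) : ∃ i, Ty S Γ A (.sort i) := by
  cases h with
  | sort => exact ⟨_, .sort⟩
  | var _ _ h => exact ⟨_, h⟩
  | pi => exact ⟨_, .sort⟩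
  | lam h h' => exact ⟨_, .pi h h'⟩
  | app h h' _ h₂ => exact ⟨_, h'.inst hv h₂⟩
  | conv _ _ h => exact ⟨_, h⟩

theorem pi_inv (h : Ty S Γ (.pi A B) C) :
    ∃ i, Ty S Γ A (.sort i) ∧ Ty (upP S) (A :: Γ) B (.sort i) := by
  generalize ht : Term.pi A B = t at h
  induction h with
  | conv _ _ _ ih _ => exact ih ht
  | pi hA hB => cases ht; exact ⟨_, hA, hB⟩
  | _ => cases ht

theorem lam_inv (h : Ty S Γ (.lam A t) C) :
    ∃ B i, Ty S Γ A (.sort i) ∧ Ty (upP S) (A :: Γ) B (.sort i) ∧ Ty (upP S) (A :: Γ) t B ∧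
      Cumul .ccω (.pi A B) C := by
  generalize ht : Term.lam A t = u at h
  induction h with
  | conv _ hc _ ih _ =>
    obtain ⟨B, i, hA, hB, h, hc'⟩ := ih ht
    exact ⟨B, i, hA, hB, h, hc'.trans hc⟩
  | lam hA hB h => cases ht; exact ⟨_, _, hA, hB, h, .refl _⟩
  | _ => cases ht

/-- Subject reduction. -/
theorem par (hv : Valid S Γ) (h : Ty S Γ t A) (hp : Par t u) : Ty S Γ u A := by
  induction h generalizing u with
  | sort => cases hp; exact .sort
  | var h h' h'' => cases hp; exact .var h h' h''
  | pi hA _ ih ih' =>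
    cases hp with
    | pi h h' =>
      exact .pi (ih hv h) ((ih' (hv.cons hA) h').conv_ctx hv hA (ih hv h) (.conv h.conv.symm))
  | lam hA hB _ ih _ ih' =>
    cases hp with
    | lam h h' =>
      have hA' := ih hv h
      have hB' := hB.conv_ctx hv hA hA' (.conv h.conv.symm)
      exact .conv (.lam hA' hB' ((ih' (hv.cons hA) h').conv_ctx hv hA hA' (.conv h.conv.symm)))
        (.conv (.pi h.conv.symm (.refl _))) (.pi hA hB)
  | app hA hB ht hu _ _ ih ih' =>
    cases hp with
    | app h h' =>
      exact .conv (.app hA hB (ih hv h) (ih' hv h')) (.conv (.inst (.refl _) h'.conv.symm))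
        (hB.inst hv hu)
    | beta h h' =>
      -- The induction hypothesis types the abstraction with its body reduced. Inversion gives it a
      -- product type of its own, and injectivity of products compares this type with the one used
      -- by the application.
      obtain ⟨B₁, i, hA₁, hB₁, hb, hc⟩ := (ih hv (.lam (Par.self _) h)).lam_inv
      obtain ⟨hcA, hcB⟩ := hc.pi_pi
      have hu' := ih' hv h'
      have := hb.inst hv (.conv hu' (.conv hcA.symm) hA₁)
      refine .conv this ?_ (hB.inst hv hu)
      exact (hcB.inst _).trans (.conv (.inst (.refl _) h'.conv.symm))
  | conv _ hc hB ih _ => exact .conv (ih hv hp) hc hB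

theorem red (hv : Valid S Γ) (h : Ty S Γ t A) (hr : Par.Red t u) : Ty S Γ u A := by
  induction hr with
  | refl => exact h
  | tail _ hp ih => exact ih.par hv hp

/-- A term that is typable in `CC_ω` and has all its variables in `S` has a type with all its
variables in `S`, below any of its types. -/
theorem of_typing (h : Typing .ccω Γ t A) (hv : Valid S Γ) (ht : FV S t) :
    ∃ B, Ty S Γ t B ∧ Cumul .ccω B A := by
  generalize hT : Theory.ccω = T at h
  induction h generalizing S with
  | sort => exact ⟨_, .sort, .refl _⟩
  | var h => obtain ⟨i, hi⟩ := hv _ _ ht h; exact ⟨_, .var ht h hi, .refl _⟩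
  | pi _ _ ih ih' =>
    subst hT
    obtain ⟨C, hC, hC'⟩ := ih hv ht.1 rfl
    have hA := Ty.conv hC hC' .sort
    obtain ⟨D, hD, hD'⟩ := ih' (hv.cons hA) ht.2 rfl
    exact ⟨_, .pi hA (.conv hD hD' .sort), .refl _⟩
  | lam _ _ ih ih' =>
    subst hT
    obtain ⟨C, hC, hC'⟩ := ih hv ht.1 rfl
    have hA := Ty.conv hC hC' .sort
    obtain ⟨D, hD, hD'⟩ := ih' (hv.cons hA) ht.2 rfl
    obtain ⟨j, hj⟩ := hD.valid (hv.cons hA)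
    exact ⟨_, .lam (hA.sort_mono (le_max_left _ _)) (hj.sort_mono (le_max_right _ _)) hD,
      .pi (.refl _) hD'⟩
  | app _ _ ih ih' =>
    subst hT
    obtain ⟨C, hC, hC'⟩ := ih hv ht.1 rfl
    obtain ⟨D, hD, hD'⟩ := ih' hv ht.2 rfl
    -- The product type in the given derivation may mention variables outside `S`. The type found
    -- within `S` lies below it, so it reduces to a product, which stays within `S` by subject
    -- reduction.
    obtain ⟨A₀, B₀, hr, hA₀, hB₀⟩ := hC'.pi_inv .refl
    obtain ⟨j, hj⟩ := hC.valid hv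
    have hj' := hj.red hv hr
    obtain ⟨i, hA, hB⟩ := hj'.pi_inv
    exact ⟨_, .app hA hB (.conv hC (.conv hr.conv) hj') (.conv hD (hD'.trans (.conv hA₀.symm)) hA),
      hB₀.inst _⟩
  | conv _ hc _ ih _ =>
    subst hT
    obtain ⟨C, hC, hC'⟩ := ih hv ht rfl
    exact ⟨C, hC, hC'.trans hc⟩
  | _ => cases hT

/-- The types of a term of `CC_ω` with all its variables in `S` are well-formed. -/
theorem typing_valid (h : Typing .ccω Γ t A) (hv : Valid S Γ) (ht : FV S t) :
    ∃ i, Typing .ccω Γ A (.sort i) := by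
  generalize hT : Theory.ccω = T at h
  induction h generalizing S with
  | sort => exact ⟨_, .sort⟩
  | var h => obtain ⟨i, hi⟩ := hv _ _ ht h; exact ⟨i, hT ▸ hi.typing⟩
  | pi => exact ⟨_, .sort⟩
  | lam hA _ ih ih' =>
    subst hT
    obtain ⟨C, hC, hC'⟩ := of_typing hA hv ht.1
    obtain ⟨j, hj⟩ := ih' (hv.cons (Ty.conv hC hC' .sort)) ht.2 rfl
    exact ⟨_, .pi' hA hj⟩
  | app _ hu ih _ =>
    obtain ⟨j, hj⟩ := ih hv ht.1 hT
    obtain ⟨i, hA, hB⟩ := hj.pi_inv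
    exact ⟨i, hB.inst hu⟩
  | conv _ _ h _ _ => exact ⟨_, h⟩
  | _ => cases hT

/-- A typing judgment of `CC_ω` whose term and type have all their variables in `S`. -/
theorem of_typing_of_fv (h : Typing .ccω Γ t A) (hv : Valid S Γ) (ht : FV S t) (hA : FV S A) :
    Ty S Γ t A := by
  -- The type is itself a typable term with variables in `S`, so `of_typing` applies to it as well
  -- as to the term, and one conversion joins the two results.
  obtain ⟨i, hi⟩ := typing_valid h hv ht
  obtain ⟨B, hB, hBA⟩ := of_typing h hv ht
  obtain ⟨C, hC, hCi⟩ := of_typing hi hv hA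
  exact .conv hB hBA (.conv hC hCi .sort)

end Ty

end Trocq

namespace Trocq

open Term

/-! ## A type checker for the univalent theory -/

namespace Checker

/-- Weak head normal form, computed with bounded fuel. -/
def whnf : ℕ → Term → Term
  | 0, t => t
  | n + 1, t =>
    match t with
    | .app f u =>
      match whnf n f with
      | .lam _ b => whnf n (b.inst u)
      | f' => .app f' u
    | .fst p =>
      match whnf n p with
      | .pair a _ => whnf n a
      | p' => .fst p'
    | .snd p =>
      match whnf n p with
      | .pair _ b => whnf n b
      | p' => .snd p'
    | .split C d p =>
      match whnf n p with
      | .pair a b => whnf n (d.inst₂ a b)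
      | p' => .split C d p'
    | .idrec C d p =>
      match whnf n p with
      | .refl _ => whnf n d
      | p' => .idrec C d p'
    | t => t

/-- Whether the variable `k` occurs in a term. -/
def occurs : ℕ → Term → Bool
  | k, .var n => n == k
  | _, .sort _ => false
  | k, .app t u => occurs k t || occurs k u
  | k, .lam A t => occurs k A || occurs (k + 1) t
  | k, .pi A B => occurs k A || occurs (k + 1) B
  | k, .sig A B => occurs k A || occurs (k + 1) B
  | k, .pair a b => occurs k a || occurs k b
  | k, .fst p => occurs k p
  | k, .snd p => occurs k p
  | k, .split C d p => occurs (k + 1) C || occurs (k + 2) d || occurs k p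
  | k, .id A a b => occurs k A || occurs k a || occurs k b
  | k, .refl a => occurs k a
  | k, .idrec C d p => occurs (k + 2) C || occurs k d || occurs k p
  | _, .ua => false

/-- Abstraction, followed by an `η`-contraction if possible. -/
def etaLam (A : Term) : Term → Term
  | .app t (.var 0) =>
    match occurs 0 t with
    | true => .lam A (.app t (.var 0))
    | false => t.rename Nat.pred
  | t => .lam A t

/-- Normal form, computed with bounded fuel. -/
def nf : ℕ → Term → Term
  | 0, t => t
  | n + 1, t =>
    match whnf 1000 t with
    | .app t u => .app (nf n t) (nf n u)
    | .lam A t => etaLam (nf n A) (nf n t)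
    | .pi A B => .pi (nf n A) (nf n B)
    | .sig A B => .sig (nf n A) (nf n B)
    | .pair a b => .pair (nf n a) (nf n b)
    | .fst p => .fst (nf n p)
    | .snd p => .snd (nf n p)
    | .split C d p => .split (nf n C) (nf n d) (nf n p)
    | .id A a b => .id (nf n A) (nf n a) (nf n b)
    | .refl a => .refl (nf n a)
    | .idrec C d p => .idrec (nf n C) (nf n d) (nf n p)
    | t => t

/-- Syntactic equality up to the domains of abstractions. -/
def eqv : Term → Term → Bool
  | .var n, .var m => n == m
  | .sort i, .sort j => i == j
  | .app t u, .app t' u' => eqv t t' && eqv u u'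
  | .lam _ t, .lam _ t' => eqv t t'
  | .pi t u, .pi t' u' => eqv t t' && eqv u u'
  | .sig t u, .sig t' u' => eqv t t' && eqv u u'
  | .pair t u, .pair t' u' => eqv t t' && eqv u u'
  | .fst t, .fst t' => eqv t t'
  | .snd t, .snd t' => eqv t t'
  | .split C d p, .split C' d' p' => eqv p p' && eqv C C' && eqv d d'
  | .id A a b, .id A' a' b' => eqv A A' && eqv a a' && eqv b b'
  | .refl t, .refl t' => eqv t t'
  | .idrec C d p, .idrec C' d' p' => eqv p p' && eqv C C' && eqv d d'
  | .ua, .ua => true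
  | _, _ => false

/-- Syntactic cumulativity up to the domains of abstractions. -/
def sub : Term → Term → Bool
  | .sort i, .sort j => Nat.ble i j
  | .pi t u, .pi t' u' => eqv t t' && sub u u'
  | .sig t u, .sig t' u' => sub t t' && sub u u'
  | t, t' => eqv t t'

/-- Conversion test. -/
def conv (t u : Term) : Bool := eqv t u || eqv (nf 1000 t) (nf 1000 u)

/-- Cumulativity test. -/
def cumul (t u : Term) : Bool := sub t u || sub (nf 1000 t) (nf 1000 u)

/-- The universe of a type, given an inference procedure. -/
def sortOf (inf : Ctx → Term → Option Term) (Γ : Ctx) (A : Term) : Option ℕ :=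
  match inf Γ A with
  | some T =>
    match whnf 1000 T with
    | .sort i => some i
    | _ => none
  | none => none

/-- A form of a type that exposes its head constructor. -/
def expose (inf : Ctx → Term → Option Term) (Γ : Ctx) (A : Term) : Option Term :=
  match A with
  | .pi A B => some (.pi A B)
  | .sig A B => some (.sig A B)
  | .id A a b => some (.id A a b)
  | A =>
    -- The normal form is checked again to be a type, so that soundness does not depend on subject
    -- reduction for the univalent theory.
    match sortOf inf Γ (nf 1000 A) with
    | some _ => some (nf 1000 A)
    | none => none

/-- The type of the univalence axiom for the types `A` and `B` in the universe `□ᵢ`. -/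
def uaType (i : ℕ) (A B : Term) : Term :=
  isEquiv (.id (.sort i) A B) (equiv A B) (.lam (.id (.sort i) A B) (idToEquiv (A.lift 1) (.var 0)))

/-- `some t` if the test succeeds. -/
def test (b : Bool) (t : Term) : Option Term :=
  match b with
  | true => some t
  | false => none

/-- One layer of type inference. -/
def inferF (inf : Ctx → Term → Option Term) (chk : Ctx → Term → Term → Bool) (Γ : Ctx) :
    Term → Option Term
  | .var n => (Γ[n]?).map (Term.lift (n + 1))
  | .sort i => some (.sort (i + 1))
  | .pi A B => (sortOf inf Γ A).bind fun i =>
      (sortOf inf (A :: Γ) B).map fun j => .sort (max i j)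
  | .sig A B => (sortOf inf Γ A).bind fun i =>
      (sortOf inf (A :: Γ) B).map fun j => .sort (max i j)
  | .lam A t => (sortOf inf Γ A).bind fun _ => (inf (A :: Γ) t).map fun B => .pi A B
  -- The constant `ua` has one type per level, so a type is inferred only once it is applied to two
  -- types, at the maximum of the levels inferred for them.
  | .app (.app .ua A) B => (sortOf inf Γ A).bind fun i =>
      (sortOf inf Γ B).bind fun j =>
        (sortOf inf Γ (uaType (max i j) A B)).map fun _ => uaType (max i j) A B
  | .app t u => ((inf Γ t).bind (expose inf Γ)).bind fun T =>
      match T with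
      | .pi A B => test (chk Γ u A) (B.inst u)
      | _ => none
  | .fst p => ((inf Γ p).bind (expose inf Γ)).bind fun T =>
      match T with
      | .sig A _ => some A
      | _ => none
  | .snd p => ((inf Γ p).bind (expose inf Γ)).bind fun T =>
      match T with
      | .sig _ B => some (B.inst (.fst p))
      | _ => none
  -- Without an expected type a pair receives a non-dependent product; dependent pair types are
  -- reached in checking mode.
  | .pair a b => (inf Γ a).bind fun A => (inf Γ b).map fun B => prod A B
  | .split C d p => ((inf Γ p).bind (expose inf Γ)).bind fun T =>
      match T with
      | .sig A B => (sortOf inf (.sig A B :: Γ) C).bind fun _ =>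
          test (chk (B :: A :: Γ) d
            (C.subst (scons (.pair (.var 1) (.var 0)) fun n => .var (n + 2)))) (C.inst p)
      | _ => none
  | .id A a b => (sortOf inf Γ A).bind fun i => test (chk Γ a A && chk Γ b A) (.sort i)
  | .refl a => (inf Γ a).map fun A => .id A a a
  | .idrec C d p => ((inf Γ p).bind (expose inf Γ)).bind fun T =>
      match T with
      | .id A a b => (sortOf inf (.id (A.lift 1) (a.lift 1) (.var 0) :: A :: Γ) C).bind fun _ =>
          test (chk Γ d (C.inst₂ a (.refl a))) (C.inst₂ b p)
      | _ => none
  | .ua => none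

/-- One layer of type checking. -/
def checkF (inf : Ctx → Term → Option Term) (chk : Ctx → Term → Term → Bool) (Γ : Ctx)
    (t E : Term) : Bool :=
  match t with
  | .lam A b =>
    match expose inf Γ E with
    | some (.pi A' B') => (sortOf inf Γ A).isSome && conv A A' && chk (A :: Γ) b B'
    | _ => false
  | .pair a b =>
    match expose inf Γ E with
    | some (.sig A B) => chk Γ a A && chk Γ b (B.inst a)
    | _ => false
  | .refl a =>
    match expose inf Γ E with
    | some (.id A x y) => chk Γ a A && conv a x && conv a y
    | _ => false
  | t =>
    match inf Γ t with
    | some T => cumul T E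
    | none => false

/-- Type inference and type checking with bounded fuel. -/
def run : ℕ → (Ctx → Term → Option Term) × (Ctx → Term → Term → Bool)
  | 0 => (fun _ _ => none, fun _ _ _ => false)
  | n + 1 => (inferF (run n).1 (run n).2, checkF (run n).1 (run n).2)

end Checker

end Trocq

namespace Trocq

open Term

namespace Checker

/-! ### Soundness of the conversion test -/

theorem whnf_sound (n : ℕ) (t : Term) : Conv .univalent t (whnf n t) := by
  induction n generalizing t with
  | zero => exact .refl _
  | succ n ih =>
    cases t with
    | app f u =>
      have hf := ih f
      simp only [whnf]
      split
      · next h => rw [h] at hf; exact ((hf.app (.refl u)).trans .beta).trans (ih _)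
      · exact hf.app (.refl u)
    | fst p =>
      have hp := ih p
      simp only [whnf]
      split
      · next h => rw [h] at hp; exact (hp.fst.trans (.step .fst_pair)).trans (ih _)
      · exact hp.fst
    | snd p =>
      have hp := ih p
      simp only [whnf]
      split
      · next h => rw [h] at hp; exact (hp.snd.trans (.step .snd_pair)).trans (ih _)
      · exact hp.snd
    | split C d p =>
      have hp := ih p
      simp only [whnf]
      split
      · next h =>
        rw [h] at hp
        exact ((Conv.split (.refl C) (.refl d) hp).trans (.step .split_pair)).trans (ih _)
      · exact .split (.refl C) (.refl d) hp
    | idrec C d p =>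
      have hp := ih p
      simp only [whnf]
      split
      · next h =>
        rw [h] at hp
        exact ((Conv.idrec (.refl C) (.refl d) hp).trans (.step .idrec_refl)).trans (ih _)
      · exact .idrec (.refl C) (.refl d) hp
    | _ => exact .refl _

theorem upP_of_ne {P : ℕ → Prop} {k n : ℕ} (h : ∀ n, n ≠ k → P n) (hn : n ≠ k + 1) : upP P n := by
  cases n with
  | zero => trivial
  | succ n => exact h n fun e => hn (e ▸ rfl)

theorem FV_of_occurs {t : Term} : ∀ {k : ℕ} {P : ℕ → Prop}, (∀ n, n ≠ k → P n) →
    occurs k t = false → FV P t := by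
  induction t with
  | var n => intro k P hP h; exact hP n (by simpa [occurs] using h)
  | sort | ua => intro k P hP h; trivial
  | app _ _ ih₁ ih₂ | pair _ _ ih₁ ih₂ =>
    intro k P hP h
    simp only [occurs, Bool.or_eq_false_iff] at h
    exact ⟨ih₁ hP h.1, ih₂ hP h.2⟩
  | fst _ ih | snd _ ih | refl _ ih => intro k P hP h; exact ih hP h
  | lam _ _ ih₁ ih₂ | pi _ _ ih₁ ih₂ | sig _ _ ih₁ ih₂ =>
    intro k P hP h
    simp only [occurs, Bool.or_eq_false_iff] at h
    exact ⟨ih₁ hP h.1, ih₂ (fun n => upP_of_ne hP) h.2⟩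
  | split _ _ _ ih₁ ih₂ ih₃ =>
    intro k P hP h
    simp only [occurs, Bool.or_eq_false_iff] at h
    exact ⟨ih₁ (fun n => upP_of_ne hP) h.1.1,
      ih₂ (fun n => upP_of_ne fun n => upP_of_ne hP) h.1.2, ih₃ hP h.2⟩
  | id _ _ _ ih₁ ih₂ ih₃ =>
    intro k P hP h
    simp only [occurs, Bool.or_eq_false_iff] at h
    exact ⟨ih₁ hP h.1.1, ih₂ hP h.1.2, ih₃ hP h.2⟩
  | idrec _ _ _ ih₁ ih₂ ih₃ =>
    intro k P hP h
    simp only [occurs, Bool.or_eq_false_iff] at h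
    exact ⟨ih₁ (fun n => upP_of_ne fun n => upP_of_ne hP) h.1.1, ih₂ hP h.1.2, ih₃ hP h.2⟩

theorem etaLam_sound (A t : Term) : Conv .univalent (.lam A t) (etaLam A t) := by
  unfold etaLam
  split
  · next t =>
    split
    · exact .refl _
    · next h =>
      -- As the variable `0` does not occur in `t`, taking predecessors of indices loses nothing,
      -- and `t` is the weakening demanded by the η rule.
      have ht : t = (t.rename Nat.pred).lift 1 := by
        rw [Term.lift, rename_rename]
        conv_lhs => rw [← rename_id t]
        refine rename_congr (fun n hn => ?_) (FV_of_occurs (P := fun n => n ≠ 0) (fun _ h => h) h)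
        exact (Nat.succ_pred hn).symm
      conv_lhs => rw [ht]
      exact .step .eta
  · exact .refl _

theorem nf_sound (n : ℕ) (t : Term) : Conv .univalent t (nf n t) := by
  induction n generalizing t with
  | zero => exact .refl _
  | succ n ih =>
    refine (whnf_sound 1000 t).trans ?_
    simp only [nf]
    generalize whnf 1000 t = u
    cases u with
    | app t u => exact (ih t).app (ih u)
    | lam A t => exact ((ih A).lam (ih t)).trans (etaLam_sound _ _)
    | pi t u => exact (ih t).pi (ih u)
    | sig t u => exact (ih t).sig (ih u)
    | pair t u => exact (ih t).pair (ih u)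
    | fst p => exact (ih p).fst
    | snd p => exact (ih p).snd
    | split C d p => exact (ih C).split (ih d) (ih p)
    | id A a b => exact (ih A).id (ih a) (ih b)
    | refl a => exact (ih a).reflTerm
    | idrec C d p => exact (ih C).idrec (ih d) (ih p)
    | _ => exact .refl _

/-- The domain of an abstraction is irrelevant for conversion. -/
theorem lam_conv {A A' t t' : Term} (h : Conv .univalent t t') :
    Conv .univalent (.lam A t) (.lam A' t') := by
  refine (h.map (fun x => .lam A x) .lam_body).trans ?_
  -- The η-expansion of `lam A' t'` may be written with the domain `A`: it contracts by η to `lam A'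
  -- t'` and by β under the binder to `lam A t'`.
  have h₁ : Conv .univalent (.lam A (.app ((Term.lam A' t').lift 1) (.var 0))) (.lam A' t') :=
    .step .eta
  have h₂ : Conv .univalent (.app ((Term.lam A' t').lift 1) (.var 0)) t' := by
    refine .trans .beta (.of_eq ?_)
    simp only [inst, subst_rename]
    conv_rhs => rw [← subst_var t']
    congr 1; funext n; cases n <;> rfl
  exact (h₂.symm.map (fun x => .lam A x) .lam_body).trans h₁

theorem eqv_sound {t u : Term} (h : eqv t u = true) : Conv .univalent t u := by
  induction t generalizing u <;> cases u <;>
    simp only [eqv, Bool.and_eq_true, beq_iff_eq, Bool.false_eq_true] at h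
  case var => rw [h]; exact .refl _
  case sort => rw [h]; exact .refl _
  case ua => exact .refl _
  case lam.lam ih _ _ => exact lam_conv (ih h)
  case app ih ih' _ _ => exact (ih h.1).app (ih' h.2)
  case pi ih ih' _ _ => exact (ih h.1).pi (ih' h.2)
  case sig ih ih' _ _ => exact (ih h.1).sig (ih' h.2)
  case pair ih ih' _ _ => exact (ih h.1).pair (ih' h.2)
  case fst ih _ => exact (ih h).fst
  case snd ih _ => exact (ih h).snd
  case refl ih _ => exact (ih h).reflTerm
  case split ih ih' ih'' _ _ _ => exact (ih h.1.2).split (ih' h.2) (ih'' h.1.1)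
  case id ih ih' ih'' _ _ _ => exact (ih h.1.1).id (ih' h.1.2) (ih'' h.2)
  case idrec ih ih' ih'' _ _ _ => exact (ih h.1.2).idrec (ih' h.2) (ih'' h.1.1)

theorem sub_sound {t u : Term} (h : sub t u = true) : Cumul .univalent t u := by
  induction t generalizing u with
  | sort i =>
    cases u with
    | sort j => exact .sort (Nat.le_of_ble_eq_true h)
    | _ => exact .conv (eqv_sound h)
  | pi A B _ ih =>
    cases u with
    | pi A' B' =>
      simp only [sub, Bool.and_eq_true] at h
      exact .pi (eqv_sound h.1) (ih h.2)
    | _ => exact .conv (eqv_sound h)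
  | sig A B ih ih' =>
    cases u with
    | sig A' B' =>
      simp only [sub, Bool.and_eq_true] at h
      exact .sig (ih h.1) (ih' h.2)
    | _ => exact .conv (eqv_sound h)
  | _ => exact .conv (eqv_sound h)

theorem conv_sound {t u : Term} (h : conv t u = true) : Conv .univalent t u := by
  simp only [conv, Bool.or_eq_true] at h
  rcases h with h | h
  · exact eqv_sound h
  · exact ((nf_sound _ _).trans (eqv_sound h)).trans (nf_sound _ _).symm

theorem cumul_sound {t u : Term} (h : cumul t u = true) : Cumul .univalent t u := by
  simp only [cumul, Bool.or_eq_true] at h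
  rcases h with h | h
  · exact sub_sound h
  · exact (Cumul.trans (.conv (nf_sound _ _)) (sub_sound h)).trans (.conv (nf_sound _ _).symm)

/-! ### Soundness of type checking -/

/-- All types declared in the context are well-formed. -/
def CtxValid (Γ : Ctx) : Prop :=
  ∀ n A, Ctx.HasVar Γ n A → ∃ i, Typing .univalent Γ A (.sort i)

theorem CtxValid.nil : CtxValid [] := by rintro n A ⟨B, hB, _⟩; simp at hB

theorem CtxValid.cons {Γ : Ctx} {A : Term} {i : ℕ} (h : CtxValid Γ)
    (hA : Typing .univalent Γ A (.sort i)) : CtxValid (A :: Γ) := by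
  intro n B hB
  rcases hB.cases with ⟨rfl, rfl⟩ | ⟨m, C, rfl, hC, rfl⟩
  · exact ⟨i, hA.lift A⟩
  · obtain ⟨j, hj⟩ := h m C hC
    exact ⟨j, hj.lift A⟩

theorem _root_.Trocq.WfCtx.ctxValid {Γ : Ctx} (h : WfCtx Γ) : CtxValid Γ := by
  induction h with
  | nil => exact .nil
  | cons _ h ih => exact ih.cons h

/-- Well-formed types. -/
def IsType (Γ : Ctx) (A : Term) : Prop := ∃ i, Typing .univalent Γ A (.sort i)

/-- Soundness of an inference procedure. -/
def InferSound (inf : Ctx → Term → Option Term) : Prop :=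
  ∀ Γ t A, CtxValid Γ → inf Γ t = some A → Typing .univalent Γ t A ∧ IsType Γ A

/-- Soundness of a checking procedure. -/
def CheckSound (chk : Ctx → Term → Term → Bool) : Prop :=
  ∀ Γ t A, CtxValid Γ → IsType Γ A → chk Γ t A = true → Typing .univalent Γ t A

variable {inf : Ctx → Term → Option Term} {chk : Ctx → Term → Term → Bool} {Γ : Ctx}

theorem sortOf_sound (hi : InferSound inf) (hΓ : CtxValid Γ) {A : Term} {i : ℕ}
    (h : sortOf inf Γ A = some i) : Typing .univalent Γ A (.sort i) := by
  unfold sortOf at h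
  split at h
  · next T hT =>
    split at h
    · next j hj =>
      cases h
      have := whnf_sound 1000 T
      rw [hj] at this
      exact .conv (hi _ _ _ hΓ hT).1 (.conv this) .sort
    · cases h
  · cases h

theorem expose_sound (hi : InferSound inf) (hΓ : CtxValid Γ) {A B : Term} (hA : IsType Γ A)
    (h : expose inf Γ A = some B) : Conv .univalent A B ∧ IsType Γ B := by
  have key : (match sortOf inf Γ (nf 1000 A) with
      | some _ => some (nf 1000 A)
      | none => none) = some B → Conv .univalent A B ∧ IsType Γ B := by
    intro h
    split at h
    · next i hs => cases h; exact ⟨nf_sound _ _, i, sortOf_sound hi hΓ hs⟩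
    · cases h
  unfold expose at h
  split at h
  · cases h; exact ⟨.refl _, hA⟩
  · cases h; exact ⟨.refl _, hA⟩
  · cases h; exact ⟨.refl _, hA⟩
  · exact key h

theorem infer_expose (hi : InferSound inf) (hΓ : CtxValid Γ) {t A : Term}
    (h : (inf Γ t).bind (expose inf Γ) = some A) : Typing .univalent Γ t A ∧ IsType Γ A := by
  rw [Option.bind_eq_some_iff] at h
  obtain ⟨B, hB, hA⟩ := h
  obtain ⟨h₁, h₂⟩ := hi _ _ _ hΓ hB
  obtain ⟨hc, i, h₃⟩ := expose_sound hi hΓ h₂ hA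
  exact ⟨.conv h₁ (.conv hc) h₃, i, h₃⟩

theorem test_eq_some {b : Bool} {t u : Term} (h : test b t = some u) : b = true ∧ t = u := by
  cases b <;> simp_all [test]

/-- Soundness of checking presupposes that the expected type is well-formed; this provides it for
the branch of `split`. -/
theorem pairMotive_typing {A B C : Term} {i : ℕ} (hA : Typing .univalent Γ A (.sort i)) (hB : Typing .univalent (A :: Γ) B (.sort i))
    {j : ℕ} (hC : Typing .univalent (.sig A B :: Γ) C (.sort j)) :
    Typing .univalent (B :: A :: Γ)
      (C.subst (scons (.pair (.var 1) (.var 0)) fun n => .var (n + 2))) (.sort j) := by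
  have hA₂ := (hA.lift A).lift B
  have hB₂ : Typing .univalent (((A.lift 1).lift 1) :: B :: A :: Γ)
      (B.rename (upRen fun n => n + 2)) (.sort i) := by
    have := hB.rename (((RenTyped.succ Γ A).up A))
    have := this.rename ((RenTyped.succ (A :: Γ) B).up (A.rename fun n => n + 1))
    simp only [rename_rename, upRen_comp, Term.lift] at this ⊢
    exact this
  have hp : Typing .univalent (B :: A :: Γ) (.pair (.var 1) (.var 0))
      ((Term.sig A B).rename fun n => n + 2) := by
    have e : (Term.sig A B).rename (fun n => n + 2) =
        .sig ((A.lift 1).lift 1) (B.rename (upRen fun n => n + 2)) := by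
      simp only [Term.rename, Term.lift, rename_rename]
    rw [e]
    refine .pair (.sig hA₂ hB₂) (.var (Ctx.HasVar.zero.succ)) ?_
    have e₂ : (B.rename (upRen fun n => n + 2)).inst (.var 1) = B.lift 1 := by
      rw [inst, subst_rename, lift_eq_subst]
      congr 1; funext n; cases n <;> rfl
    rw [e₂]
    exact .var .zero
  refine hC.subst (SubTyped.scons (σ := fun n => .var (n + 2)) (fun n D hD => ?_) ?_)
  · have := (hD.succ (A := A)).succ (A := B)
    rw [lift_lift, lift_eq_subst] at this
    exact .var this
  · rw [← rename_eq_subst]; exact hp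

theorem CtxValid.id_ctx {A a : Term} {i : ℕ} (hΓ : CtxValid Γ)
    (hA : Typing .univalent Γ A (.sort i)) (ha : Typing .univalent Γ a A) :
    CtxValid (.id (A.lift 1) (a.lift 1) (.var 0) :: A :: Γ) :=
  (hΓ.cons hA).cons (.id (hA.lift A) (ha.lift A) (.var .zero))

theorem uaType_eq (i : ℕ) (A B : Term) :
    (isEquiv (.id (.sort i) (.var 1) (.var 0)) (equiv (.var 1) (.var 0))
      (.lam (.id (.sort i) (.var 1) (.var 0)) (idToEquiv (.var 2) (.var 0)))).inst₂ A B =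
      uaType i A B := by
  simp [uaType, isEquiv, inst₂, arrow, equiv, idToEquiv, idEquiv, ap, Term.lift, Term.subst,
    Term.rename, upSub, upRen, scons, rename_rename]

theorem Typing.ua_app₂ {i : ℕ} {A B : Term} (hA : Typing .univalent Γ A (.sort i))
    (hB : Typing .univalent Γ B (.sort i)) :
    Typing .univalent Γ (.app (.app .ua A) B) (uaType i A B) := by
  have h₁ := Typing.app (Typing.ua (Γ := Γ) (i := i)) hA
  have h₂ := Typing.app h₁ hB
  rw [← uaType_eq]
  convert h₂ using 1
  rw [inst, subst_subst, inst₂]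
  congr 1; funext n
  rcases n with _ | _ | n
  · rfl
  · simp [upSub, scons, lift_subst_scons]
  · rfl

theorem id_inst (A a b : Term) :
    (Term.id (A.lift 1) (a.lift 1) (.var 0)).inst b = .id A a b := by
  change Term.id ((A.lift 1).inst b) ((a.lift 1).inst b) b = _
  rw [lift_inst, lift_inst]

theorem inferF_sound (hi : InferSound inf) (hc : CheckSound chk) : InferSound (inferF inf chk) := by
  have happ : ∀ {Γ : Ctx} {t u T : Term}, CtxValid Γ →
      (((inf Γ t).bind (expose inf Γ)).bind fun T =>
        match T with
        | .pi A B => test (chk Γ u A) (B.inst u)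
        | _ => none) = some T → Typing .univalent Γ (.app t u) T ∧ IsType Γ T := by
    intro Γ t u T hΓ h
    obtain ⟨U, hU, h⟩ := Option.bind_eq_some_iff.1 h
    obtain ⟨h₁, i, h₂⟩ := infer_expose hi hΓ hU
    split at h
    · obtain ⟨hb, rfl⟩ := test_eq_some h
      obtain ⟨j, hA, hB⟩ := h₂.pi_inv
      have hu := hc _ _ _ hΓ ⟨j, hA⟩ hb
      exact ⟨.app h₁ hu, j, hB.inst hu⟩
    · cases h
  intro Γ t T hΓ h
  unfold inferF at h
  split at h
  · next n =>
    obtain ⟨A, hA, rfl⟩ := Option.map_eq_some_iff.1 h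
    have hv : Ctx.HasVar Γ n (A.lift (n + 1)) := ⟨A, hA, rfl⟩
    exact ⟨.var hv, hΓ _ _ hv⟩
  · cases h; exact ⟨.sort, _, .sort⟩
  · obtain ⟨i, hA, h⟩ := Option.bind_eq_some_iff.1 h
    obtain ⟨j, hB, rfl⟩ := Option.map_eq_some_iff.1 h
    have hA := sortOf_sound hi hΓ hA
    exact ⟨.pi' hA (sortOf_sound hi (hΓ.cons hA) hB), _, .sort⟩
  · obtain ⟨i, hA, h⟩ := Option.bind_eq_some_iff.1 h
    obtain ⟨j, hB, rfl⟩ := Option.map_eq_some_iff.1 h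
    have hA := sortOf_sound hi hΓ hA
    exact ⟨.sig' hA (sortOf_sound hi (hΓ.cons hA) hB), _, .sort⟩
  · obtain ⟨i, hA, h⟩ := Option.bind_eq_some_iff.1 h
    obtain ⟨B, hB, rfl⟩ := Option.map_eq_some_iff.1 h
    have hA := sortOf_sound hi hΓ hA
    obtain ⟨ht, j, hB⟩ := hi _ _ _ (hΓ.cons hA) hB
    exact ⟨.lam hA ht, _, .pi' hA hB⟩
  · obtain ⟨i, hA, h⟩ := Option.bind_eq_some_iff.1 h
    obtain ⟨j, hB, h⟩ := Option.bind_eq_some_iff.1 h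
    obtain ⟨k, hk, rfl⟩ := Option.map_eq_some_iff.1 h
    exact ⟨Typing.ua_app₂ ((sortOf_sound hi hΓ hA).sort_mono (le_max_left _ _))
      ((sortOf_sound hi hΓ hB).sort_mono (le_max_right _ _)), k, sortOf_sound hi hΓ hk⟩
  · exact happ hΓ h
  · obtain ⟨U, hU, h⟩ := Option.bind_eq_some_iff.1 h
    obtain ⟨h₁, i, h₂⟩ := infer_expose hi hΓ hU
    split at h
    · cases h
      obtain ⟨j, hA, hB⟩ := h₂.sig_inv
      exact ⟨.fst h₁, j, hA⟩
    · cases h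
  · obtain ⟨U, hU, h⟩ := Option.bind_eq_some_iff.1 h
    obtain ⟨h₁, i, h₂⟩ := infer_expose hi hΓ hU
    split at h
    · cases h
      obtain ⟨j, hA, hB⟩ := h₂.sig_inv
      exact ⟨.snd h₁, j, hB.inst (.fst h₁)⟩
    · cases h
  · obtain ⟨A, hA, h⟩ := Option.bind_eq_some_iff.1 h
    obtain ⟨B, hB, rfl⟩ := Option.map_eq_some_iff.1 h
    obtain ⟨ha, i, hA⟩ := hi _ _ _ hΓ hA
    obtain ⟨hb, j, hB⟩ := hi _ _ _ hΓ hB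
    have hp := Typing.sig' hA (hB.lift A)
    exact ⟨.pair hp ha (by rwa [lift_inst]), _, hp⟩
  · obtain ⟨U, hU, h⟩ := Option.bind_eq_some_iff.1 h
    obtain ⟨h₁, i, h₂⟩ := infer_expose hi hΓ hU
    split at h
    · obtain ⟨j, hC, h⟩ := Option.bind_eq_some_iff.1 h
      obtain ⟨hb, rfl⟩ := test_eq_some h
      obtain ⟨k, hA, hB⟩ := h₂.sig_inv
      have hs := Typing.sig hA hB
      have hC := sortOf_sound hi (hΓ.cons hs) hC
      have hd := hc _ _ _ ((hΓ.cons hA).cons hB) ⟨j, pairMotive_typing hA hB hC⟩ hb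
      exact ⟨.split h₁ hC hd, j, hC.inst h₁⟩
    · cases h
  · obtain ⟨i, hA, h⟩ := Option.bind_eq_some_iff.1 h
    obtain ⟨hb, rfl⟩ := test_eq_some h
    rw [Bool.and_eq_true] at hb
    have hA := sortOf_sound hi hΓ hA
    exact ⟨.id hA (hc _ _ _ hΓ ⟨i, hA⟩ hb.1) (hc _ _ _ hΓ ⟨i, hA⟩ hb.2), _, .sort⟩
  · obtain ⟨A, hA, rfl⟩ := Option.map_eq_some_iff.1 h
    obtain ⟨ha, i, hA⟩ := hi _ _ _ hΓ hA
    exact ⟨.refl ha, i, .id hA ha ha⟩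
  · obtain ⟨U, hU, h⟩ := Option.bind_eq_some_iff.1 h
    obtain ⟨h₁, i, h₂⟩ := infer_expose hi hΓ hU
    split at h
    · obtain ⟨j, hC, h⟩ := Option.bind_eq_some_iff.1 h
      obtain ⟨hb, rfl⟩ := test_eq_some h
      obtain ⟨k, hA, ha, hb'⟩ := h₂.id_inv
      have hC := sortOf_sound hi (hΓ.id_ctx hA ha) hC
      have hd := hc _ _ _ hΓ ⟨j, hC.inst₂ ha (by rw [id_inst]; exact .refl ha)⟩ hb
      exact ⟨.idrec h₁ hC hd, j, hC.inst₂ hb' (by rw [id_inst]; exact h₁)⟩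
    · cases h
  · cases h

theorem checkF_sound (hi : InferSound inf) (hc : CheckSound chk) : CheckSound (checkF inf chk) := by
  intro Γ t E hΓ hE h
  obtain ⟨e, hE⟩ := hE
  unfold checkF at h
  split at h
  · split at h
    · next hx =>
      obtain ⟨hEc, j, hT⟩ := expose_sound hi hΓ ⟨e, hE⟩ hx
      simp only [Bool.and_eq_true, Option.isSome_iff_exists] at h
      obtain ⟨⟨⟨i, hA⟩, hcv⟩, ht⟩ := h
      have hA := sortOf_sound hi hΓ hA
      obtain ⟨k, hA', hB'⟩ := hT.pi_inv
      have hcv := conv_sound hcv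
      have hB := hB'.conv_ctx hA' (.conv hcv)
      refine .conv (.lam hA (hc _ _ _ (hΓ.cons hA) ⟨k, hB⟩ ht)) (.conv ?_) hE
      exact (hcv.pi (.refl _)).trans hEc.symm
    · cases h
  · split at h
    · next hx =>
      obtain ⟨hEc, j, hT⟩ := expose_sound hi hΓ ⟨e, hE⟩ hx
      rw [Bool.and_eq_true] at h
      obtain ⟨k, hA, hB⟩ := hT.sig_inv
      have ha := hc _ _ _ hΓ ⟨k, hA⟩ h.1
      exact .conv (.pair hT ha (hc _ _ _ hΓ ⟨k, hB.inst ha⟩ h.2)) (.conv hEc.symm) hE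
    · cases h
  · split at h
    · next hx =>
      obtain ⟨hEc, j, hT⟩ := expose_sound hi hΓ ⟨e, hE⟩ hx
      simp only [Bool.and_eq_true] at h
      obtain ⟨k, hA, hx, hy⟩ := hT.id_inv
      have ha := hc _ _ _ hΓ ⟨k, hA⟩ h.1.1
      refine .conv (.refl ha) (.conv (Conv.trans ?_ hEc.symm)) hE
      exact .id (.refl _) (conv_sound h.1.2) (conv_sound h.2)
    · cases h
  · split at h
    · next hT => exact .conv (hi _ _ _ hΓ hT).1 (cumul_sound h) hE
    · cases h

/-- With no fuel both procedures fail, and each layer of one is sound as soon as the inner layers of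
both are. -/
theorem run_sound (n : ℕ) : InferSound (run n).1 ∧ CheckSound (run n).2 := by
  induction n with
  | zero => 
    constructor
    · intro _ _ _ _ h; cases h
    · intro _ _ _ _ _ h; cases h
  | succ n ih => exact ⟨inferF_sound ih.1 ih.2, checkF_sound ih.1 ih.2⟩

end Checker

end Trocq

namespace Trocq

/-! ## Terms as functions of the length of the context

Binders are represented by functions, so that terms can be written with names for variables. -/

/-- A term in a context of unspecified length; variables are numbered from the left. -/
def Tm : Type := ℕ → Term

namespace Tm

/-- The variable declared in position `l` of the context. -/
def v (l : ℕ) : Tm := fun d => .var (d - 1 - l)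
/-- The universe of level `i`. -/
def sort (i : ℕ) : Tm := fun _ => .sort i
/-- Application. -/
def app (t u : Tm) : Tm := fun d => .app (t d) (u d)

infixl:70 " ⬝ " => Tm.app

/-- Abstraction. -/
def lam (A : Tm) (t : Tm → Tm) : Tm := fun d => .lam (A d) (t (v d) (d + 1))
/-- Dependent product. -/
def pi (A : Tm) (B : Tm → Tm) : Tm := fun d => .pi (A d) (B (v d) (d + 1))
/-- Dependent pair type. -/
def sig (A : Tm) (B : Tm → Tm) : Tm := fun d => .sig (A d) (B (v d) (d + 1))
/-- Function type. -/
def arr (A B : Tm) : Tm := fun d => .arrow (A d) (B d)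
/-- Pair. -/
def pair (a b : Tm) : Tm := fun d => .pair (a d) (b d)
/-- First projection. -/
def fst (p : Tm) : Tm := fun d => .fst (p d)
/-- Second projection. -/
def snd (p : Tm) : Tm := fun d => .snd (p d)
/-- Eliminator of pairs. -/
def split (C : Tm → Tm) (t : Tm → Tm → Tm) (p : Tm) : Tm := fun d =>
  .split (C (v d) (d + 1)) (t (v d) (v (d + 1)) (d + 2)) (p d)
/-- Identity type. -/
def id (A a b : Tm) : Tm := fun d => .id (A d) (a d) (b d)
/-- Reflexivity. -/
def refl (a : Tm) : Tm := fun d => .refl (a d)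
/-- Path induction. -/
def J (C : Tm → Tm → Tm) (t p : Tm) : Tm := fun d =>
  .idrec (C (v d) (v (d + 1)) (d + 2)) (t d) (p d)
/-- The univalence axiom. -/
def ua (A B : Tm) : Tm := fun d => .app (.app .ua (A d)) (B d)
/-- The type of equivalences. -/
def equiv (A B : Tm) : Tm := fun d => .equiv (A d) (B d)
/-- The canonical map from paths to equivalences. -/
def idToEquiv (A p : Tm) : Tm := fun d => .idToEquiv (A d) (p d)

/-- A term with a type annotation, written as a `β`-redex. -/
def ann (t A : Tm) : Tm := lam A (fun x => x) ⬝ t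

/-- The type of univalent maps. -/
def isUMap (A B R : Tm) : Tm := fun d => .isUMap (A d) (B d) (R d)
/-- The inverse of a relation. -/
def flip (A B R : Tm) : Tm := fun d => .flip (A d) (B d) (R d)
/-- The type of univalent relations. -/
def param (i : ℕ) (A B : Tm) : Tm := fun d => .param i (A d) (B d)
/-- The projection of a path in a dependent pair type to its base `A`. -/
def apFst (A a q : Tm) : Tm := J (fun z _ => id A a (fst z)) (refl a) q
/-- The path from `z'` to `z` composed of the inverse of `q : x = z'` and `q' : x = z`. -/
def comp (S z q q' : Tm) : Tm := J (fun w _ => id S w z) q' q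
/-- A path from `refl` to the composition of `q : x = z` and its inverse. -/
def compSelf (S x q : Tm) : Tm :=
  J (fun w q => id (id S w w) (refl w) (comp S w q q)) (refl (refl x)) q

end Tm

namespace Checker

open Term

/-! ## Proof scripts

A script declares the variables of a context, states a type and proves that it is inhabited; it may
use previously proved theorems, which are abstracted as variables. -/

/-- No universe occurs in a term. -/
def noSort : Term → Bool
  | .var _ => true
  | .sort _ => false
  | .app t u => noSort t && noSort u
  | .lam A t => noSort A && noSort t
  | .pi A B => noSort A && noSort B
  | .sig A B => noSort A && noSort B
  | .pair a b => noSort a && noSort b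
  | .fst p => noSort p
  | .snd p => noSort p
  | .split C d p => noSort C && noSort d && noSort p
  | .id A a b => noSort A && noSort a && noSort b
  | .refl a => noSort a
  | .idrec C d p => noSort C && noSort d && noSort p
  | .ua => true

theorem shift_of_noSort {t : Term} (h : noSort t = true) (k : ℕ) : t.shift k = t := by
  induction t <;> simp_all [noSort, Term.shift]

/-- `A` is inhabited in the context `Γ`, by a term without universes if `sf` is true. -/
def Inh (sf : Bool) (Γ : Ctx) (A : Term) : Prop :=
  ∃ t, (sf = true → ∀ k, t.shift k = t) ∧ Typing .univalent Γ t A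

/-- A well-formed type in a well-formed context, with a proof that it is inhabited. -/
structure Thm where
  /-- Whether the inhabitant contains no universe. -/
  sf : Bool
  /-- The context. -/
  ctx : Ctx
  /-- The type. -/
  type : Term
  wf : WfCtx ctx
  isType : IsType ctx type
  inh : Inh sf ctx type

/-- Generalized instances of a theorem. -/
inductive Instance : Type
  | bind (A : Tm) (r : Tm → Instance)
  | args (as : List Tm)

/-- Proofs that a type is inhabited. -/
inductive Proof : Type
  | done (t : Tm)
  | cut (T t : Tm) (r : Tm → Proof)
  | use (J : Thm) (l : ℕ) (i : Instance) (r : Tm → Proof)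

/-- Theorems with proofs. -/
inductive Script : Type
  | decl (A : Tm) (r : Tm → Script)
  | goal (T : Tm) (p : Proof)

/-- Type inference. -/
def infer : Ctx → Term → Option Term := (run 300).1

/-- Type checking. -/
def check : Ctx → Term → Term → Bool := (run 300).2

/-- The universe of a type. -/
def isType (Γ : Ctx) (A : Term) : Bool := (sortOf infer Γ A).isSome

/-- The substitution given by a list of terms, last one first. -/
def subOf : List Term → ℕ → Term
  | [] => .var
  | a :: as => scons a (subOf as)

/-- The terms `as` inhabit the types of the context `Δ` shifted by `l` levels. -/
def checkSub (l : ℕ) (Γ : Ctx) : List Term → Ctx → Bool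
  | [], [] => true
  | a :: as, A :: Δ => checkSub l Γ as Δ && check Γ a ((A.shift l).subst (subOf as))
  | _, _ => false

/-- The type of an instance of a theorem. -/
def Instance.type (J : Thm) (l : ℕ) : Instance → ℕ → Term
  | bind A r, d => .pi (A d) ((r (.v d)).type J l (d + 1))
  | args as, d => nf 1000 ((J.type.shift l).subst (subOf (as.map fun a => a d).reverse))

/-- The correctness of an instance of a theorem. -/
def Instance.check (sf : Bool) (J : Thm) (l : ℕ) : Instance → Ctx → Bool
  | bind A r, Γ => isType Γ (A Γ.length) && (!sf || noSort (A Γ.length)) &&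
      (r (.v Γ.length)).check sf J l (A Γ.length :: Γ)
  | args as, Γ => (!sf || J.sf && (as.map fun a => a Γ.length).all noSort) &&
      checkSub l Γ (as.map fun a => a Γ.length).reverse J.ctx &&
      isType Γ ((args as).type J l Γ.length)

/-- The correctness of a proof. -/
def Proof.check (sf : Bool) : Proof → Ctx → Term → Bool
  | done t, Γ, A => (!sf || noSort (t Γ.length)) && Checker.check Γ (t Γ.length) A
  | cut T t r, Γ, A => isType Γ (T Γ.length) &&
      (!sf || noSort (t Γ.length)) && Checker.check Γ (t Γ.length) (T Γ.length) &&
      (r (.v Γ.length)).check sf (T Γ.length :: Γ) (A.lift 1)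
  | use J l i r, Γ, A => i.check sf J l Γ &&
      (r (.v Γ.length)).check sf (i.type J l Γ.length :: Γ) (A.lift 1)

/-- The context of a script. -/
def Script.ctx : Script → Ctx → Ctx
  | decl A r, Γ => (r (.v Γ.length)).ctx (A Γ.length :: Γ)
  | goal _ _, Γ => Γ

/-- The statement of a script. -/
def Script.type : Script → ℕ → Term
  | decl _ r, d => (r (.v d)).type (d + 1)
  | goal T _, d => T d

/-- The correctness of a script. -/
def Script.check (sf : Bool) : Script → Ctx → Bool
  | decl A r, Γ => isType Γ (A Γ.length) && (r (.v Γ.length)).check sf (A Γ.length :: Γ)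
  | goal T p, Γ => isType Γ (T Γ.length) && p.check sf Γ (T Γ.length)

/-! ### Soundness of proof scripts. -/

theorem isType_sound {Γ : Ctx} {A : Term} (hΓ : CtxValid Γ) (h : isType Γ A = true) : IsType Γ A := by
  obtain ⟨i, h⟩ := Option.isSome_iff_exists.1 h
  exact ⟨i, sortOf_sound (run_sound _).1 hΓ h⟩

theorem shift_of_check {sf : Bool} {t : Term} (h : (!sf || noSort t) = true) :
    sf = true → ∀ k, t.shift k = t := by
  rintro rfl
  exact shift_of_noSort h

/-- Each term can be checked against its instantiated type because that type is well-formed: it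
comes from a well-formed context by a shift and by a substitution already known to be typed. -/
theorem checkSub_sound {l : ℕ} {Γ : Ctx} (hΓ : CtxValid Γ) {Δ : Ctx} (hΔ : WfCtx Δ) :
    ∀ {as : List Term}, checkSub l Γ as Δ = true →
      SubTyped .univalent (Δ.map (Term.shift l)) Γ (subOf as) := by
  induction hΔ with
  | nil =>
    intro as h
    exact SubTyped.nil
  | @cons Δ A i _ hA ih =>
    intro as h
    cases as with
    | nil => cases h
    | cons a as =>
      simp only [checkSub, Bool.and_eq_true] at h
      have hs := ih h.1
      exact hs.scons ((run_sound _).2 _ _ _ hΓ ⟨_, (hA.shift l).subst hs⟩ h.2)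

theorem shift_subOf {as : List Term} (h : as.all noSort = true) (k n : ℕ) :
    (subOf as n).shift k = subOf as n := by
  induction as generalizing n with
  | nil => rfl
  | cons a as ih =>
    simp only [List.all_cons, Bool.and_eq_true] at h
    cases n with
    | zero => exact shift_of_noSort h.1 k
    | succ n => exact ih h.2 n

/-- The inhabitant is the shifted proof of the theorem, instantiated; its type is then replaced by a
normal form. If neither that proof nor the arguments and abstracted types contain universes, the
result is again fixed by shifting. -/
theorem Instance.sound {sf : Bool} {J : Thm} {l : ℕ} (i : Instance) : ∀ {Γ : Ctx},
    CtxValid Γ → i.check sf J l Γ = true →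
      IsType Γ (i.type J l Γ.length) ∧ Inh sf Γ (i.type J l Γ.length) := by
  induction i with
  | bind A r ih =>
    intro Γ hΓ h
    simp only [check, Bool.and_eq_true] at h
    obtain ⟨i, hA⟩ := isType_sound hΓ h.1.1
    obtain ⟨⟨j, hT⟩, t, ht, hty⟩ := ih _ (hΓ.cons hA) h.2
    refine ⟨⟨_, .pi' hA hT⟩, .lam (A Γ.length) t, fun hs k => ?_, .lam hA hty⟩
    rw [Term.shift, shift_of_check h.1.2 hs, ht hs]
  | args as =>
    intro Γ hΓ h
    simp only [check, Bool.and_eq_true] at h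
    obtain ⟨i, hT⟩ := isType_sound hΓ h.2
    refine ⟨⟨i, hT⟩, ?_⟩
    obtain ⟨t, ht, hty⟩ := J.inh
    refine ⟨(t.shift l).subst (subOf (as.map fun a => a Γ.length).reverse), fun hs k => ?_, ?_⟩
    · subst hs
      have := h.1.1
      simp only [Bool.not_true, Bool.false_or, Bool.and_eq_true] at this
      rw [ht this.1, shift_subst, ht this.1]
      congr 1; funext n
      exact shift_subOf (by rw [List.all_reverse]; exact this.2) k n
    · exact .conv ((hty.shift l).subst (checkSub_sound hΓ J.wf h.1.2)) (.conv (nf_sound _ _)) hT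

/-- While the rest of a proof is checked, the auxiliary fact is a mere variable. Its proof is
substituted only here, outside the evaluated checker, which therefore never normalizes earlier
proofs. -/
theorem Inh.cut {sf : Bool} {Γ : Ctx} {A B : Term} (hA : Inh sf Γ A)
    (hB : Inh sf (A :: Γ) (B.lift 1)) : Inh sf Γ B := by
  obtain ⟨t, ht, hty⟩ := hA
  obtain ⟨u, hu, huy⟩ := hB
  refine ⟨u.inst t, fun hs k => ?_, ?_⟩
  · rw [shift_inst, hu hs, ht hs]
  · have := huy.inst hty
    rwa [lift_inst] at this

theorem Proof.sound {sf : Bool} (p : Proof) : ∀ {Γ : Ctx} {A : Term}, CtxValid Γ → IsType Γ A →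
    p.check sf Γ A = true → Inh sf Γ A := by
  induction p with
  | done t =>
    intro Γ A hΓ hA h
    simp only [check, Bool.and_eq_true] at h
    exact ⟨_, shift_of_check h.1, (run_sound _).2 _ _ _ hΓ hA h.2⟩
  | cut T t r ih =>
    intro Γ A hΓ hA h
    simp only [check, Bool.and_eq_true] at h
    obtain ⟨i, hT⟩ := isType_sound hΓ h.1.1.1
    obtain ⟨j, hA⟩ := hA
    exact Inh.cut ⟨_, shift_of_check h.1.1.2, (run_sound _).2 _ _ _ hΓ ⟨i, hT⟩ h.1.2⟩
      (ih _ (hΓ.cons hT) ⟨j, hA.lift _⟩ h.2)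
  | use J l i r ih =>
    intro Γ A hΓ hA h
    simp only [check, Bool.and_eq_true] at h
    obtain ⟨⟨k, hT⟩, hI⟩ := i.sound hΓ h.1
    obtain ⟨j, hA⟩ := hA
    exact hI.cut (ih _ (hΓ.cons hT) ⟨j, hA.lift _⟩ h.2)

theorem Script.sound {sf : Bool} (s : Script) : ∀ {Γ : Ctx}, WfCtx Γ → s.check sf Γ = true →
    WfCtx (s.ctx Γ) ∧ IsType (s.ctx Γ) (s.type Γ.length) ∧ Inh sf (s.ctx Γ) (s.type Γ.length) := by
  induction s with
  | decl A r ih =>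
    intro Γ hΓ h
    simp only [check, Bool.and_eq_true] at h
    obtain ⟨i, hA⟩ := isType_sound hΓ.ctxValid h.1
    exact ih _ (hΓ.cons hA) h.2
  | goal T p =>
    intro Γ hΓ h
    simp only [check, Bool.and_eq_true] at h
    have hT := isType_sound hΓ.ctxValid h.1
    exact ⟨hΓ, hT, p.sound hΓ.ctxValid hT h.2⟩

/-- The theorem proved by a script. -/
def Script.thm (sf : Bool) (s : Script) (h : s.check sf [] = true) : Thm where
  sf := sf
  ctx := s.ctx []
  type := s.type 0
  wf := (s.sound .nil h).1
  isType := (s.sound .nil h).2.1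
  inh := (s.sound .nil h).2.2

end Checker

end Trocq

namespace Trocq

open Checker

namespace Tm

/-! ## Contractible types -/

/-- The type `X` is contractible. -/
def isContr (X : Tm) : Tm := sig X fun z => pi X fun w => id X z w

/-- The image of `a` under the relation whose fibers are contracted by `h`. -/
def map (h a : Tm) : Tm := fst (fst (h ⬝ a))

/-- The proof that `a` is related to its image. -/
def rel (h a : Tm) : Tm := snd (fst (h ⬝ a))

/-- Function extensionality: a path from `f` to `g`, given `h : Π x : D, f x = g x`. -/
def funext (D : Tm) (B : Tm → Tm) (f g h : Tm) : Tm :=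
  -- `X` consists of the points of `D` with a path out of the value of `f`. Its projection `w` to
  -- `D` is an equivalence, packed in `e`, and both `k` and `k'` are sections of `w` by computation.
  let X := sig D fun x => sig (B x) fun u => id (B x) (f ⬝ x) u
  let w := lam X fun z => fst z
  let k := ann (lam D fun x => pair x (pair (f ⬝ x) (refl (f ⬝ x)))) (arr D X)
  let k' := lam D fun x => pair x (pair (g ⬝ x) (h ⬝ x))
  let elim (C : Tm → Tm) (t : Tm → Tm) := lam X fun z =>
    split C (fun x q => split (fun q => C (pair x q))
      (fun _ p => J (fun y p => C (pair x (pair y p))) (t x) p) q) z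
  let s := elim (fun z => id X (k ⬝ fst z) z) fun x => refl (k ⬝ x)
  let ap := fun z => J (fun y _ => id D (fst z) (fst y)) (refl (fst z)) (s ⬝ z)
  let c := elim (fun z => id (id D (fst z) (fst z)) (ap z) (refl (fst z))) fun x => refl (refl x)
  let e := pair w (pair k (pair s (pair (lam D fun x => refl x) c)))
  -- `F Y w` is a strong injectivity of composition with `w`: a path from `w ∘ k` to `w ∘ k'` makes
  -- `k'`, together with this path, equal to `k` with `refl`.
  let T (Y w k κ : Tm) := id (arr D Y) (lam D fun x => w ⬝ (k ⬝ x)) (lam D fun x => w ⬝ (κ ⬝ x))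
  let S (Y w k : Tm) := sig (arr D X) fun κ => T Y w k κ
  let F (Y w : Tm) := pi (arr D X) fun k => pi (arr D X) fun k' => pi (T Y w k k') fun q =>
    id (S Y w k) (pair k (refl (lam D fun x => w ⬝ (k ⬝ x)))) (pair k' q)
  -- For the identity map of `X`, strong injectivity is path induction. Univalence then turns `e`
  -- into a path, and two transports carry the property to `w`. No universe is written in the
  -- process.
  let F₀ := lam (arr D X) fun k => lam (arr D X) fun k' => lam (id (arr D X) k k') fun q =>
    J (fun y q => id (sig (arr D X) fun κ => id (arr D X) k κ) (pair k (refl k)) (pair y q))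
      (refl (pair k (refl k))) q
  let p := fst (ua X D) ⬝ e
  let F₁ := J (fun Y p => F Y (fst (idToEquiv X p))) F₀ p
  let F₂ := J (fun e _ => F D (fst e)) F₁ (fst (snd (snd (ua X D))) ⬝ e)
  let Q := F₂ ⬝ k ⬝ k' ⬝ refl (lam D fun x => x)
  -- A section up to a path gives a function in `Π x, B x` by transporting the second components
  -- along that path. Up to conversion `G` yields `f` on `k` and `g` on `k'`, so the path `Q`
  -- becomes the required one.
  let G (z : Tm) := lam D fun x =>
    J (fun m _ => arr (B (m ⬝ x)) (B x)) (lam (B x) fun b => b) (snd z) ⬝ fst (snd (fst z ⬝ x))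
  J (fun z _ => id (pi D B) f (G z)) (refl f) Q

end Tm

/-! ### Function extensionality, univalent maps and contractible fibers. -/

open Tm

/-- Function extensionality. -/
def funextThm : Thm := Script.thm true
  (.decl (sort 0) fun D => .decl (arr D (sort 0)) fun B =>
    .decl (pi D fun x => B ⬝ x) fun f => .decl (pi D fun x => B ⬝ x) fun g =>
    .decl (pi D fun x => id (B ⬝ x) (f ⬝ x) (g ⬝ x)) fun h =>
    .goal (id (pi D fun x => B ⬝ x) f g) <| .done (Tm.funext D (fun x => B ⬝ x) f g h))
  (by decide +kernel)

/-- Function extensionality for a given type of functions. -/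
def funextInst (D : Tm) (B : Tm → Tm) : Instance :=
  .bind (pi D B) fun f => .bind (pi D B) fun g =>
    .bind (pi D fun x => id (B x) (f ⬝ x) (g ⬝ x)) fun h => .args [D, lam D B, f, g, h]

/-- A relation with contractible fibers is a univalent map. -/
def ofContrThm : Thm := Script.thm true
  (.decl (sort 0) fun A => .decl (sort 0) fun B => .decl (arr A (arr B (sort 0))) fun R =>
    .decl (pi A fun a => isContr (sig B fun b => R ⬝ a ⬝ b)) fun H =>
    .goal (isUMap A B R) <| .done <|
      -- The map picks the centers of the fibers; `g` transports the relatedness of the center, and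
      -- `h` projects a path of the fiber to its base.
      let g (a p : Tm) := J (fun y _ => R ⬝ a ⬝ y) (rel H a) p
      let h (a q : Tm) := apFst B (map H a) q
      pair (lam A fun a => map H a) <|
      pair (lam A fun a => lam B fun b => lam (id B (map H a) b) fun p => g a p) <|
      pair (lam A fun a => lam B fun b => lam (R ⬝ a ⬝ b) fun x => h a (snd (H ⬝ a) ⬝ pair b x)) <|
      -- Induction on the path from the center to the point given by `b` and `x`: at the center both
      -- sides compute to the same proof.
      lam A fun a => lam B fun b => lam (R ⬝ a ⬝ b) fun x =>
        J (fun z q => id (R ⬝ a ⬝ fst z) (g a (h a q)) (snd z)) (refl (rel H a))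
          (snd (H ⬝ a) ⬝ pair b x))
  (by decide +kernel)

/-- The fibers of a univalent map are contractible. -/
def toContrThm : Thm := Script.thm true
  (.decl (sort 0) fun A => .decl (sort 0) fun B => .decl (arr A (arr B (sort 0))) fun R =>
    .decl (isUMap A B R) fun u => .decl A fun a =>
    .goal (isContr (sig B fun b => R ⬝ a ⬝ b)) <| .done <|
      let S := sig B fun b => R ⬝ a ⬝ b
      let m := fst u ⬝ a
      let z := pair m (fst (snd u) ⬝ a ⬝ m ⬝ refl m)
      -- The last component of the univalent map replaces `x` by the image of a path under the
      -- second one; induction on this path then reaches the center.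
      pair z <| lam S fun w => split (fun w => id S z w) (fun b x =>
        J (fun y _ => id S z (pair b y))
          (J (fun y p => id S z (pair y (fst (snd u) ⬝ a ⬝ y ⬝ p))) (refl z)
            (fst (snd (snd u)) ⬝ a ⬝ b ⬝ x))
          (snd (snd (snd u)) ⬝ a ⬝ b ⬝ x)) w)
  (by decide +kernel)

/-- A form of the axiom of choice: functions in contractible types are contractible. -/
def choiceThm : Thm := Script.thm true
  (.decl (sort 0) fun A => .decl (arr A (sort 0)) fun B =>
    .decl (pi A fun x => arr (B ⬝ x) (sort 0)) fun T =>
    .decl (pi A fun x => isContr (sig (B ⬝ x) fun y => T ⬝ x ⬝ y)) fun h =>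
    .goal (isContr (sig (pi A fun x => B ⬝ x) fun f => pi A fun x => T ⬝ x ⬝ (f ⬝ x))) <|
      .use funextThm 0 (funextInst A fun x => sig (B ⬝ x) fun y => T ⬝ x ⬝ y) fun ext => .done <|
        let X := sig (pi A fun x => B ⬝ x) fun f => pi A fun x => T ⬝ x ⬝ (f ⬝ x)
        let z := pair (lam A fun x => map h x) (lam A fun x => rel h x)
        pair z <| lam X fun w => split (fun w => id X z w) (fun f F =>
          -- Pointwise contraction paths combine, by extensionality, into a path between functions
          -- with values in pairs. Splitting such a function into its two components gives back `f`
          -- and `F` by η.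
          J (fun Y _ => id X z (pair (lam A fun x => fst (Y ⬝ x)) (lam A fun x => snd (Y ⬝ x))))
            (refl z) (ext ⬝ (lam A fun x => fst (h ⬝ x)) ⬝ (lam A fun x => pair (f ⬝ x) (F ⬝ x)) ⬝
              lam A fun x => snd (h ⬝ x) ⬝ pair (f ⬝ x) (F ⬝ x))) w)
  (by decide +kernel)

/-- Functions on a contractible type with values in contractible types are contractible. -/
def piFiberThm : Thm := Script.thm true
  (.decl (sort 0) fun A => .decl (arr A (sort 0)) fun S =>
    .decl (isContr (sig A fun x => S ⬝ x)) fun h => .decl (sort 0) fun B =>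
    .decl (pi A fun x => arr (S ⬝ x) (arr B (sort 0))) fun R =>
    .decl (pi A fun x => pi (S ⬝ x) fun s => isContr (sig B fun y => R ⬝ x ⬝ s ⬝ y)) fun k =>
    .goal (isContr (sig B fun y => pi A fun x => pi (S ⬝ x) fun s => R ⬝ x ⬝ s ⬝ y)) <|
      let P (y : Tm) := pi A fun x => pi (S ⬝ x) fun s => R ⬝ x ⬝ s ⬝ y
      let T := sig B P
      -- A relation proof at the center of the contractible domain extends to the whole domain by
      -- transport along the contraction.
      let ext (y r : Tm) := lam A fun x => lam (S ⬝ x) fun s =>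
        J (fun z _ => R ⬝ fst z ⬝ snd z ⬝ y) r (snd h ⬝ pair x s)
      .use funextThm 0 (.bind B fun y => funextInst A fun x => pi (S ⬝ x) fun s =>
        R ⬝ x ⬝ s ⬝ y) fun ext₁ =>
      .use funextThm 0 (.bind B fun y => .bind A fun x => funextInst (S ⬝ x) fun s =>
        R ⬝ x ⬝ s ⬝ y) fun ext₂ => .done <|
        let k₀ := k ⬝ fst (fst h) ⬝ snd (fst h)
        let z₀ := pair (fst (fst k₀)) (ext (fst (fst k₀)) (snd (fst k₀)))
        pair z₀ <| lam T fun w => split (fun w => id T z₀ w) (fun y t =>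
          -- The family `t` is compared with the extension of its own value at the center: `p` moves
          -- this value along the contraction of the fiber there, and `q` identifies the extension
          -- with `t` by extensionality in both arguments.
          let r := t ⬝ fst (fst h) ⬝ snd (fst h)
          let p := J (fun z _ => id T z₀ (pair (fst z) (ext (fst z) (snd z)))) (refl z₀)
            (snd k₀ ⬝ pair y r)
          let q := ext₁ ⬝ y ⬝ ext y r ⬝ t ⬝ lam A fun x =>
            ext₂ ⬝ y ⬝ x ⬝ (ext y r ⬝ x) ⬝ (t ⬝ x) ⬝ lam (S ⬝ x) fun s => J
              (fun z q => id (R ⬝ fst z ⬝ snd z ⬝ y) (J (fun z _ => R ⬝ fst z ⬝ snd z ⬝ y) r q)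
                (t ⬝ fst z ⬝ snd z)) (refl r) (snd h ⬝ pair x s)
          J (fun s _ => id T z₀ (pair y s)) p q) w)
  (by decide +kernel)

/-- The relation on functions given by related families has contractible fibers. -/
def piContrThm : Thm := Script.thm true
  (.decl (sort 0) fun A => .decl (sort 0) fun A' => .decl (arr A (arr A' (sort 0))) fun S =>
    .decl (pi A' fun x' => isContr (sig A fun x => S ⬝ x ⬝ x')) fun h =>
    .decl (arr A' (sort 0)) fun B' =>
    .decl (pi A fun x => pi A' fun x' => arr (S ⬝ x ⬝ x') (arr (B' ⬝ x') (sort 0))) fun R =>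
    .decl (pi A fun x => pi A' fun x' => pi (S ⬝ x ⬝ x') fun s =>
      isContr (sig (B' ⬝ x') fun y => R ⬝ x ⬝ x' ⬝ s ⬝ y)) fun k =>
    .goal (isContr (sig (pi A' fun x' => B' ⬝ x') fun f => pi A' fun x' => pi A fun x =>
      pi (S ⬝ x ⬝ x') fun s => R ⬝ x ⬝ x' ⬝ s ⬝ (f ⬝ x'))) <|
      -- The problem is solved separately over each `x'`, where the related elements of `A` form a
      -- contractible type; choice then collects the solutions into a function of `x'`.
      .use piFiberThm 0 (.bind A' fun x' => .args [A, lam A fun x => S ⬝ x ⬝ x', h ⬝ x', B' ⬝ x',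
        lam A fun x => lam (S ⬝ x ⬝ x') fun s => lam (B' ⬝ x') fun y => R ⬝ x ⬝ x' ⬝ s ⬝ y,
        lam A fun x => lam (S ⬝ x ⬝ x') fun s => k ⬝ x ⬝ x' ⬝ s]) fun fib =>
      .use choiceThm 0 (.args [A', B', lam A' fun x' => lam (B' ⬝ x') fun y =>
        pi A fun x => pi (S ⬝ x ⬝ x') fun s => R ⬝ x ⬝ x' ⬝ s ⬝ y, fib]) .done)
  (by decide +kernel)

end Trocq

namespace Trocq

open Checker Tm

/-! ## Products -/

/-- The relation `λ f f', Π x x' xR, Rel(BR x x' xR) (f x) (f' x')`. -/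
def Tm.prodRel (A A' AR B B' BR : Tm) : Tm := fun d =>
  piRel (A d) (A' d) (AR d) (B d) (B' d) (BR d)

/-- The relation on dependent functions is a univalent map. -/
def piUMapThm : Thm := Script.thm true
  (.decl (sort 0) fun A => .decl (sort 0) fun A' => .decl (param 0 A A') fun AR =>
    .decl (arr A (sort 0)) fun B => .decl (arr A' (sort 0)) fun B' =>
    .decl (pi A fun x => pi A' fun x' => pi (fst AR ⬝ x ⬝ x') fun _ =>
      param 0 (B ⬝ x) (B' ⬝ x')) fun BR =>
    let PB := pi A fun x => B ⬝ x
    let PB' := pi A' fun x' => B' ⬝ x'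
    let S (x x' : Tm) := fst AR ⬝ x ⬝ x'
    let R (f x x' s y : Tm) := fst (BR ⬝ x ⬝ x' ⬝ s) ⬝ (f ⬝ x) ⬝ y
    .goal (isUMap PB PB' (prodRel A A' AR B B' BR)) <|
      -- The two directions are mixed: contractibility is used backwards for the domains, to find
      -- the elements related to `x'`, and forwards for the families.
      .use toContrThm 0 (.bind A' fun x' =>
        .args [A', A, flip A A' (fst AR), snd (snd AR), x']) fun h =>
      .use toContrThm 0 (.bind A fun x => .bind A' fun x' => .bind (S x x') fun s =>
        .bind (B ⬝ x) fun y => .args [B ⬝ x, B' ⬝ x', fst (BR ⬝ x ⬝ x' ⬝ s),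
          fst (snd (BR ⬝ x ⬝ x' ⬝ s)), y]) fun k =>
      .use piContrThm 0 (.bind PB fun f => .args [A, A', fst AR, h, B',
        lam A fun x => lam A' fun x' => lam (S x x') fun s => lam (B' ⬝ x') fun y => R f x x' s y,
        lam A fun x => lam A' fun x' => lam (S x x') fun s => k ⬝ x ⬝ x' ⬝ s ⬝ (f ⬝ x)]) fun K =>
      let X (f : Tm) := sig PB' fun f' => pi A fun x => pi A' fun x' => pi (S x x') fun s =>
        R f x x' s (f' ⬝ x')
      -- The fibers just contracted quantify over `x'` before `x`, while the relation quantifies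
      -- over `x` first. Exchanging the arguments is invertible up to β and η, so the contraction is
      -- carried over.
      let swap (F : Tm) := lam A fun x => lam A' fun x' => lam (S x x') fun s => F ⬝ x' ⬝ x ⬝ s
      let swap' (F : Tm) := lam A' fun x' => lam A fun x => lam (S x x') fun s => F ⬝ x ⬝ x' ⬝ s
      let z (f : Tm) := pair (map K f) (swap (rel K f))
      .use ofContrThm 0 (.args [PB, PB', prodRel A A' AR B B' BR, lam PB fun f => pair (z f) <|
        lam (X f) fun w => split (fun w => id (X f) (z f) w) (fun f' F =>
          J (fun w _ => id (X f) (z f) (pair (fst w) (swap (snd w)))) (refl (z f))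
            (snd (K ⬝ f) ⬝ pair f' (swap' F))) w]) .done)
  (by decide +kernel)

/-- The inverse of the relation on dependent functions is a univalent map. -/
def piUMapInvThm : Thm := Script.thm true
  (.decl (sort 0) fun A => .decl (sort 0) fun A' => .decl (param 0 A A') fun AR =>
    .decl (arr A (sort 0)) fun B => .decl (arr A' (sort 0)) fun B' =>
    .decl (pi A fun x => pi A' fun x' => pi (fst AR ⬝ x ⬝ x') fun _ =>
      param 0 (B ⬝ x) (B' ⬝ x')) fun BR =>
    let PB := pi A fun x => B ⬝ x
    let PB' := pi A' fun x' => B' ⬝ x'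
    let S (x x' : Tm) := fst AR ⬝ x ⬝ x'
    .goal (isUMap PB' PB (flip PB PB' (prodRel A A' AR B B' BR))) <|
      -- Here the domains are used forwards and the families backwards, and the order of the
      -- quantifiers already agrees with the relation.
      .use toContrThm 0 (.bind A fun x => .args [A, A', fst AR, fst (snd AR), x]) fun h =>
      .use toContrThm 0 (.bind A' fun x' => .bind A fun x => .bind (S x x') fun s =>
        .bind (B' ⬝ x') fun y => .args [B' ⬝ x', B ⬝ x, flip (B ⬝ x) (B' ⬝ x') (fst (BR ⬝ x ⬝ x' ⬝ s)),
          snd (snd (BR ⬝ x ⬝ x' ⬝ s)), y]) fun k =>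
      .use piContrThm 0 (.bind PB' fun f => .args [A', A, flip A A' (fst AR), h, B,
        lam A' fun x' => lam A fun x => lam (S x x') fun s => lam (B ⬝ x) fun y =>
          fst (BR ⬝ x ⬝ x' ⬝ s) ⬝ y ⬝ (f ⬝ x'),
        lam A' fun x' => lam A fun x => lam (S x x') fun s => k ⬝ x' ⬝ x ⬝ s ⬝ (f ⬝ x')]) fun K =>
      .use ofContrThm 0 (.args [PB', PB, flip PB PB' (prodRel A A' AR B B' BR), K]) .done)
  (by decide +kernel)

/-! ## Universes -/

namespace Tm

/-- A path to `w` from any element of a type contracted by `h`. -/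
def path (X h z w : Tm) : Tm := comp X w (snd h ⬝ z) (snd h ⬝ w)

/-- Contraction of the type of the paths from `x`. -/
def contrTo (X x : Tm) : Tm :=
  let S := sig X fun y => id X x y
  pair (pair x (refl x)) <| lam S fun w => split (fun w => id S (pair x (refl x)) w)
    (fun _ p => J (fun y p => id S (pair x (refl x)) (pair y p)) (refl (pair x (refl x))) p) w

/-- Contraction of the type of the paths to `x`. -/
def contrFrom (X x : Tm) : Tm :=
  let S (x : Tm) := sig X fun y => id X y x
  pair (pair x (refl x)) <| lam (S x) fun w => split (fun w => id (S x) (pair x (refl x)) w)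
    (fun y p => J (fun x p => id (S x) (pair x (refl x)) (pair y p)) (refl (pair y (refl y))) p) w

/-- The type `X` is a proposition. -/
def isProp (X : Tm) : Tm := pi X fun u => pi X fun u' => id X u u'

/-- The identity relation. -/
def idRel (A : Tm) : Tm := lam A fun a => lam A fun b => id A a b

/-- The identity is a univalent map. -/
def idUMap (A : Tm) : Tm :=
  let g (t : Tm → Tm) := lam A fun a => lam A fun b => lam (id A a b) t
  pair (lam A fun x => x) (pair (g fun p => p) (pair (g fun p => p) (g refl)))

/-- The type of the proofs that `f` is an equivalence. -/
def isEquiv (A B f : Tm) : Tm := fun d => .isEquiv (A d) (B d) (f d)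

end Tm

/-- Contractible relations are equivalent to identity types. -/
def idEquivThm : Thm := Script.thm true
  (.decl (sort 0) fun Y => .decl (arr Y (sort 0)) fun S => .decl Y fun a => .decl (S ⬝ a) fun c =>
    .decl (isContr (sig Y fun y => S ⬝ y)) fun h =>
    .goal (pi Y fun y => equiv (id Y a y) (S ⬝ y)) <| .done <|
      let T := sig Y fun y => S ⬝ y
      -- The paths go through the center of the total space, so the path from the base point to
      -- itself is trivial only up to a path, which is `N`.
      let κ (y x : Tm) := path T h (pair a c) (pair y x)
      let g (p : Tm) := J (fun y _ => S ⬝ y) c p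
      let P (p : Tm) := id Y a p
      let k (q : Tm) := apFst Y a q
      let N := compSelf T (fst h) (snd h ⬝ pair a c)
      let sBase (N : Tm) := J (fun q _ => id (P a) (k q) (refl a)) (refl (refl a)) N
      let s (p : Tm) := J (fun y p => id (P y) (k (κ y (g p))) p) (sBase N) p
      let r (q : Tm) := J (fun z q => id (S ⬝ fst z) (g (k q)) (snd z)) (refl c) q
      let apg (y x p : Tm) := J (fun p' _ => id (S ⬝ y) (g x) (g p')) (refl (g x)) p
      -- After path induction on `p` only the loop at the base point remains. Replacing it by `refl`
      -- along `N` makes all the terms of the coherence compute.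
      let coh (q N : Tm) := J (fun q N => id (id (S ⬝ a) (g (k q)) c) (apg a (k q) (sBase N)) (r q))
        (refl (refl c)) N
      lam Y fun y =>
        pair (lam (P y) g) <| pair (lam (S ⬝ y) fun x => k (κ y x)) <| pair (lam (P y) s) <|
        pair (lam (S ⬝ y) fun x => r (κ y x)) <|
        lam (P y) fun p => J (fun y p => id (id (S ⬝ y) (g (k (κ y (g p)))) (g p))
          (apg y (k (κ y (g p))) (s p)) (r (κ y (g p)))) (coh (κ a c) N) p)
  (by decide +kernel)

/-- A relation with contractible fibers in both directions is an equivalence. -/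
def equivThm : Thm := Script.thm true
  (.decl (sort 0) fun A => .decl (sort 0) fun B => .decl (arr A (arr B (sort 0))) fun R =>
    .decl (pi A fun a => isContr (sig B fun b => R ⬝ a ⬝ b)) fun h =>
    .decl (pi B fun b => isContr (sig A fun a => R ⬝ a ⬝ b)) fun k =>
    .goal (isEquiv A B (lam A fun a => map h a)) <| .done <|
      let T (a : Tm) := sig B fun b => R ⬝ a ⬝ b
      let m (a : Tm) := map h a
      let c (a : Tm) := rel h a
      let n (b : Tm) := map k b
      let q (a : Tm) := snd (h ⬝ a) ⬝ pair (m a) (c a)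
      let ρ (a b x : Tm) := apFst B (m a) (path (T a) (h ⬝ a) (pair (m a) (c a)) (pair b x))
      let s (a : Tm) := apFst A (n (m a)) (snd (k ⬝ m a) ⬝ pair a (c a))
      let r (b : Tm) := ρ (n b) b (rel k b)
      let ap (x p : Tm) := J (fun y _ => id B (m x) (m y)) (refl (m x)) p
      let trans (x p t : Tm) := J (fun y _ => id B x y) p t
      let N (a : Tm) := J (fun q _ => id (id B (m a) (m a)) (refl (m a)) (apFst B (m a) q))
        (refl (refl (m a))) (compSelf (T a) (fst (h ⬝ a)) (q a))
      let unit (x t : Tm) := J (fun y t => id (id B x y) (trans x (refl x) t) t) (refl (refl x)) t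
      -- Induction on a path in the backward fiber over `b`, starting from its center: this proves
      -- the coherence with an additional factor `ρ`.
      let G (b a x : Tm) := J (fun z q => id (id B (m (n b)) b)
          (trans (m (n b)) (ap (n b) (apFst A (n b) q)) (ρ (fst z) b (snd z))) (r b))
        (unit (m (n b)) (r b)) (snd (k ⬝ b) ⬝ pair a x)
      let C (a t : Tm) := id (id B (m (n (m a))) (m a))
        (trans (m (n (m a))) (ap (n (m a)) (s a)) t) (r (m a))
      pair (lam B n) <| pair (lam A s) <| pair (lam B r) <| lam A fun a =>
        -- At the image of `a` the additional factor is a loop equal to `refl` by `N a`, and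
        -- composition with `refl` computes away.
        J (fun t _ => arr (C a t) (C a (refl (m a)))) (lam (C a (refl (m a))) fun x => x) (N a) ⬝
          G (m a) a (c a))
  (by decide +kernel)

end Trocq

/-! ### Consequences of univalence: univalent relations with one side fixed. -/

namespace Trocq

open Checker Tm

/-- Induction on equivalences. -/
def equivIndThm : Thm := Script.thm false
  (.decl (sort 0) fun A => .decl (pi (sort 0) fun B => arr (arr A B) (sort 1)) fun P =>
    .decl (P ⬝ A ⬝ lam A fun x => x) fun p => .decl (sort 0) fun B => .decl (equiv A B) fun e =>
    .goal (P ⬝ B ⬝ fst e) <| .done <|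
      -- Univalence provides a path whose associated equivalence equals `e`. The inner induction
      -- treats this path, and the outer one replaces its equivalence by `e`.
      J (fun e _ => P ⬝ B ⬝ fst e)
        (J (fun Y q => P ⬝ Y ⬝ fst (idToEquiv A q)) p (fst (ua A B) ⬝ e))
        (fst (snd (snd (ua A B))) ⬝ e))
  (by decide +kernel)

/-- A reflexive relation with contractible fibers is the identity relation. -/
def relPathThm : Thm := Script.thm false
  (.decl (sort 0) fun A => .decl (arr A (arr A (sort 0))) fun R =>
    .decl (pi A fun a => R ⬝ a ⬝ a) fun t =>
    .decl (pi A fun a => isContr (sig A fun b => R ⬝ a ⬝ b)) fun h =>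
    .goal (id (arr A (arr A (sort 0))) (idRel A) R) <|
      .use idEquivThm 0 (.bind A fun a => .args [A, R ⬝ a, a, t ⬝ a, h ⬝ a]) fun E =>
      -- Extensionality is raised by one level because the functions take values in a universe.
      .use funextThm 1 (funextInst A fun _ => arr A (sort 0)) fun ext₁ =>
      .use funextThm 1 (funextInst A fun _ => sort 0) fun ext₂ => .done <|
        ext₁ ⬝ idRel A ⬝ R ⬝ lam A fun a => ext₂ ⬝ (idRel A ⬝ a) ⬝ (R ⬝ a) ⬝ lam A fun b =>
          fst (ua (id A a b) (R ⬝ a ⬝ b)) ⬝ (E ⬝ a ⬝ b))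
  (by decide +kernel)

/-- A univalent relation is the identity relation, up to a path. -/
def paramPathThm : Thm := Script.thm false
  (.decl (sort 0) fun A => .decl (sort 0) fun B => .decl (arr A (arr B (sort 0))) fun R =>
    .decl (isUMap A B R) fun u => .decl (isUMap B A (flip A B R)) fun v =>
    let rels (Y : Tm) := arr A (arr Y (sort 0))
    let W := sig (sort 0) rels
    .goal (id W (pair A (idRel A)) (pair B R)) <|
      .use toContrThm 0 (.bind A fun a => .args [A, B, R, u, a]) fun h =>
      .use toContrThm 0 (.bind B fun b => .args [B, A, flip A B R, v, b]) fun k =>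
      .use equivThm 0 (.args [A, B, R, h, k]) fun e =>
      let refls (Y f R : Tm) := pi A fun a => R ⬝ a ⬝ (f ⬝ a)
      let contrs (Y R : Tm) := pi A fun a => isContr (sig Y fun y => R ⬝ a ⬝ y)
      let i := lam A fun x => x
      .use relPathThm 0 (.bind (rels A) fun R => .bind (refls A i R) fun t =>
        .bind (contrs A R) fun h => .args [A, R, t, h]) fun p =>
      -- The relation stays arbitrary in the motive, subject only to containing the graph of the map
      -- and having contractible fibers. For the identity map this is exactly a reflexive relation
      -- with contractible fibers.
      .use equivIndThm 0 (.args [A, lam (sort 0) fun Y => lam (arr A Y) fun f =>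
          pi (rels Y) fun R => pi (refls Y f R) fun _ => pi (contrs Y R) fun _ =>
            id W (pair A (idRel A)) (pair Y R),
        lam (rels A) fun R => lam (refls A i R) fun t => lam (contrs A R) fun h =>
          J (fun R _ => id W (pair A (idRel A)) (pair A R)) (refl (pair A (idRel A)))
            (p ⬝ R ⬝ t ⬝ h), B, pair (lam A fun a => map h a) e]) fun q =>
      .done (q ⬝ R ⬝ (lam A fun a => rel h a) ⬝ h))
  (by decide +kernel)

/-- The axiom of choice for functions of three arguments. -/
def choice₃Thm : Thm := Script.thm true
  (.decl (sort 0) fun A => .decl (arr A (arr A (sort 0))) fun E =>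
    .decl (pi A fun a => pi A fun b => arr (E ⬝ a ⬝ b) (arr (E ⬝ a ⬝ b) (sort 0))) fun T =>
    .decl (pi A fun a => pi A fun b => pi (E ⬝ a ⬝ b) fun p =>
      isContr (sig (E ⬝ a ⬝ b) fun q => T ⬝ a ⬝ b ⬝ p ⬝ q)) fun h =>
    let D₁ (a b : Tm) := pi (E ⬝ a ⬝ b) fun _ => E ⬝ a ⬝ b
    let D₂ (a : Tm) := pi A fun b => D₁ a b
    let T₁ (a b g : Tm) := pi (E ⬝ a ⬝ b) fun p => T ⬝ a ⬝ b ⬝ p ⬝ (g ⬝ p)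
    let T₂ (a g : Tm) := pi A fun b => T₁ a b (g ⬝ b)
    .goal (isContr (sig (pi A D₂) fun g => pi A fun a => T₂ a (g ⬝ a))) <|
      .use choiceThm 0 (.bind A fun a => .bind A fun b => .args [E ⬝ a ⬝ b,
        lam (E ⬝ a ⬝ b) fun _ => E ⬝ a ⬝ b, T ⬝ a ⬝ b, h ⬝ a ⬝ b]) fun h₁ =>
      .use choiceThm 0 (.bind A fun a => .args [A, lam A (D₁ a),
        lam A fun b => lam (D₁ a b) (T₁ a b), h₁ ⬝ a]) fun h₂ =>
      .use choiceThm 0 (.args [A, lam A D₂, lam A fun a => lam (D₂ a) (T₂ a), h₂]) .done)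
  (by decide +kernel)

/-- Being a univalent map is a proposition for the identity relation. -/
def isPropIdUMapThm : Thm := Script.thm true
  (.decl (sort 0) fun A =>
    let I (a b : Tm) := id A a b
    let M := isUMap A A (idRel A)
    .goal (isProp M) <|
      .use choiceThm 0 (.args [A, lam A fun _ => A, idRel A, lam A fun a => contrTo A a]) fun c₁ =>
      .use choice₃Thm 0 (.args [A, idRel A, lam A fun a => lam A fun b => idRel (I a b),
        lam A fun a => lam A fun b => lam (I a b) fun p => contrTo (I a b) p]) fun c₂ =>
      .use choice₃Thm 0 (.args [A, idRel A, lam A fun a => lam A fun b => lam (I a b) fun p =>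
          lam (I a b) fun q => id (I a b) q p,
        lam A fun a => lam A fun b => lam (I a b) fun p => contrFrom (I a b) p]) fun c₃ =>
      let pi₃ (F : Tm → Tm → Tm → Tm) := pi A fun a => pi A fun b => pi (I a b) fun p => F a b p
      let lam₃ (F : Tm → Tm → Tm → Tm) := lam A fun a => lam A fun b => lam (I a b) fun p => F a b p
      let i := lam A fun a => a
      let i₃ := lam₃ fun _ _ p => p
      let r₃ := lam₃ fun _ _ p => refl p
      let S₁ := sig (arr A A) fun m => pi A fun a => I a (m ⬝ a)
      let S₂ := sig (pi₃ fun a b _ => I a b) fun g => pi₃ fun a b p => id (I a b) p (g ⬝ a ⬝ b ⬝ p)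
      let S₃ := sig (pi₃ fun a b _ => I a b) fun g => pi₃ fun a b p => id (I a b) (g ⬝ a ⬝ b ⬝ p) p
      let u := pair i (pair i₃ (pair i₃ r₃))
      let G₁ (m : Tm) := pi A fun a => pi A fun b => arr (I (m ⬝ a) b) (I a b)
      let G₂ (m : Tm) := pi A fun a => pi A fun b => arr (I a b) (I (m ⬝ a) b)
      -- The path from `a` to `m a` used to contract `m` is obtained from `g₁` itself. `K` remembers
      -- this, so that once `m` is the identity and the path is `refl`, `g₁` is known to preserve
      -- `refl`.
      let K (m k g₁ : Tm) := pi A fun a =>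
        id (I a (m ⬝ a)) (k ⬝ a) (g₁ ⬝ a ⬝ (m ⬝ a) ⬝ refl (m ⬝ a))
      let H (g₁ g₂ : Tm) := pi₃ fun a b x => id (I a b) (g₁ ⬝ a ⬝ b ⬝ (g₂ ⬝ a ⬝ b ⬝ x)) x
      -- The components are made standard one at a time and proved in reverse: first `g₂` with its
      -- inverse law when `m` and `g₁` are identities, then `g₁` when only `m` is, and finally `m`.
      -- Each is contracted by the matching form of choice.
      .cut (pi (G₂ i) fun g₂ => pi (H i₃ g₂) fun h => id M u (pair i (pair i₃ (pair g₂ h))))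
        (lam (G₂ i) fun g₂ => lam (H i₃ g₂) fun h =>
          J (fun z _ => id M u (pair i (pair i₃ (pair (fst z) (snd z))))) (refl u)
            (path S₃ c₃ (pair i₃ r₃) (pair g₂ h))) fun p₃ =>
      .cut (pi (G₁ i) fun g₁ => pi (K i (lam A refl) g₁) fun k => pi (G₂ i) fun g₂ =>
          pi (H g₁ g₂) fun h => id M u (pair i (pair g₁ (pair g₂ h))))
        (lam (G₁ i) fun g₁ => lam (K i (lam A refl) g₁) fun k =>
          J (fun z _ => pi (G₂ i) fun g₂ => pi (H (fst z) g₂) fun h =>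
              id M u (pair i (pair (fst z) (pair g₂ h)))) p₃
            (path S₂ c₂ (pair i₃ r₃) (pair g₁ (lam₃ fun a _ p =>
              J (fun b p => id (I a b) p (g₁ ⬝ a ⬝ b ⬝ p)) (k ⬝ a) p)))) fun p₂ =>
      .cut (pi M fun w => id M u w)
        (lam M fun w => split (fun w => id M u w) (fun m w =>
          split (fun w => id M u (pair m w)) (fun g₁ w =>
            split (fun w => id M u (pair m (pair g₁ w))) (fun g₂ h =>
              let q := lam A fun a => g₁ ⬝ a ⬝ (m ⬝ a) ⬝ refl (m ⬝ a)
              J (fun z _ => pi (G₁ (fst z)) fun g₁ => pi (K (fst z) (snd z) g₁) fun k =>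
                  pi (G₂ (fst z)) fun g₂ => pi (H g₁ g₂) fun h =>
                    id M u (pair (fst z) (pair g₁ (pair g₂ h)))) p₂
                (path S₁ c₁ (pair i (lam A refl)) (pair m q)) ⬝
                g₁ ⬝ (lam A fun a => refl (q ⬝ a)) ⬝ g₂ ⬝ h) w) w) w) fun p₁ =>
      .done (lam M fun w => lam M fun w' => comp M w' (p₁ ⬝ w) (p₁ ⬝ w')))
  (by decide +kernel)

/-- Being a univalent map is a proposition for univalent relations. -/
def isPropUMapThm : Thm := Script.thm false
  (.decl (sort 0) fun A => .decl (sort 0) fun B => .decl (arr A (arr B (sort 0))) fun R =>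
    .decl (isUMap A B R) fun u => .decl (isUMap B A (flip A B R)) fun v =>
    .goal (isProp (isUMap A B R)) <|
      .use isPropIdUMapThm 0 (.args [A]) fun h =>
      .use paramPathThm 0 (.args [A, B, R, u, v]) fun p =>
      .done (J (fun z _ => isProp (isUMap A (fst z) (snd z))) h p))
  (by decide +kernel)

/-- The type of the univalent relations from `A` is contractible. -/
def paramContrThm : Thm := Script.thm false
  (.decl (sort 0) fun A =>
    let W := sig (sort 0) fun B => param 0 A B
    .goal (isContr W) <|
      .use ofContrThm 0 (.args [A, A, flip A A (idRel A), lam A fun a => contrFrom A a]) fun v₀ =>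
      let inst (J : Thm) (as : Tm → Tm → Tm → Tm → List Tm) := Proof.use J 0 <|
        .bind (sort 0) fun B => .bind (arr A (arr B (sort 0))) fun R =>
          .bind (isUMap A B R) fun u => .bind (isUMap B A (flip A B R)) fun v => .args (as B R u v)
      inst paramPathThm (fun B R u v => [A, B, R, u, v]) fun p =>
      inst isPropUMapThm (fun B R u v => [A, B, R, u, v]) fun pu =>
      inst isPropUMapThm (fun B R u v => [B, A, flip A B R, v, u]) fun pv =>
      let z (u v : Tm) := pair A (pair (idRel A) (pair u v))
      let z₀ := z (idUMap A) v₀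
      let U (B R : Tm) := isUMap A B R
      let V (B R : Tm) := isUMap B A (flip A B R)
      .done <| pair z₀ <| lam W fun w => split (fun w => id W z₀ w) (fun B r =>
        split (fun r => id W z₀ (pair B r)) (fun R w =>
          split (fun w => id W z₀ (pair B (pair R w))) (fun u v =>
            -- Path induction makes the relation the identity; the two uniqueness statements are
            -- carried in the motive so that they are available there to replace `u` and `v` by the
            -- standard proofs.
            J (fun w _ => pi (U (fst w) (snd w)) fun u => pi (V (fst w) (snd w)) fun v =>
                pi (isProp (U (fst w) (snd w))) fun _ => pi (isProp (V (fst w) (snd w))) fun _ =>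
                  id W z₀ (pair (fst w) (pair (snd w) (pair u v))))
              (lam (U A (idRel A)) fun u => lam (V A (idRel A)) fun v =>
                lam (isProp (U A (idRel A))) fun pu => lam (isProp (V A (idRel A))) fun pv =>
                  J (fun u _ => id W z₀ (z u v))
                    (J (fun v _ => id W z₀ (z (idUMap A) v)) (refl z₀) (pv ⬝ v₀ ⬝ v))
                    (pu ⬝ idUMap A ⬝ u))
              (p ⬝ B ⬝ R ⬝ u ⬝ v) ⬝ u ⬝ v ⬝ (pu ⬝ B ⬝ R ⬝ u ⬝ v) ⬝ (pv ⬝ B ⬝ R ⬝ u ⬝ v)) w) r) w)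
  (by decide +kernel)

/-- The type of the univalent relations to `B` is contractible. -/
def paramInvContrThm : Thm := Script.thm false
  (.decl (sort 0) fun B =>
    let W := sig (sort 0) fun A => param 0 A B
    .goal (isContr W) <|
      .use paramContrThm 0 (.args [B]) fun h =>
      let inv (A r : Tm) := pair (flip B A (fst r)) (pair (snd (snd r)) (fst (snd r)))
      let z₀ := pair (fst (fst h)) (inv (fst (fst h)) (snd (fst h)))
      .done <| pair z₀ <| lam W fun w => split (fun w => id W z₀ w) (fun A r =>
        split (fun r => id W z₀ (pair A r)) (fun R w =>
          split (fun w => id W z₀ (pair A (pair R w))) (fun u v =>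
            -- Swapping the arguments twice gives back `R` by β and η, so the inverse of the inverse
            -- of the given relation is the relation itself up to conversion.
            J (fun w _ => id W z₀ (pair (fst w) (inv (fst w) (snd w)))) (refl z₀)
              (snd h ⬝ pair A (pair (flip A B R) (pair v u)))) w) r) w)
  (by decide +kernel)

/-- The relation `Param` is a univalent map. -/
def sortUMapThm : Thm := Script.thm false
  (.goal (isUMap (sort 0) (sort 0) (lam (sort 0) fun A => lam (sort 0) fun B => param 0 A B)) <|
    .use paramContrThm 0 (.bind (sort 0) fun A => .args [A]) fun h =>
    -- The level is raised by one because the related types are themselves universes.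
    .use ofContrThm 1 (.args [sort 0, sort 0,
      lam (sort 0) fun A => lam (sort 0) fun B => param 0 A B, h]) .done)
  (by decide +kernel)

/-- The inverse of the relation `Param` is a univalent map. -/
def sortUMapInvThm : Thm := Script.thm false
  (.goal (isUMap (sort 0) (sort 0) (flip (sort 0) (sort 0)
      (lam (sort 0) fun A => lam (sort 0) fun B => param 0 A B))) <|
    .use paramInvContrThm 0 (.bind (sort 0) fun B => .args [B]) fun h =>
    .use ofContrThm 1 (.args [sort 0, sort 0, flip (sort 0) (sort 0)
      (lam (sort 0) fun A => lam (sort 0) fun B => param 0 A B), h]) .done)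
  (by decide +kernel)

end Trocq

namespace Trocq

open Term Checker

/-! ## Existence of the combinators -/

theorem Checker.check_sound {Γ : Ctx} {A t : Term} (hΓ : CtxValid Γ) (hA : isType Γ A = true)
    (h : check Γ t A = true) : Typing .univalent Γ t A :=
  (run_sound _).2 _ _ _ hΓ (isType_sound hΓ hA) h

theorem param_shift (i k : ℕ) (A B : Term) :
    (param i A B).shift k = param (i + k) (A.shift k) (B.shift k) := by
  simp [param, isUMap, Term.flip, prod, arrow, app₂, Term.shift, shift_lift]

/-- A relation that is a univalent map in both directions is univalent. -/
theorem Checker.param_mk {Γ : Ctx} {A B R T₁ T₂ u v : Term} {i : ℕ} (hΓ : CtxValid Γ)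
    (h₁ : IsType Γ T₁) (h₂ : IsType Γ T₂)
    (hT : isType (T₂.lift 1 :: T₁ :: Γ) ((param i A B).lift 2) = true)
    (hR : check (T₂.lift 1 :: T₁ :: Γ) (pair (R.lift 2) (pair (var 1) (var 0)))
      ((param i A B).lift 2) = true)
    (hu : Typing .univalent Γ u T₁) (hv : Typing .univalent Γ v T₂) :
    Typing .univalent Γ (pair R (pair u v)) (param i A B) := by
  obtain ⟨i₁, h₁⟩ := h₁
  obtain ⟨i₂, h₂⟩ := h₂
  -- The pair is checked with two variables in place of the proofs, which compares their types with
  -- the components of `param` by conversion; the actual proofs are substituted afterwards.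
  have := (check_sound ((hΓ.cons h₁).cons (h₂.lift T₁)) hT hR).inst₂ hu (by rwa [lift_inst])
  have e (t : Term) : (t.lift 2).inst₂ u v = t := by
    rw [inst₂, Term.lift, subst_rename]
    exact subst_var t
  rw [e] at this
  convert this using 1
  change _ = pair ((R.lift 2).inst₂ u v) (pair u v)
  rw [e]

/-- Pairing the prescribed relations with the proofs obtained by the scripts makes the equations for
`Rel` hold by computation of projections. The combinator for universes is shifted to each level. -/
theorem exists_isUnivalent : ∃ p : Combinators, p.IsUnivalent := by
  obtain ⟨u, hu, hut⟩ := piUMapThm.inh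
  obtain ⟨v, hv, hvt⟩ := piUMapInvThm.inh
  obtain ⟨u', -, hut'⟩ := sortUMapThm.inh
  obtain ⟨v', -, hvt'⟩ := sortUMapInvThm.inh
  have hp : Typing .univalent (piCtx 0) (pair (piRel (var 5) (var 4) (var 3) (var 2) (var 1) (var 0))
      (pair u v)) (param 0 (pi (var 5) (app (var 3) (var 0))) (pi (var 4) (app (var 2) (var 0)))) :=
    param_mk piUMapThm.wf.ctxValid piUMapThm.isType piUMapInvThm.isType
      (by decide +kernel) (by decide +kernel) hut hvt
  have hs : Typing .univalent [] (pair (lam (sort 0) (lam (sort 0) (param 0 (var 1) (var 0))))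
      (pair u' v')) (param 1 (sort 0) (sort 0)) :=
    param_mk .nil sortUMapThm.isType sortUMapInvThm.isType
      (by decide +kernel) (by decide +kernel) hut' hvt'
  refine ⟨⟨fun i => (pair (lam (sort 0) (lam (sort 0) (param 0 (var 1) (var 0))))
    (pair u' v')).shift i, pair (piRel (var 5) (var 4) (var 3) (var 2) (var 1) (var 0))
      (pair u v)⟩, fun i => ?_, fun i => ?_, fun i => ?_, .step .fst_pair⟩
  · convert hs.shift i using 1
    · rfl
    · simp only [param_shift, Term.shift, add_comm, add_zero]
  · refine .trans (.step .fst_pair) (.of_eq ?_)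
    simp only [Term.shift, param_shift, zero_add]
  · convert hp.shift i using 1
    · simp [piCtx, pi₃, rel, app₂, arrow, Term.shift, param_shift, shift_lift]
    · change _ = pair _ (pair (u.shift i) (v.shift i))
      -- The proofs contain no universe, so a single term for products serves at every level.
      rw [hu rfl, hv rfl]
      simp [piRel, pi₃, rel, Term.shift, app₂, app₃, shift_lift]
    · simp only [param_shift, zero_add, Term.shift]

end Trocq

namespace Trocq

open Term

/-! ## The abstraction theorem -/

/-! ### Combinators and substitution -/

theorem param_subst (i : ℕ) (A B : Term) (σ : ℕ → Term) :
    (param i A B).subst σ = param i (A.subst σ) (B.subst σ) := by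
  simp [param, isUMap, Term.flip, prod, arrow, app₂, Term.subst, Term.rename, Term.lift,
    subst_rename, rename_subst, rename_rename, upSub, upRen]

/-- It suffices to check the type once on two variables at the lowest level, and then to shift and
substitute. -/
theorem param_typing {Γ : Ctx} {A B : Term} {i : ℕ} (hA : Typing .univalent Γ A (.sort i))
    (hB : Typing .univalent Γ B (.sort i)) :
    Typing .univalent Γ (param i A B) (.sort (i + 1)) := by
  have h : Typing .univalent [sort 0, sort 0] (param 0 (var 1) (var 0)) (sort 1) :=
    Checker.check_sound ((Checker.CtxValid.nil.cons .sort).cons .sort)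
      (by decide +kernel) (by decide +kernel)
  have h' := (h.shift i).subst (Δ := Γ) (σ := scons B (scons A var)) <| by
    refine (SubTyped.scons (SubTyped.scons SubTyped.nil ?_) ?_)
    · simpa [Term.shift, Term.subst] using hA
    · simpa [Term.shift, Term.subst] using hB
  simpa only [param_shift, param_subst, Term.shift, Term.subst, scons, zero_add, add_comm 1 i]
    using h'

theorem rel_typing {Γ : Ctx} {A B r u v : Term} {i : ℕ}
    (hr : Typing .univalent Γ r (param i A B)) (hu : Typing .univalent Γ u A)
    (hv : Typing .univalent Γ v B) : Typing .univalent Γ (rel r u v) (.sort i) := by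
  have h := (Typing.fst hr).app hu
  rw [lift_inst] at h
  have := h.app hv
  rwa [lift_inst] at this

theorem Conv.param {A A' B B' : Term} (i : ℕ) (hA : Conv .univalent A A')
    (hB : Conv .univalent B B') : Conv .univalent (param i A B) (param i A' B') := by
  have h := param_subst i (var 1) (var 0) (scons B (scons A var))
  have h' := param_subst i (var 1) (var 0) (scons B' (scons A' var))
  simp only [Term.subst, scons] at h h'
  rw [← h, ← h']
  refine .subst_right _ fun n => ?_
  rcases n with _ | _ | n
  · exact hB
  · exact hA
  · exact .refl _

theorem Conv.rel {r r' u u' v v' : Term} (hr : Conv .univalent r r') (hu : Conv .univalent u u')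
    (hv : Conv .univalent v v') : Conv .univalent (rel r u v) (rel r' u' v') :=
  (hr.fst.app hu).app hv

theorem Conv.pi₃ {A A' r B B' r' t t' : Term} (hA : Conv .univalent A A')
    (hB : Conv .univalent B B') (hr : Conv .univalent r r') (h : Conv .univalent t t') :
    Conv .univalent (pi₃ A B r t) (pi₃ A' B' r' t') :=
  hA.pi ((hB.lift 1).pi (((hr.lift 2).rel (.refl _) (.refl _)).pi h))

/-- The composition of three extensions of the identity substitution. -/
def inst₃ (t u v w : Term) : Term := t.subst (scons w (scons v (scons u var)))

theorem app₃_lam₃ (T : Theory) (A A' AR t u v w : Term) :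
    Conv T (app₃ (lam₃ A A' AR t) u v w) (inst₃ t u v w) := by
  refine ((Conv.beta.app (.refl v)).app (.refl w)).trans ?_
  refine (Conv.app Conv.beta (.refl w)).trans (Conv.beta.trans (.of_eq ?_))
  simp only [inst, subst_subst, inst₃]
  congr 1; funext n
  rcases n with _ | _ | _ | n <;>
    simp [upSub, scons, Term.subst, Term.lift, Term.rename, subst_rename]

theorem inst₃_lift (t : Term) :
    inst₃ (t.rename (upRen (upRen (upRen fun n => n + 3)))) (var 2) (var 1) (var 0) = t := by
  rw [inst₃, subst_rename]
  conv_rhs => rw [← subst_var t]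
  congr 1; funext n
  rcases n with _ | _ | _ | n <;> rfl

theorem app₃_lam₃_lift (T : Theory) (A A' AR t : Term) :
    Conv T (app₃ ((lam₃ A A' AR t).lift 3) (var 2) (var 1) (var 0)) t := by
  have h := app₃_lam₃ T (A.lift 3) (A'.lift 3) (AR.lift 3)
    (t.rename (upRen (upRen (upRen fun n => n + 3)))) (var 2) (var 1) (var 0)
  rw [inst₃_lift] at h
  convert h using 2
  simp [lam₃, rel, app₂, Term.lift, Term.rename, rename_rename, upRen]

theorem app₃_typing {Γ : Ctx} {A A' r B t u v w : Term}
    (ht : Typing .univalent Γ t (pi₃ A A' r B)) (hu : Typing .univalent Γ u A)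
    (hv : Typing .univalent Γ v A') (hw : Typing .univalent Γ w (rel r u v)) :
    Typing .univalent Γ (app₃ t u v w) (inst₃ B u v w) := by
  have h₁ := ht.app hu
  have h₂ := Typing.app (A := (A'.lift 1).inst u) h₁ (by rwa [lift_inst])
  have e : ((rel (r.lift 2) (var 1) (var 0)).subst (upSub (scons u var))).inst v = rel r u v := by
    simp [rel, app₂, inst, Term.subst, Term.lift, Term.rename, subst_rename, subst_subst, upSub, scons]
  have h₃ := Typing.app (A := ((rel (r.lift 2) (var 1) (var 0)).subst (upSub (scons u var))).inst v)
    h₂ (by rwa [e])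
  have e₂ : inst₃ B u v w =
      ((B.subst (upSub (upSub (scons u var)))).subst (upSub (scons v var))).inst w := by
    simp only [inst, subst_subst, inst₃]
    congr 1; funext n
    rcases n with _ | _ | _ | n <;>
      simp [upSub, scons, Term.subst, Term.lift, Term.rename, subst_rename]
  rw [e₂]
  exact h₃

/-! ### The translation -/

/-- Lifting of a renaming into the scope of three more variables, one of which is the image of the
last variable. -/
def upRen₃ (k : ℕ) (ρ : ℕ → ℕ) : ℕ → ℕ
  | 0 => k
  | n + 1 => ρ n + 3

theorem upRen₃_upRen (k : ℕ) (ρ ξ : ℕ → ℕ) :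
    (fun n => upRen₃ k ρ (upRen ξ n)) = upRen₃ k fun n => ρ (ξ n) := by
  funext n; cases n <;> rfl

theorem upRen_upRen₃ {k : ℕ} (hk : k < 3) (ρ ξ : ℕ → ℕ) :
    (fun n => upRen (upRen (upRen ξ)) (upRen₃ k ρ n)) = upRen₃ k fun n => ξ (ρ n) := by
  funext n
  cases n with
  | zero => interval_cases k <;> rfl
  | succ n => rfl

namespace Combinators

variable {p : Combinators}

/-- The parametricity witness of a term of `CC_ω`, where `a n`, `b n` and `c n` are the variables
for the left member, the right member and the relation associated with the variable `n`. -/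
def tr (p : Combinators) : (ℕ → ℕ) → (ℕ → ℕ) → (ℕ → ℕ) → Term → Term
  | _, _, c, .var n => .var (c n)
  | _, _, _, .sort i => p.pSort i
  | a, b, c, .app t u => app₃ (tr p a b c t) (u.rename a) (u.rename b) (tr p a b c u)
  | a, b, c, .lam A t => lam₃ (A.rename a) (A.rename b) (tr p a b c A)
      (tr p (upRen₃ 2 a) (upRen₃ 1 b) (upRen₃ 0 c) t)
  | a, b, c, .pi A B => p.piWitness (A.rename a) (A.rename b) (tr p a b c A)
      (.lam (A.rename a) (B.rename (upRen a))) (.lam (A.rename b) (B.rename (upRen b)))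
      (lam₃ (A.rename a) (A.rename b) (tr p a b c A)
        (tr p (upRen₃ 2 a) (upRen₃ 1 b) (upRen₃ 0 c) B))
  -- A closed default for the constructors outside `CC_ω`, which no derivation in `Ty` concerns;
  -- being closed, it is stable under renaming and substitution.
  | _, _, _, _ => .sort 0

theorem IsUnivalent.fv_pPi (hp : p.IsUnivalent) : FV (fun n => n < 6) p.pPi := (hp.pi_typing 0).fv

theorem IsUnivalent.pSort_subst (hp : p.IsUnivalent) (i : ℕ) (σ : ℕ → Term) :
    (p.pSort i).subst σ = p.pSort i := by
  conv_rhs => rw [← subst_var (p.pSort i)]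
  exact subst_congr (fun n h => absurd h (Nat.not_lt_zero n)) (hp.sort_typing i).fv

theorem IsUnivalent.piWitness_subst (hp : p.IsUnivalent) (A A' AR B B' BR : Term) (σ : ℕ → Term) :
    (p.piWitness A A' AR B B' BR).subst σ = p.piWitness (A.subst σ) (A'.subst σ) (AR.subst σ)
      (B.subst σ) (B'.subst σ) (BR.subst σ) := by
  rw [piWitness, subst_subst]
  refine subst_congr (fun n hn => ?_) hp.fv_pPi
  interval_cases n <;> rfl

theorem IsUnivalent.piWitness_rename (hp : p.IsUnivalent) (A A' AR B B' BR : Term) (ρ : ℕ → ℕ) :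
    (p.piWitness A A' AR B B' BR).rename ρ = p.piWitness (A.rename ρ) (A'.rename ρ) (AR.rename ρ)
      (B.rename ρ) (B'.rename ρ) (BR.rename ρ) := by
  simp only [rename_eq_subst, hp.piWitness_subst]

theorem lam₃_subst (A A' AR t : Term) (σ : ℕ → Term) : (lam₃ A A' AR t).subst σ =
    lam₃ (A.subst σ) (A'.subst σ) (AR.subst σ) (t.subst (upSub (upSub (upSub σ)))) := by
  simp [lam₃, rel, app₂, Term.subst, Term.lift, Term.rename, subst_rename, rename_subst,
    rename_rename, upSub]

theorem lam₃_rename (A A' AR t : Term) (ρ : ℕ → ℕ) : (lam₃ A A' AR t).rename ρ =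
    lam₃ (A.rename ρ) (A'.rename ρ) (AR.rename ρ) (t.rename (upRen (upRen (upRen ρ)))) := by
  simp [lam₃, rel, app₂, Term.lift, Term.rename, rename_rename, upRen]

theorem tr_rename (t : Term) (a b c ρ : ℕ → ℕ) :
    p.tr a b c (t.rename ρ) =
      p.tr (fun n => a (ρ n)) (fun n => b (ρ n)) (fun n => c (ρ n)) t := by
  induction t generalizing a b c ρ <;>
    simp_all [tr, Term.rename, rename_rename, upRen₃_upRen, upRen_comp]

theorem IsUnivalent.rename_tr (hp : p.IsUnivalent) (t : Term) (a b c ρ : ℕ → ℕ) :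
    (p.tr a b c t).rename ρ =
      p.tr (fun n => ρ (a n)) (fun n => ρ (b n)) (fun n => ρ (c n)) t := by
  induction t generalizing a b c ρ with
  | sort i => simp only [tr, rename_eq_subst, hp.pSort_subst]
  | var n => rfl
  | app t u iht ihu => simp only [tr, app₃, Term.rename, rename_rename, iht, ihu]
  | lam A t ihA iht =>
    simp only [tr, lam₃_rename, rename_rename, ihA, iht, upRen_upRen₃ (by decide : 2 < 3),
      upRen_upRen₃ (by decide : 1 < 3), upRen_upRen₃ (by decide : 0 < 3)]
  | pi A t ihA iht =>
    simp only [tr, hp.piWitness_rename, Term.rename, lam₃_rename, rename_rename, ihA, iht,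
      upRen_upRen₃ (by decide : 2 < 3), upRen_upRen₃ (by decide : 1 < 3),
      upRen_upRen₃ (by decide : 0 < 3), upRen_comp]
  | _ => rfl

/-- The translation triples the variables, so a substitution `σ` has to act as a `τ` that sends the
three copies of a variable to the left copy, the right copy and the translation of its value. -/
theorem IsUnivalent.tr_subst (hp : p.IsUnivalent) (t : Term) {a b c a' b' c' : ℕ → ℕ}
    {σ τ : ℕ → Term} (ha : ∀ n, τ (a' n) = (σ n).rename a) (hb : ∀ n, τ (b' n) = (σ n).rename b)
    (hc : ∀ n, τ (c' n) = p.tr a b c (σ n)) :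
    p.tr a b c (t.subst σ) = (p.tr a' b' c' t).subst τ := by
  have ren : ∀ {a a' : ℕ → ℕ} {σ τ : ℕ → Term} (t : Term), (∀ n, τ (a' n) = (σ n).rename a) →
      (t.subst σ).rename a = (t.rename a').subst τ := fun t h => by
    rw [rename_subst, subst_rename]; congr 1; funext n; exact (h n).symm
  have up₁ : ∀ {a a' : ℕ → ℕ} {σ τ : ℕ → Term}, (∀ n, τ (a' n) = (σ n).rename a) →
      ∀ n, upSub τ (upRen a' n) = (upSub σ n).rename (upRen a) := fun h n => by
    cases n with
    | zero => rfl
    | succ n => simp only [upRen, upSub, h, Term.lift, rename_rename]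
  have up₃ : ∀ {k : ℕ} {a a' : ℕ → ℕ} {σ τ : ℕ → Term}, k < 3 → (∀ n, τ (a' n) = (σ n).rename a) →
      ∀ n, upSub (upSub (upSub τ)) (upRen₃ k a' n) = (upSub σ n).rename (upRen₃ k a) :=
    fun hk h n => by
      cases n with
      | zero => interval_cases ‹ℕ› <;> rfl
      | succ n => simp only [upRen₃, upSub, h, Term.lift, rename_rename]
  have upc : ∀ {a b c c' : ℕ → ℕ} {σ τ : ℕ → Term}, (∀ n, τ (c' n) = p.tr a b c (σ n)) →
      ∀ n, upSub (upSub (upSub τ)) (upRen₃ 0 c' n) =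
        p.tr (upRen₃ 2 a) (upRen₃ 1 b) (upRen₃ 0 c) (upSub σ n) := fun h n => by
    cases n with
    | zero => rfl
    | succ n =>
      simp only [upRen₃, upSub, h, Term.lift, tr_rename, hp.rename_tr]
  induction t generalizing a b c a' b' c' σ τ with
  | sort i => simp only [tr, Term.subst, hp.pSort_subst]
  | var n => exact (hc n).symm
  | app t u iht ihu =>
    simp only [tr, app₃, Term.subst, iht ha hb hc, ihu ha hb hc, ren u ha, ren u hb]
  | lam A t ihA iht =>
    simp only [tr, lam₃_subst, Term.subst, ihA ha hb hc, ren A ha, ren A hb,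
      iht (up₃ (by decide) ha) (up₃ (by decide) hb) (upc hc)]
  | pi A t ihA iht =>
    simp only [tr, hp.piWitness_subst, lam₃_subst, Term.subst, ihA ha hb hc, ren A ha, ren A hb,
      iht (up₃ (by decide) ha) (up₃ (by decide) hb) (upc hc), ren t (up₁ ha), ren t (up₁ hb)]
  | _ => rfl

theorem IsUnivalent.tr_inst (hp : p.IsUnivalent) (t u : Term) (a b c : ℕ → ℕ) :
    p.tr a b c (t.inst u) = inst₃ (p.tr (upRen₃ 2 a) (upRen₃ 1 b) (upRen₃ 0 c) t)
      (u.rename a) (u.rename b) (p.tr a b c u) := by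
  refine hp.tr_subst t ?_ ?_ ?_ <;> intro n <;> cases n <;> rfl

end Combinators

end Trocq

namespace Trocq

open Term

/-! ### Inclusion of `CC_ω` in the univalent theory, and congruence of the witnesses. -/

theorem Step.univalent {T : Theory} {t u : Term} (h : Step T t u) : Step .univalent t u := by
  induction h with
  | beta => exact .beta
  | eta => exact .eta
  | split_pair => exact .split_pair
  | fst_pair => exact .fst_pair
  | snd_pair => exact .snd_pair
  | idrec_refl => exact .idrec_refl
  | _ => constructor; assumption

theorem Conv.univalent {T : Theory} {t u : Term} (h : Conv T t u) : Conv .univalent t u := by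
  induction h with
  | rel _ _ h => exact .step h.univalent
  | refl => exact .refl _
  | symm _ _ _ ih => exact ih.symm
  | trans _ _ _ _ _ ih ih' => exact ih.trans ih'

theorem Cumul.univalent {T : Theory} {A B : Term} (h : Cumul T A B) : Cumul .univalent A B := by
  induction h with
  | conv h => exact .conv h.univalent
  | sort h => exact .sort h
  | pi h _ ih => exact .pi h.univalent ih
  | sig _ _ ih ih' => exact .sig ih ih'
  | trans _ _ ih ih' => exact .trans ih ih'

theorem Conv.lam₃ {A A' B B' r r' t t' : Term} (hA : Conv .univalent A A')
    (hB : Conv .univalent B B') (hr : Conv .univalent r r') (h : Conv .univalent t t') :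
    Conv .univalent (lam₃ A B r t) (lam₃ A' B' r' t') :=
  hA.lam ((hB.lift 1).lam (((hr.lift 2).rel (.refl _) (.refl _)).lam h))

theorem Conv.piWitness (p : Combinators) {A₁ A₂ A₃ A₄ A₅ A₆ B₁ B₂ B₃ B₄ B₅ B₆ : Term}
    (h₁ : Conv .univalent A₁ B₁) (h₂ : Conv .univalent A₂ B₂) (h₃ : Conv .univalent A₃ B₃)
    (h₄ : Conv .univalent A₄ B₄) (h₅ : Conv .univalent A₅ B₅) (h₆ : Conv .univalent A₆ B₆) :
    Conv .univalent (p.piWitness A₁ A₂ A₃ A₄ A₅ A₆) (p.piWitness B₁ B₂ B₃ B₄ B₅ B₆) :=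
  .subst_right _ fun n => by
    rcases n with _ | _ | _ | _ | _ | _ | n
    exacts [h₆, h₅, h₄, h₃, h₂, h₁, .refl _]

namespace Combinators

variable {p : Combinators}

/-! ### Conversion and cumulativity of translations -/

/-- A β-redex translates to a redex with three arguments, which contracts to the translation of the
contractum by `tr_inst`. The other steps act on the translation and on the renamed copies of a
subterm. -/
theorem IsUnivalent.tr_step (hp : p.IsUnivalent) {t u : Term} (h : Step .ccω t u)
    (a b c : ℕ → ℕ) : Conv .univalent (p.tr a b c t) (p.tr a b c u) := by
  generalize hT : Theory.ccω = T at h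
  have ren {t u : Term} (h : Step .ccω t u) (ρ : ℕ → ℕ) :
      Conv .univalent (t.rename ρ) (u.rename ρ) := (Conv.step h.univalent).rename ρ
  induction h generalizing a b c with
  | beta => rw [hp.tr_inst]; exact app₃_lam₃ _ _ _ _ _ _ _ _
  | app_left _ ih => exact (((ih a b c hT).app (.refl _)).app (.refl _)).app (.refl _)
  | app_right h ih =>
    subst hT
    exact (((Conv.refl _).app (ren h a)).app (ren h b)).app (ih a b c rfl)
  | lam_dom h ih => subst hT; exact .lam₃ (ren h a) (ren h b) (ih a b c rfl) (.refl _)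
  | lam_body _ ih => exact .lam₃ (.refl _) (.refl _) (.refl _) (ih _ _ _ hT)
  | pi_dom h ih =>
    subst hT
    exact .piWitness p (ren h a) (ren h b) (ih a b c rfl) ((ren h a).lam (.refl _))
      ((ren h b).lam (.refl _)) (.lam₃ (ren h a) (ren h b) (ih a b c rfl) (.refl _))
  | pi_cod h ih =>
    subst hT
    exact .piWitness p (.refl _) (.refl _) (.refl _) (.lam (.refl _) (ren h _))
      (.lam (.refl _) (ren h _)) (.lam₃ (.refl _) (.refl _) (.refl _) (ih _ _ _ rfl))
  | eta | fst_pair | snd_pair | split_pair | idrec_refl => cases hT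
  | _ => exact .refl _

theorem IsUnivalent.tr_conv (hp : p.IsUnivalent) {t u : Term} (h : Conv .ccω t u)
    (a b c : ℕ → ℕ) : Conv .univalent (p.tr a b c t) (p.tr a b c u) := by
  induction h with
  | rel _ _ h => exact hp.tr_step h a b c
  | refl => exact .refl _
  | symm _ _ _ ih => exact ih.symm
  | trans _ _ _ _ _ ih ih' => exact ih.trans ih'

theorem IsUnivalent.rel_pSort (hp : p.IsUnivalent) (i : ℕ) (A B : Term) :
    Conv .univalent (rel (p.pSort i) A B) (param i A B) := by
  refine (((hp.sort_rel i).app (.refl A)).app (.refl B)).trans ?_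
  refine (Conv.app Conv.beta (.refl B)).trans (Conv.beta.trans (.of_eq ?_))
  simp only [inst, Term.subst, param_subst, upSub, scons]
  rw [← inst, lift_inst]

theorem piRel_subst (A A' AR B B' BR : Term) (σ : ℕ → Term) :
    (piRel A A' AR B B' BR).subst σ = piRel (A.subst σ) (A'.subst σ) (AR.subst σ)
      (B.subst σ) (B'.subst σ) (BR.subst σ) := by
  simp [piRel, pi₃, rel, app₂, app₃, Term.subst, Term.lift, Term.rename, subst_rename, rename_subst,
    rename_rename, upSub]

theorem IsUnivalent.rel_piWitness (hp : p.IsUnivalent) (A A' AR B B' BR f f' : Term) :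
    Conv .univalent (rel (p.piWitness A A' AR B B' BR) f f')
      (pi₃ A A' AR (rel (app₃ (BR.lift 3) (var 2) (var 1) (var 0)) (app (f.lift 3) (var 2))
        (app (f'.lift 3) (var 1)))) := by
  have h := hp.pi_rel.subst (scons BR <| scons B' <| scons B <| scons AR <| scons A' <| scons A var)
  rw [piRel_subst] at h
  refine ((h.app (.refl f)).app (.refl f')).trans ?_
  refine (Conv.app Conv.beta (.refl f')).trans (Conv.beta.trans (.of_eq ?_))
  simp [inst, pi₃, rel, app₂, app₃, Term.subst, Term.lift, subst_subst, upSub, scons,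
    rename_eq_subst]

/-- The relation associated with a product. -/
theorem IsUnivalent.rel_tr_pi (hp : p.IsUnivalent) (A B f f' : Term) (a b c : ℕ → ℕ) :
    Conv .univalent (rel (p.tr a b c (pi A B)) f f')
      (pi₃ (A.rename a) (A.rename b) (p.tr a b c A)
        (rel (p.tr (upRen₃ 2 a) (upRen₃ 1 b) (upRen₃ 0 c) B) (app (f.lift 3) (var 2))
          (app (f'.lift 3) (var 1)))) :=
  (hp.rel_piWitness _ _ _ _ _ _ f f').trans <|
    .pi₃ (.refl _) (.refl _) (.refl _) (.rel (app₃_lam₃_lift _ _ _ _ _) (.refl _) (.refl _))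

/-- The level occurs only in the codomain of the relation, not in the conditions on it. Cumulativity
of dependent pair types in their first component is what is used. -/
theorem param_cumul {i j : ℕ} (h : i ≤ j) (A B : Term) :
    Cumul .univalent (param i A B) (param j A B) :=
  .sig (.pi (.refl _) (.pi (.refl _) (.sort h))) (.refl _)

/-- The relation associated with a type is monotone. -/
theorem IsUnivalent.rel_tr_cumul (hp : p.IsUnivalent) {A B : Term} (h : Cumul .ccω A B)
    (a b c : ℕ → ℕ) (t t' : Term) :
    Cumul .univalent (rel (p.tr a b c A) t t') (rel (p.tr a b c B) t t') := by
  generalize hT : Theory.ccω = T at h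
  induction h generalizing a b c t t' with
  | conv h => subst hT; exact .conv (.rel (hp.tr_conv h a b c) (.refl _) (.refl _))
  | sort h =>
    exact (Cumul.trans (.conv (hp.rel_pSort _ _ _)) (param_cumul h t t')).trans
      (.conv (hp.rel_pSort _ _ _).symm)
  | @pi T A A' B B' hA hB ih =>
    subst hT
    refine Cumul.trans (.conv (hp.rel_tr_pi A B t t' a b c)) (Cumul.trans ?_
      (.conv (hp.rel_tr_pi A' B' t t' a b c).symm))
    have hA' (ρ : ℕ → ℕ) := hA.univalent.rename ρ
    exact .pi (hA' a) (.pi ((hA' b).lift 1)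
      (.pi (.rel ((hp.tr_conv hA a b c).lift 2) (.refl _) (.refl _)) (ih _ _ _ _ _ rfl)))
  | sig => cases hT
  | trans _ _ ih ih' => exact (ih a b c t t' hT).trans (ih' a b c t t' hT)

end Combinators

end Trocq

namespace Trocq

open Term

/-! ### Typing of translations -/

/-- A renaming that respects the types of the variables in `S`. -/
def RenOn (S : ℕ → Prop) (Γ Δ : Ctx) (ρ : ℕ → ℕ) : Prop :=
  ∀ n A, S n → Ctx.HasVar Γ n A → Ctx.HasVar Δ (ρ n) (A.rename ρ)

theorem RenOn.up {S : ℕ → Prop} {Γ Δ : Ctx} {ρ : ℕ → ℕ} (h : RenOn S Γ Δ ρ) (A : Term) :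
    RenOn (upP S) (A :: Γ) (A.rename ρ :: Δ) (upRen ρ) := by
  have e (C : Term) : (C.lift 1).rename (upRen ρ) = (C.rename ρ).lift 1 := by
    simp only [Term.lift, rename_rename]; rfl
  intro n B hn hB
  rcases hB.cases with ⟨rfl, rfl⟩ | ⟨m, C, rfl, hC, rfl⟩
  · rw [e]; exact .zero
  · rw [e]; exact (h m C hn hC).succ

/-- Only the variables in `S` need an image of the right type, and the target may be either theory:
the same induction types the right member in `CC_ω` and both members in the univalent theory. -/
theorem Ty.typing_rename {T : Theory} {S : ℕ → Prop} {Γ Δ : Ctx} {t A : Term} {ρ : ℕ → ℕ}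
    (h : Ty S Γ t A) (hρ : RenOn S Γ Δ ρ) : Typing T Δ (t.rename ρ) (A.rename ρ) := by
  induction h generalizing Δ ρ with
  | sort => exact .sort
  | var hn hv => exact .var (hρ _ _ hn hv)
  | pi _ _ ih ih' => exact .pi (ih hρ) (ih' (hρ.up _))
  | lam _ _ _ ih _ ih' => exact .lam (ih hρ) (ih' (hρ.up _))
  | app _ _ _ _ _ _ ih ih' => rw [rename_inst]; exact .app (ih hρ) (ih' hρ)
  | conv _ h _ ih ih' =>
    refine .conv (ih hρ) ?_ (ih' hρ)
    cases T with
    | ccω => exact h.rename ρ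
    | univalent => exact h.univalent.rename ρ

/-- The extension of a context by two related variables and the proof that they are related. -/
def ctx₃ (Δ : Ctx) (A A' AR : Term) : Ctx :=
  rel (AR.lift 2) (var 1) (var 0) :: A'.lift 1 :: A :: Δ

section

variable {Δ : Ctx} {A A' AR t B : Term} {i : ℕ}

theorem Typing.lift₃ {T : Theory} (h : Typing T Δ t B) (X Y Z : Term) :
    Typing T (X :: Y :: Z :: Δ) (t.lift 3) (B.lift 3) := by
  have := ((h.lift Z).lift Y).lift X
  simpa only [lift_lift] using this

theorem rel_var_typing (hr : Typing .univalent Δ AR (param i A A')) :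
    Typing .univalent (A'.lift 1 :: A :: Δ) (rel (AR.lift 2) (var 1) (var 0)) (.sort i) := by
  have h := (hr.lift A).lift (A'.lift 1)
  simp only [lift_lift] at h
  rw [lift_eq_subst 2 (param _ _ _), param_subst, ← lift_eq_subst, ← lift_eq_subst] at h
  exact rel_typing h (.var ⟨A, rfl, rfl⟩) (.var ⟨A'.lift 1, rfl, by rw [lift_lift]⟩)

theorem lam₃_typing (hA : Typing .univalent Δ A (.sort i)) (hA' : Typing .univalent Δ A' (.sort i))
    (hr : Typing .univalent Δ AR (param i A A'))
    (ht : Typing .univalent (ctx₃ Δ A A' AR) t B) :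
    Typing .univalent Δ (lam₃ A A' AR t) (pi₃ A A' AR B) :=
  .lam hA (.lam (hA'.lift A) (.lam (rel_var_typing hr) ht))

theorem pi₃_typing (hA : Typing .univalent Δ A (.sort i)) (hA' : Typing .univalent Δ A' (.sort i))
    (hr : Typing .univalent Δ AR (param i A A'))
    (hB : Typing .univalent (ctx₃ Δ A A' AR) B (.sort i)) :
    Typing .univalent Δ (pi₃ A A' AR B) (.sort i) :=
  .pi hA (.pi (hA'.lift A) (.pi (rel_var_typing hr) hB))

end

theorem lift_rename_upRen₃ (t : Term) (k : ℕ) (ρ : ℕ → ℕ) :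
    (t.lift 1).rename (upRen₃ k ρ) = (t.rename ρ).lift 3 := by
  simp only [Term.lift, rename_rename]; rfl

theorem rename_upRen_lift_inst (t : Term) (k : ℕ) (ρ : ℕ → ℕ) :
    ((t.rename (upRen ρ)).rename (upRen fun n => n + 3)).inst (var k) = t.rename (upRen₃ k ρ) := by
  rw [rename_rename, inst, subst_rename, rename_eq_subst]
  congr 1; funext n; cases n <;> rfl

/-- The application of a function to a variable from an extension of the context. -/
theorem Typing.app_var {Δ : Ctx} {A B t X Y Z : Term} {k : ℕ} {a : ℕ → ℕ} {T : Theory}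
    (h : Typing T Δ t ((Term.pi A B).rename a))
    (hk : Ctx.HasVar (X :: Y :: Z :: Δ) k ((A.rename a).lift 3)) :
    Typing T (X :: Y :: Z :: Δ) (.app (t.lift 3) (.var k)) (B.rename (upRen₃ k a)) := by
  have := (h.lift₃ X Y Z).app (.var hk)
  rwa [rename_upRen_lift_inst] at this

theorem Ctx.HasVar.succ₃ {Γ : Ctx} {n : ℕ} {A X Y Z : Term} (h : Ctx.HasVar Γ n A) :
    Ctx.HasVar (X :: Y :: Z :: Γ) (n + 3) (A.lift 3) := by
  obtain ⟨C, hC, rfl⟩ := h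
  exact ⟨C, hC, by rw [lift_lift]⟩

theorem hasVar_ctx₃_two (Δ : Ctx) (A A' AR : Term) : Ctx.HasVar (ctx₃ Δ A A' AR) 2 (A.lift 3) :=
  ⟨A, rfl, rfl⟩

theorem hasVar_ctx₃_one (Δ : Ctx) (A A' AR : Term) : Ctx.HasVar (ctx₃ Δ A A' AR) 1 (A'.lift 3) :=
  ⟨A'.lift 1, rfl, by rw [lift_lift]⟩

theorem hasVar_ctx₃_zero (Δ : Ctx) (A A' AR : Term) :
    Ctx.HasVar (ctx₃ Δ A A' AR) 0 (rel (AR.lift 3) (var 2) (var 1)) :=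
  ⟨_, rfl, by simp [rel, app₂, Term.lift, Term.rename, rename_rename]⟩

theorem inst₃_rel (r t t' u v w : Term) :
    inst₃ (rel r (app (t.lift 3) (var 2)) (app (t'.lift 3) (var 1))) u v w =
      rel (inst₃ r u v w) (app t u) (app t' v) := by
  have l (t : Term) : inst₃ (t.lift 3) u v w = t := by
    rw [inst₃, Term.lift, subst_rename]; exact subst_var t
  change rel (inst₃ r u v w) (app (inst₃ (t.lift 3) u v w) u) (app (inst₃ (t'.lift 3) u v w) v) = _
  rw [l, l]

/-- The variables in `S` of a context `Γ` are interpreted in `Δ` by two related variables. -/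
structure Related (p : Combinators) (S : ℕ → Prop) (Γ Δ : Ctx) (a b c : ℕ → ℕ) : Prop where
  left : RenOn S Γ Δ a
  right : RenOn S Γ Δ b
  rel : ∀ n A, S n → Ctx.HasVar Γ n A →
    Typing .univalent Δ (.var (c n)) (rel (p.tr a b c A) (.var (a n)) (.var (b n)))

namespace Combinators

variable {p : Combinators} {S : ℕ → Prop} {Γ Δ : Ctx} {a b c : ℕ → ℕ}

theorem IsUnivalent.tr_lift (hp : p.IsUnivalent) (t : Term) (a b c : ℕ → ℕ) :
    p.tr (upRen₃ 2 a) (upRen₃ 1 b) (upRen₃ 0 c) (t.lift 1) = (p.tr a b c t).lift 3 := by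
  rw [Term.lift, Term.lift, tr_rename, hp.rename_tr]; rfl

theorem _root_.Trocq.Related.up (hp : p.IsUnivalent) (h : Related p S Γ Δ a b c) (A : Term) :
    Related p (upP S) (A :: Γ) (ctx₃ Δ (A.rename a) (A.rename b) (p.tr a b c A))
      (upRen₃ 2 a) (upRen₃ 1 b) (upRen₃ 0 c) := by
  refine ⟨fun n B hn hB => ?_, fun n B hn hB => ?_, fun n B hn hB => ?_⟩ <;>
    rcases hB.cases with ⟨rfl, rfl⟩ | ⟨m, C, rfl, hC, rfl⟩
  · rw [lift_rename_upRen₃]; exact hasVar_ctx₃_two _ _ _ _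
  · rw [lift_rename_upRen₃]
    exact (h.left m C hn hC).succ₃
  · rw [lift_rename_upRen₃]; exact hasVar_ctx₃_one _ _ _ _
  · rw [lift_rename_upRen₃]
    exact (h.right m C hn hC).succ₃
  · rw [hp.tr_lift]
    exact .var (hasVar_ctx₃_zero _ _ _ _)
  · rw [hp.tr_lift]
    exact (h.rel m C hn hC).lift₃ _ _ _

/-- The translation of a type is a univalent relation. -/
theorem IsUnivalent.param_of_rel (hp : p.IsUnivalent) {A A' AR : Term} {i : ℕ}
    (h : Typing .univalent Δ AR (rel (p.pSort i) A A')) (hA : Typing .univalent Δ A (.sort i))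
    (hA' : Typing .univalent Δ A' (.sort i)) : Typing .univalent Δ AR (param i A A') :=
  .conv h (.conv (hp.rel_pSort i A A')) (param_typing hA hA')

theorem IsUnivalent.pSort_typing (hp : p.IsUnivalent) (i : ℕ) :
    Typing .univalent Δ (p.pSort i) (param (i + 1) (sort i) (sort i)) := by
  have := (hp.sort_typing i).subst (σ := var) (SubTyped.nil (Γ := Δ))
  rwa [subst_var, subst_var] at this

theorem IsUnivalent.rel_of_param (hp : p.IsUnivalent) {A A' AR : Term} {i : ℕ}
    (h : Typing .univalent Δ AR (param i A A')) (hA : Typing .univalent Δ A (.sort i))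
    (hA' : Typing .univalent Δ A' (.sort i)) : Typing .univalent Δ AR (rel (p.pSort i) A A') :=
  .conv h (.conv (hp.rel_pSort i A A').symm) (rel_typing (hp.pSort_typing i) hA hA')

theorem IsUnivalent.piWitness_typing (hp : p.IsUnivalent) {A A' AR B B' BR : Term} {i : ℕ}
    (hA : Typing .univalent Δ A (.sort i)) (hA' : Typing .univalent Δ A' (.sort i))
    (hAR : Typing .univalent Δ AR (param i A A')) (hB : Typing .univalent Δ B (pi A (.sort i)))
    (hB' : Typing .univalent Δ B' (pi A' (.sort i)))
    (hBR : Typing .univalent Δ BR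
      (pi₃ A A' AR (param i (app (B.lift 3) (var 2)) (app (B'.lift 3) (var 1))))) :
    Typing .univalent Δ (p.piWitness A A' AR B B' BR)
      (param i (pi A (app (B.lift 1) (var 0))) (pi A' (app (B'.lift 1) (var 0)))) := by
  have h := (hp.pi_typing i).subst (Δ := Δ)
    (σ := scons BR <| scons B' <| scons B <| scons AR <| scons A' <| scons A var) <| by
    refine .scons (.scons (.scons (.scons (.scons (.scons .nil hA) hA') ?_) hB) hB') ?_
    · rw [param_subst]; exact hAR
    · convert hBR using 1
      simp [pi₃, Trocq.Term.rel, app₂, Term.subst, Term.lift, param_subst, upSub, scons,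
        rename_rename, Term.rename]
  rw [param_subst] at h
  exact h

/-- The translation of a product is a univalent relation. -/
theorem IsUnivalent.tr_pi_typing (hp : p.IsUnivalent) {A B : Term} {i : ℕ}
    (hA : Typing .univalent Δ (A.rename a) (.sort i))
    (hA' : Typing .univalent Δ (A.rename b) (.sort i))
    (hB : Typing .univalent (A.rename a :: Δ) (B.rename (upRen a)) (.sort i))
    (hB' : Typing .univalent (A.rename b :: Δ) (B.rename (upRen b)) (.sort i))
    (hAR : Typing .univalent Δ (p.tr a b c A) (param i (A.rename a) (A.rename b)))
    (hBR : Typing .univalent (ctx₃ Δ (A.rename a) (A.rename b) (p.tr a b c A))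
      (p.tr (upRen₃ 2 a) (upRen₃ 1 b) (upRen₃ 0 c) B)
      (param i (B.rename (upRen₃ 2 a)) (B.rename (upRen₃ 1 b)))) :
    Typing .univalent Δ (p.tr a b c (pi A B))
      (param i ((pi A B).rename a) ((pi A B).rename b)) := by
  have hl : Typing .univalent Δ (lam (A.rename a) (B.rename (upRen a)))
      ((pi A (sort i)).rename a) := .lam hA hB
  have hl' : Typing .univalent Δ (lam (A.rename b) (B.rename (upRen b)))
      ((pi A (sort i)).rename b) := .lam hA' hB'
  -- The combinator takes families as functions, so codomains appear as β-redexes and have to be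
  -- contracted to match the translated product.
  have e (k : ℕ) (ρ : ℕ → ℕ) : Conv .univalent (B.rename (upRen₃ k ρ))
      (app ((lam (A.rename ρ) (B.rename (upRen ρ))).lift 3) (var k)) := by
    rw [← rename_upRen_lift_inst]; exact Conv.beta.symm
  have e' (ρ : ℕ → ℕ) : Conv .univalent (pi (A.rename ρ)
      (app ((lam (A.rename ρ) (B.rename (upRen ρ))).lift 1) (var 0))) ((pi A B).rename ρ) := by
    refine .pi (.refl _) (Conv.beta.trans (.of_eq ?_))
    rw [rename_rename, inst, subst_rename, rename_eq_subst]
    congr 1; funext n; cases n <;> rfl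
  refine .conv (hp.piWitness_typing hA hA' hAR hl hl' (lam₃_typing hA hA' hAR ?_))
    (.conv (.param i (e' a) (e' b))) (param_typing (.pi hA hB) (.pi hA' hB'))
  exact .conv hBR (.conv (.param i (e 2 a) (e 1 b)))
    (param_typing (hl.app_var (hasVar_ctx₃_two _ _ _ _)) (hl'.app_var (hasVar_ctx₃_one _ _ _ _)))

/-- The abstraction theorem for the translation. -/
theorem IsUnivalent.tr_typing (hp : p.IsUnivalent) {M A : Term} (h : Ty S Γ M A)
    (hr : Related p S Γ Δ a b c) :
    Typing .univalent Δ (p.tr a b c M) (Term.rel (p.tr a b c A) (M.rename a) (M.rename b)) := by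
  induction h generalizing Δ a b c with
  | sort =>
    exact hp.rel_of_param (hp.pSort_typing _) .sort .sort
  | var hn hv => exact hr.rel _ _ hn hv
  | @pi S Γ A B i hA hB ihA ihB =>
    have tA := hA.typing_rename (T := .univalent) hr.left
    have tA' := hA.typing_rename (T := .univalent) hr.right
    have tB := hB.typing_rename (T := .univalent) (hr.left.up _)
    have tB' := hB.typing_rename (T := .univalent) (hr.right.up _)
    have hr₃ := hr.up hp A
    exact hp.rel_of_param (hp.tr_pi_typing tA tA' tB tB' (hp.param_of_rel (ihA hr) tA tA')
      (hp.param_of_rel (ihB hr₃) (hB.typing_rename hr₃.left) (hB.typing_rename hr₃.right)))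
      (.pi tA tB) (.pi tA' tB')
  -- The derivation of the codomain, which `Typing` does not require of abstractions, provides the
  -- hypothesis that makes the relation on the product well-formed.
  | @lam S Γ A B t i hA hB ht ihA ihB iht =>
    have tA := hA.typing_rename (T := .univalent) hr.left
    have tA' := hA.typing_rename (T := .univalent) hr.right
    have tB := hB.typing_rename (T := .univalent) (hr.left.up _)
    have tB' := hB.typing_rename (T := .univalent) (hr.right.up _)
    have tt := (Ty.lam hA hB ht).typing_rename (T := .univalent) hr.left
    have tt' := (Ty.lam hA hB ht).typing_rename (T := .univalent) hr.right
    have hr₃ := hr.up hp A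
    have hAR := hp.param_of_rel (ihA hr) tA tA'
    have hBR := hp.param_of_rel (ihB hr₃) (hB.typing_rename hr₃.left) (hB.typing_rename hr₃.right)
    have e (k : ℕ) (ρ : ℕ → ℕ) : Conv .univalent (t.rename (upRen₃ k ρ))
        (app (((lam A t).rename ρ).lift 3) (var k)) := by
      rw [← rename_upRen_lift_inst]; exact Conv.beta.symm
    refine .conv (lam₃_typing tA tA' hAR (iht hr₃)) (.conv ?_)
      (rel_typing (hp.tr_pi_typing tA tA' tB tB' hAR hBR) tt tt')
    exact (Conv.pi₃ (.refl _) (.refl _) (.refl _) (.rel (.refl _) (e 2 a) (e 1 b))).trans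
      (hp.rel_tr_pi _ _ _ _ _ _ _).symm
  | @app S Γ A B t u i hA hB ht hu ihA ihB iht ihu =>
    have tA := hA.typing_rename (T := .univalent) hr.left
    have tA' := hA.typing_rename (T := .univalent) hr.right
    have tt := ht.typing_rename (T := .univalent) hr.left
    have tt' := ht.typing_rename (T := .univalent) hr.right
    have hr₃ := hr.up hp A
    have hAR := hp.param_of_rel (ihA hr) tA tA'
    have hBR := hp.param_of_rel (ihB hr₃) (hB.typing_rename hr₃.left) (hB.typing_rename hr₃.right)
    have h := Typing.conv (iht hr) (.conv (hp.rel_tr_pi A B _ _ _ _ _))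
      (pi₃_typing tA tA' hAR (rel_typing hBR (tt.app_var (hasVar_ctx₃_two _ _ _ _))
        (tt'.app_var (hasVar_ctx₃_one _ _ _ _))))
    have h' := app₃_typing h (hu.typing_rename hr.left) (hu.typing_rename hr.right) (ihu hr)
    rw [inst₃_rel] at h'
    rw [hp.tr_inst]
    exact h'
  -- Changing the type by cumulativity changes the relation by cumulativity; well-formedness of the
  -- new relation comes from the translation of the new type.
  | conv hM hc hB ih ihB =>
    exact .conv (ih hr) (hp.rel_tr_cumul hc _ _ _ _ _)
      (rel_typing (hp.param_of_rel (ihB hr) (hB.typing_rename hr.left) (hB.typing_rename hr.right))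
        ((hM.conv hc hB).typing_rename hr.left) ((hM.conv hc hB).typing_rename hr.right))

end Combinators

end Trocq

namespace Trocq

open Term

/-! ### Sequents -/

theorem rename_injective {ρ ξ : ℕ → ℕ} (h : ∀ n, ξ (ρ n) = n) {t u : Term}
    (e : t.rename ρ = u.rename ρ) : t = u := by
  have := congrArg (Term.rename ξ) e
  simpa only [rename_rename, h, rename_id] using this

/-- Sequents are functional: the members on the right are determined by the member on the left. -/
theorem UParam.eq_tr {p : Combinators} {Ξ : PCtx} {N N' NR : Term} (h : UParam p Ξ N N' NR)
    {a b c : ℕ → ℕ} {M : Term}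
    (hΞ : ∀ x x' xR, (x, x', xR) ∈ Ξ → ∀ n, a n = x → b n = x' ∧ c n = xR)
    (hM : N = M.rename a) :
    N' = M.rename b ∧ NR = p.tr a b c M ∧ FV (fun n => ∃ x' xR, (a n, x', xR) ∈ Ξ) M := by
  have up : ∀ {Ξ : PCtx} {a b c : ℕ → ℕ},
      (∀ x x' xR, (x, x', xR) ∈ Ξ → ∀ n, a n = x → b n = x' ∧ c n = xR) →
      ∀ x x' xR, (x, x', xR) ∈ PCtx.ext Ξ → ∀ n, upRen₃ 2 a n = x →
        upRen₃ 1 b n = x' ∧ upRen₃ 0 c n = xR := by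
    intro Ξ a b c h x x' xR hm n hn
    simp only [PCtx.ext, List.mem_cons, List.mem_map, Prod.mk.injEq, Prod.exists] at hm
    rcases hm with ⟨rfl, rfl, rfl⟩ | ⟨y, y', yR, hm, rfl, rfl, rfl⟩
    · cases n with
      | zero => exact ⟨rfl, rfl⟩
      | succ n => simp [upRen₃] at hn
    · cases n with
      | zero => simp [upRen₃] at hn
      | succ n =>
        obtain ⟨h₁, h₂⟩ := h y y' yR hm n (Nat.add_right_cancel hn)
        exact ⟨congrArg (· + 3) h₁, congrArg (· + 3) h₂⟩
  have upF : ∀ {Ξ : PCtx} {a : ℕ → ℕ} {t : Term},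
      FV (fun n => ∃ x' xR, (upRen₃ 2 a n, x', xR) ∈ PCtx.ext Ξ) t →
        FV (upP fun n => ∃ x' xR, (a n, x', xR) ∈ Ξ) t := by
    intro Ξ a t h
    refine h.mono fun n hn => ?_
    cases n with
    | zero => trivial
    | succ n =>
      obtain ⟨x', xR, hm⟩ := hn
      simp only [PCtx.ext, List.mem_cons, List.mem_map, Prod.mk.injEq, Prod.exists] at hm
      rcases hm with ⟨h, _⟩ | ⟨y, y', yR, hm, h, _, _⟩
      · simp [upRen₃] at h
      · cases Nat.add_right_cancel h
        exact ⟨y', yR, hm⟩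
  have hX (t : Term) (a : ℕ → ℕ) : (t.rename (upRen a)).rename inX = t.rename (upRen₃ 2 a) := by
    rw [rename_rename]; congr 1; funext n; cases n <;> rfl
  have hX' {t u : Term} {b : ℕ → ℕ} (h : u.rename inX' = t.rename (upRen₃ 1 b)) :
      u = t.rename (upRen b) := by
    -- Truncated subtraction of 2 sends `1` to `0` and `n + 3` to `n + 1`, so it is a left inverse
    -- of `inX'`.
    refine rename_injective (ρ := inX') (ξ := fun n => n - 2) ?_ ?_
    · rintro (_ | n) <;> rfl
    · rw [h, rename_rename]; congr 1; funext n; cases n <;> rfl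
  -- The left member is kept as a renamed term: under a binder the sequent has three new variables
  -- where `M` has one, and the renaming `a` absorbs the difference.
  induction h generalizing a b c M with
  | sort => cases M <;> cases hM; exact ⟨rfl, rfl, trivial⟩
  | var hm _ =>
    cases M <;> cases hM
    obtain ⟨rfl, rfl⟩ := hΞ _ _ _ hm _ rfl
    exact ⟨rfl, rfl, _, _, hm⟩
  | app _ _ ih ih' =>
    cases M <;> cases hM
    obtain ⟨rfl, rfl, h⟩ := ih hΞ rfl
    obtain ⟨rfl, rfl, h'⟩ := ih' hΞ rfl
    exact ⟨rfl, rfl, h, h'⟩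
  | lam _ _ ih ih' =>
    cases M <;> cases hM
    obtain ⟨rfl, rfl, h⟩ := ih hΞ rfl
    obtain ⟨h₁, rfl, h'⟩ := ih' (up hΞ) (hX _ _)
    cases hX' h₁
    exact ⟨rfl, rfl, h, upF h'⟩
  | pi _ _ ih ih' =>
    cases M <;> cases hM
    obtain ⟨rfl, rfl, h⟩ := ih hΞ rfl
    obtain ⟨h₁, rfl, h'⟩ := ih' (up hΞ) (hX _ _)
    cases hX' h₁
    exact ⟨rfl, rfl, h, upF h'⟩

/-- A well-formed parametricity context is the graph of two functions. -/
theorem PCtx.Wf.exists_fun {Ξ : PCtx} (h : PCtx.Wf Ξ) :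
    ∃ b c : ℕ → ℕ, ∀ x x' xR, (x, x', xR) ∈ Ξ → ∀ n, n = x → b n = x' ∧ c n = xR := by
  induction Ξ with
  | nil => exact ⟨fun n => n, fun n => n, fun _ _ _ h => by cases h⟩
  | cons t Ξ ih =>
    obtain ⟨y, y', yR⟩ := t
    rw [PCtx.Wf, PCtx.vars, List.flatMap_cons, List.nodup_append] at h
    obtain ⟨b, c, hbc⟩ := ih h.2.1
    refine ⟨fun n => if n = y then y' else b n, fun n => if n = y then yR else c n, ?_⟩
    rintro x x' xR hm n rfl
    rw [List.mem_cons] at hm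
    rcases hm with hm | hm
    · cases hm; simp
    · have : n ≠ y := fun e => h.2.2 y (by simp) n
        (List.mem_flatMap.2 ⟨_, hm, by simp⟩) e.symm
      simpa [this] using hbc n x' xR hm n rfl

/-! ### Admissible contexts -/

/-- The type of the variable `k` only mentions variables of larger index. The recursion therefore
decreases `Γ.length - k`: once the variables above `k` are interpreted, `tr_typing` applies to the
type of `k` and shows that its relation is well-formed. Beyond the length of Γ nothing is declared.
-/
theorem Admissible.related {p : Combinators} (hp : p.IsUnivalent) {Γ : Ctx} {Ξ : PCtx}
    (h : Admissible p Γ Ξ) {b c : ℕ → ℕ}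
    (hΞ : ∀ x x' xR, (x, x', xR) ∈ Ξ → ∀ n, n = x → b n = x' ∧ c n = xR) (k : ℕ) :
    Ty.Valid (fun n => k ≤ n ∧ ∃ x' xR, (n, x', xR) ∈ Ξ) Γ ∧
      Related p (fun n => k ≤ n ∧ ∃ x' xR, (n, x', xR) ∈ Ξ) Γ Γ (fun n => n) b c := by
  have hR : ∀ (k : ℕ), (∀ n A, k ≤ n → (∃ x' xR, (n, x', xR) ∈ Ξ) → Ctx.HasVar Γ n A →
      (∃ i, Ty (fun n => k ≤ n ∧ ∃ x' xR, (n, x', xR) ∈ Ξ) Γ A (sort i)) ∧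
      Typing .univalent Γ (var (c n)) (rel (p.tr (fun n => n) b c A) (var n) (var (b n)))) →
    Ty.Valid (fun n => k ≤ n ∧ ∃ x' xR, (n, x', xR) ∈ Ξ) Γ ∧
      Related p (fun n => k ≤ n ∧ ∃ x' xR, (n, x', xR) ∈ Ξ) Γ Γ (fun n => n) b c := by
    intro k hk
    refine ⟨fun n A hn hA => (hk n A hn.1 hn.2 hA).1, fun n A hn hA => by rwa [rename_id], ?_,
      fun n A hn hA => (hk n A hn.1 hn.2 hA).2⟩
    rintro n A ⟨-, x', xR, hm⟩ hA
    obtain ⟨B, B', BR, hB, hB', -, -, ⟨A', AR, hu⟩, hall⟩ := h.coherent _ _ _ hm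
    cases hA.unique hB
    cases (hΞ _ _ _ hm n rfl).1
    obtain ⟨rfl, -⟩ := hall _ _ hu
    obtain ⟨e, -⟩ := hu.eq_tr hΞ (rename_id A).symm
    exact e ▸ hB'
  by_cases hk : Γ.length ≤ k
  · refine hR k fun n A hn _ hA => ?_
    obtain ⟨B, hB, -⟩ := hA
    have := (List.getElem?_eq_some_iff.mp hB).1
    omega
  · obtain ⟨hv, hr⟩ := h.related hp hΞ (k + 1)
    refine hR k fun n A hn hm hA => ?_
    rcases Nat.lt_or_eq_of_le hn with hn | rfl
    · obtain ⟨i, hi⟩ := hv n A ⟨hn, hm⟩ hA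
      exact ⟨⟨i, hi.mono fun n hn => ⟨(Nat.le_succ k).trans hn.1, hn.2⟩⟩, hr.rel n A ⟨hn, hm⟩ hA⟩
    · obtain ⟨x', xR, hm⟩ := hm
      obtain ⟨B, B', BR, hB, hB', hBR, ⟨i, hi⟩, ⟨A', AR, hu⟩, hall⟩ := h.coherent _ _ _ hm
      cases hA.unique hB
      obtain ⟨rfl, hc⟩ := hall _ _ hu
      obtain ⟨hb₁, hc₁⟩ := hΞ _ _ _ hm k rfl
      obtain ⟨rfl, rfl, hf⟩ := hu.eq_tr hΞ (rename_id A).symm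
      have hf' : FV (fun n => k + 1 ≤ n) A := by
        obtain ⟨C, -, rfl⟩ := hA
        exact FV.lift _
      -- Admissibility only gives a derivation in the whole of Γ; it is confined here to the
      -- translated variables above `k`, to which the recursive call applies.
      have hT := Ty.of_typing_of_fv hi hv (hf'.and hf) trivial
      have hA' := hT.typing_rename (T := .univalent) hr.right
      have hA₀ := hT.typing_rename (T := .univalent) hr.left
      have ht := hp.param_of_rel (hp.tr_typing hT hr) hA₀ hA'
      refine ⟨⟨i, hT.mono fun n hn => ⟨(Nat.le_succ k).trans hn.1, hn.2⟩⟩, ?_⟩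
      rw [hb₁, hc₁]
      -- The declared type of the third variable is only convertible to the relation, so the
      -- conversion rule needs the relation to be well-formed; this is what `ht` ensures.
      exact .conv (.var hBR) (.conv hc)
        (rel_typing ht (.var (by rwa [rename_id])) (.var hB'))
termination_by Γ.length - k

/-- The univalent abstraction theorem. -/
theorem univalent_abstraction {p : Combinators} (hp : p.IsUnivalent) {Γ : Ctx} {Ξ : PCtx}
    {M A M' MR A' AR : Term} (h : Admissible p Γ Ξ) (hM : Typing .ccω Γ M A)
    (hMR : UParam p Ξ M M' MR) (hAR : UParam p Ξ A A' AR) :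
    Typing .ccω Γ M' A' ∧ Typing .univalent Γ MR (rel AR M M') := by
  obtain ⟨b, c, hΞ⟩ := h.wf_pctx.exists_fun
  obtain ⟨rfl, rfl, hf⟩ := hMR.eq_tr hΞ (rename_id M).symm
  obtain ⟨rfl, rfl, hf'⟩ := hAR.eq_tr hΞ (rename_id A).symm
  -- With bound 0, all the translated variables are interpreted.
  obtain ⟨hv, hr⟩ := h.related hp hΞ 0
  have hT := Ty.of_typing_of_fv hM hv (hf.mono fun n hn => ⟨Nat.zero_le n, hn⟩)
    (hf'.mono fun n hn => ⟨Nat.zero_le n, hn⟩)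
  refine ⟨hT.typing_rename hr.right, ?_⟩
  have := hp.tr_typing hT hr
  rwa [rename_id] at this

end Trocq

theorem mainTheorem6 :
    (∃ p : Trocq.Combinators, p.IsUnivalent) ∧
    ∀ p : Trocq.Combinators, p.IsUnivalent →
      ∀ (Γ : Trocq.Ctx) (Ξ : Trocq.PCtx) (M A M' MR A' AR : Trocq.Term),
        Trocq.Admissible p Γ Ξ →
        Trocq.Typing .ccω Γ M A →
        Trocq.UParam p Ξ M M' MR →
        Trocq.UParam p Ξ A A' AR →
        Trocq.Typing .ccω Γ M' A' ∧
        Trocq.Typing .univalent Γ MR (Trocq.Term.rel AR M M') := by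
  exact ⟨Trocq.exists_isUnivalent, fun _ hp _ _ _ _ _ _ _ _ h hM hMR hAR =>
    Trocq.univalent_abstraction hp h hM hMR hAR⟩
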